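/- Work over $\mathbb{C}$; a variety is a reduced separated scheme of finite type over $\mathbb C$, given by its complex points. Let $G$ be an algebraic group acting algebraically on a variety $X$, let $V$ be a $G$-equivariant algebraic vector bundle on $X$, and let $g_1,g_2$ be elements of a common subgroup of $G$ that is compact in the classical (analytic) topology. Let $X^{g_1,g_2}=\{x\in X : g_1x=g_2x=x\}$, a closed subvariety, let $Z=Z_G(g_1,g_2)$ be the centralizer of $g_1$ and $g_2$ in $G$, which acts on $X^{g_1,g_2}$, and let $K_Z(X^{g_1,g_2})$ be the Grothendieck group of $Z$-equivariant vector bundles on $X^{g_1,g_2}$. For $g$ in the subgroup generated by $g_1,g_2$ and for $\alpha\in[0,1)$ let $V_{g,\alpha}\subseteq V|_{X^{g_1,g_2}}$ be the eigenbundle on which $g$ acts as $e^{2\pi i\alpha}$, and define the logarithmic trace $$L(g)(V|_{X^{g_1,g_2}})=\sum_{\alpha\in[0,1)}\alpha\,[V_{g,\alpha}]\in K_Z(X^{g_1,g_2})\otimes_{\mathbb Z}\mathbb R .$$ Then these logarithmic traces are well defined ($V|_{X^{g_1,g_2}}$ and the $V_{g,\alpha}$ are $Z$-equivariant vector bundles,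 only finitely many $V_{g,\alpha}$ are nonzero, and they span $V|_{X^{g_1,g_2}}$ fibrewise), and the virtual classes $$V^+(g_1,g_2)=L(g_1)(V|_{X^{g_1,g_2}})+L(g_2)(V|_{X^{g_1,g_2}})-L(g_1g_2)(V|_{X^{g_1,g_2}}),$$ $$V^-(g_1,g_2)=L(g_1^{-1})(V|_{X^{g_1,g_2}})+L(g_2^{-1})(V|_{X^{g_1,g_2}})-L(g_2^{-1}g_1^{-1})(V|_{X^{g_1,g_2}})$$ are represented by non-negative integral elements of $K_Z(X^{g_1,g_2})$: each of them is the image in $K_Z(X^{g_1,g_2})\otimes\mathbb R$ of the class of a $Z$-equivariant vector bundle on $X^{g_1,g_2}$. -/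

import Mathlib

open scoped TensorProduct

universe u v w

/-! # Complex varieties as spaces with functions -/

/-- A topological space with a sheaf of complex valued functions. `RegAt f x` means that `f` is a
section of the sheaf on some neighbourhood of `x`; the sections over an open set `U` are the
functions that are regular at all points of `U`, so the gluing axiom is automatic. -/
structure FunSpace (X : Type u) where
  top : TopologicalSpace X
  RegAt : (X → ℂ) → X → Prop
  congr' : ∀ {f g : X → ℂ} {x : X}, RegAt f x → (∀ᶠ y in @nhds X top x, f y = g y) → RegAt g x
  nearby : ∀ {f : X → ℂ} {x : X}, RegAt f x → ∀ᶠ y in @nhds X top x, RegAt f y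

namespace FunSpace

/-- `U` is open in the given (Zariski) topology. -/
def Open {X : Type u} (𝒳 : FunSpace X) (U : Set X) : Prop := @IsOpen X 𝒳.top U

/-- `f` is a regular function on `U`. -/
def RegOn {X : Type u} (𝒳 : FunSpace X) (f : X → ℂ) (U : Set X) : Prop := ∀ x ∈ U, 𝒳.RegAt f x

/-- Morphisms: continuous maps that pull regular functions back to regular functions. -/
def IsMorphism {X : Type u} {Y : Type v} (𝒳 : FunSpace X) (𝒴 : FunSpace Y) (φ : X → Y) : Prop :=
  @Continuous X Y 𝒳.top 𝒴.top φ ∧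
    ∀ (f : Y → ℂ) (x : X), 𝒴.RegAt f (φ x) → 𝒳.RegAt (f ∘ φ) x

/-- Isomorphism of spaces with functions. -/
def IsIsomorphic {X : Type u} {Y : Type v} (𝒳 : FunSpace X) (𝒴 : FunSpace Y) : Prop :=
  ∃ e : X ≃ Y, IsMorphism 𝒳 𝒴 e ∧ IsMorphism 𝒴 𝒳 e.symm

/-- A subset with the induced topology and the induced sheaf: a function is regular if it is
locally the restriction of a regular function. -/
def sub {X : Type u} (𝒳 : FunSpace X) (S : Set X) : FunSpace S where
  top := 𝒳.top.induced Subtype.val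
  RegAt f x := ∃ F : X → ℂ, 𝒳.RegAt F x ∧
    ∀ᶠ y in @nhds S (𝒳.top.induced Subtype.val) x, f y = F y
  congr' := by
    rintro f g x ⟨F, hF, h⟩ hfg
    refine ⟨F, hF, ?_⟩
    filter_upwards [h, hfg] with y h1 h2
    rw [← h2, h1]
  nearby := by
    rintro f x ⟨F, hF, h⟩
    let _ := 𝒳.top
    have h1 : ∀ᶠ y : S in nhds x, 𝒳.RegAt F y :=
      continuous_subtype_val.continuousAt.eventually (𝒳.nearby hF)
    filter_upwards [h1, h.eventually_nhds] with y hy hy'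
    exact ⟨F, hy, hy'⟩

/-- Affine `n`-space: the topology is generated by the sets where a polynomial does not vanish,
and the regular functions are locally quotients of polynomials. -/
def affineSpace (n : ℕ) : FunSpace (Fin n → ℂ) where
  top := TopologicalSpace.generateFrom
    {U | ∃ q : MvPolynomial (Fin n) ℂ, U = {z | MvPolynomial.eval z q ≠ 0}}
  RegAt f x := ∃ p q : MvPolynomial (Fin n) ℂ, MvPolynomial.eval x q ≠ 0 ∧
    ∀ᶠ z in @nhds _ (TopologicalSpace.generateFrom
      {U | ∃ q : MvPolynomial (Fin n) ℂ, U = {z | MvPolynomial.eval z q ≠ 0}}) x,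
      f z = MvPolynomial.eval z p / MvPolynomial.eval z q
  congr' := by
    rintro f g x ⟨p, q, hq, h⟩ hfg
    refine ⟨p, q, hq, ?_⟩
    filter_upwards [h, hfg] with y h1 h2
    rw [← h2, h1]
  nearby := by
    rintro f x ⟨p, q, hq, h⟩
    let _ : TopologicalSpace (Fin n → ℂ) := TopologicalSpace.generateFrom
      {U | ∃ q : MvPolynomial (Fin n) ℂ, U = {z | MvPolynomial.eval z q ≠ 0}}
    have h1 : ∀ᶠ z in nhds x, MvPolynomial.eval z q ≠ 0 :=
      IsOpen.mem_nhds (TopologicalSpace.isOpen_generateFrom_of_mem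
        (show {z | MvPolynomial.eval z q ≠ 0} ∈ _ from ⟨q, rfl⟩)) hq
    filter_upwards [h1, h.eventually_nhds] with y hy hy'
    exact ⟨p, q, hy, hy'⟩

/-- `N` is given on `U ×ˢ V` by a finite sum `∑ fᵢ(x) gᵢ(y)` with `fᵢ` regular on `U` and `gᵢ`
regular on `V`. -/
def IsTensorOn {X : Type u} {Y : Type v} (𝒳 : FunSpace X) (𝒴 : FunSpace Y) (U : Set X) (V : Set Y)
    (N : X × Y → ℂ) : Prop :=
  ∃ (n : ℕ) (f : Fin n → X → ℂ) (g : Fin n → Y → ℂ),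
    (∀ i, 𝒳.RegOn (f i) U) ∧ (∀ i, 𝒴.RegOn (g i) V) ∧
      ∀ x ∈ U, ∀ y ∈ V, N (x, y) = ∑ i, f i x * g i y

/-- The (Zariski) topology of the product: generated by the sets of all points of `U ×ˢ V` at which
some `∑ fᵢ(x) gᵢ(y)` does not vanish. -/
abbrev prodTop {X : Type u} {Y : Type v} (𝒳 : FunSpace X) (𝒴 : FunSpace Y) :
    TopologicalSpace (X × Y) :=
  TopologicalSpace.generateFrom
    {W | ∃ (U : Set X) (V : Set Y) (N : X × Y → ℂ), 𝒳.Open U ∧ 𝒴.Open V ∧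
      IsTensorOn 𝒳 𝒴 U V N ∧ W = {p | p.1 ∈ U ∧ p.2 ∈ V ∧ N p ≠ 0}}

/-- The product of two spaces with functions: regular functions are locally quotients of functions
of the form `∑ fᵢ(x) gᵢ(y)`. -/
def prod {X : Type u} {Y : Type v} (𝒳 : FunSpace X) (𝒴 : FunSpace Y) : FunSpace (X × Y) where
  top := prodTop 𝒳 𝒴
  RegAt h p := ∃ (U : Set X) (V : Set Y) (N D : X × Y → ℂ), 𝒳.Open U ∧ 𝒴.Open V ∧
    p.1 ∈ U ∧ p.2 ∈ V ∧ IsTensorOn 𝒳 𝒴 U V N ∧ IsTensorOn 𝒳 𝒴 U V D ∧ D p ≠ 0 ∧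
      ∀ᶠ q in @nhds _ (prodTop 𝒳 𝒴) p, h q = N q / D q
  congr' := by
    rintro f g p ⟨U, V, N, D, hU, hV, hpU, hpV, hN, hD, hp, h⟩ hfg
    refine ⟨U, V, N, D, hU, hV, hpU, hpV, hN, hD, hp, ?_⟩
    filter_upwards [h, hfg] with y h1 h2
    rw [← h2, h1]
  nearby := by
    rintro f p ⟨U, V, N, D, hU, hV, hpU, hpV, hN, hD, hp, h⟩
    let _ : TopologicalSpace (X × Y) := prodTop 𝒳 𝒴
    have h1 : ∀ᶠ q in nhds p, q.1 ∈ U ∧ q.2 ∈ V ∧ D q ≠ 0 :=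
      IsOpen.mem_nhds (TopologicalSpace.isOpen_generateFrom_of_mem
        (show {q : X × Y | q.1 ∈ U ∧ q.2 ∈ V ∧ D q ≠ 0} ∈ _ from ⟨U, V, D, hU, hV, hD, rfl⟩))
        ⟨hpU, hpV, hp⟩
    filter_upwards [h1, h.eventually_nhds] with q hq hq'
    exact ⟨U, V, N, D, hU, hV, hq.1, hq.2.1, hN, hD, hq.2.2, hq'⟩

/-- Affine varieties: isomorphic to the zero locus of a set of polynomials in affine space. -/
def IsAffine {X : Type u} (𝒳 : FunSpace X) : Prop :=
  ∃ (n : ℕ) (P : Set (MvPolynomial (Fin n) ℂ)),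
    IsIsomorphic 𝒳 ((affineSpace n).sub {z | ∀ p ∈ P, MvPolynomial.eval z p = 0})

/-- Complex algebraic varieties (reduced, separated and of finite type, not necessarily
irreducible), given by their complex points: quasi-compact, locally affine, with closed diagonal. -/
structure IsVariety {X : Type u} (𝒳 : FunSpace X) : Prop where
  quasiCompact : @CompactSpace X 𝒳.top
  locallyAffine : ∀ x : X, ∃ U : Set X, 𝒳.Open U ∧ x ∈ U ∧ (𝒳.sub U).IsAffine
  separated : (prod 𝒳 𝒳).Open {p | p.1 ≠ p.2}

/-- The analytic (classical) topology: the coarsest one in which the Zariski open sets are open and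
the regular functions on them are continuous for the usual topology of `ℂ`. -/
abbrev analyticTop {X : Type u} (𝒳 : FunSpace X) : TopologicalSpace X :=
  TopologicalSpace.generateFrom
    {W | ∃ (U : Set X) (f : X → ℂ) (O : Set ℂ), 𝒳.Open U ∧ 𝒳.RegOn f U ∧ IsOpen O ∧
      W = {x | x ∈ U ∧ f x ∈ O}}

/-- Algebraic groups: varieties with a group structure given by morphisms. -/
structure IsAlgebraicGroup {G : Type u} [Group G] (𝒢 : FunSpace G) : Prop where
  variety : 𝒢.IsVariety
  mul : IsMorphism (prod 𝒢 𝒢) 𝒢 (fun p => p.1 * p.2)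
  inv : IsMorphism 𝒢 𝒢 (fun g => g⁻¹)

/-- The action of `G` on `X` is algebraic. -/
def IsAlgebraicAction {G : Type u} [Group G] (𝒢 : FunSpace G) {X : Type v} [MulAction G X]
    (𝒳 : FunSpace X) : Prop :=
  IsMorphism (prod 𝒢 𝒳) 𝒳 (fun p => p.1 • p.2)

end FunSpace

/-! # Equivariant vector bundles -/

/-- A family of complex vector spaces over `X` with a notion of regular section (near a point). -/
structure BundleData (X : Type u) where
  fib : X → Type w
  [addCommGroup : ∀ x, AddCommGroup (fib x)]
  [module : ∀ x, Module ℂ (fib x)]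
  RegAt : (∀ x, fib x) → X → Prop

attribute [instance] BundleData.addCommGroup BundleData.module

namespace BundleData

/-- The family is an algebraic vector bundle: locally there is a frame, that is, finitely many
sections which form a basis of every fibre and such that the regular sections are exactly the
combinations of the frame with regular coefficients. -/
def IsVectorBundle {X : Type u} (𝒳 : FunSpace X) (E : BundleData.{u, w} X) : Prop :=
  ∀ x₀ : X, ∃ (U : Set X) (n : ℕ) (e : Fin n → ∀ x, E.fib x), 𝒳.Open U ∧ x₀ ∈ U ∧
    (∀ x ∈ U, LinearIndependent ℂ (fun i => e i x) ∧
      Submodule.span ℂ (Set.range fun i => e i x) = ⊤) ∧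
    ∀ (s : ∀ x, E.fib x), ∀ x ∈ U, E.RegAt s x ↔
      ∃ c : Fin n → X → ℂ, (∀ i, 𝒳.RegAt (c i) x) ∧
        ∀ᶠ y in @nhds X 𝒳.top x, s y = ∑ i, c i y • e i y

/-- The pull back of `E` along `φ : Y → X`; its regular sections are locally the combinations, with
regular coefficients, of pull backs of regular sections of `E`. -/
def pullback {X : Type u} {Y : Type v} (𝒴 : FunSpace Y) (φ : Y → X) (E : BundleData.{u, w} X) :
    BundleData.{v, w} Y where
  fib y := E.fib (φ y)
  RegAt s y := ∃ (n : ℕ) (c : Fin n → Y → ℂ) (σ : Fin n → ∀ x, E.fib x),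
    (∀ i, 𝒴.RegAt (c i) y) ∧ (∀ i, E.RegAt (σ i) (φ y)) ∧
      ∀ᶠ z in @nhds Y 𝒴.top y, s z = ∑ i, c i z • σ i (φ z)

/-- A family of linear maps is a homomorphism of bundles if it maps regular sections to regular
sections. -/
def IsHom {X : Type u} (E F : BundleData.{u, w} X) (φ : ∀ x, E.fib x →ₗ[ℂ] F.fib x) : Prop :=
  ∀ (s : ∀ x, E.fib x) (x : X), E.RegAt s x → F.RegAt (fun y => φ y (s y)) x

end BundleData

/-- Bundle data on a `G`-set `X` together with linear maps `E_x → E_{gx}` that lift the action of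
`G`. -/
structure EqBundleData (G : Type v) [Group G] (X : Type u) [MulAction G X] extends
    BundleData.{u, w} X where
  act : ∀ (g : G) {x y : X}, g • x = y → (fib x →ₗ[ℂ] fib y)
  act_one : ∀ {x : X} (h : (1 : G) • x = x) (a : fib x), act 1 h a = a
  act_mul : ∀ (g' g : G) {x y z : X} (h : g • x = y) (h' : g' • y = z) (h'' : (g' * g) • x = z)
    (a : fib x), act (g' * g) h'' a = act g' h' (act g h a)

namespace EqBundleData

/-- `E` is a `G`-equivariant algebraic vector bundle: it is a vector bundle, and the action
is a homomorphism from the pull back of `E` along the projection `G × X → X` to the pull back of `E`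
along the action map `G × X → X`. -/
structure IsEquivariantBundle {G : Type v} [Group G] {X : Type u} [MulAction G X]
    (𝒢 : FunSpace G) (𝒳 : FunSpace X) (E : EqBundleData.{u, v, w} G X) : Prop where
  isVectorBundle : E.toBundleData.IsVectorBundle 𝒳
  act_regular : BundleData.IsHom
    (BundleData.pullback (FunSpace.prod 𝒢 𝒳) (fun p : G × X => p.2) E.toBundleData)
    (BundleData.pullback (FunSpace.prod 𝒢 𝒳) (fun p : G × X => p.1 • p.2) E.toBundleData)
    (fun p => E.act p.1 rfl)

/-- Homomorphisms of equivariant bundles. -/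
def IsEqHom {G : Type v} [Group G] {X : Type u} [MulAction G X]
    (E F : EqBundleData.{u, v, w} G X) (φ : ∀ x, E.fib x →ₗ[ℂ] F.fib x) : Prop :=
  BundleData.IsHom E.toBundleData F.toBundleData φ ∧
    ∀ (g : G) (x y : X) (h : g • x = y) (a : E.fib x), φ y (E.act g h a) = F.act g h (φ x a)

/-- There is a short exact sequence `0 → A → B → C → 0` of equivariant bundles. -/
def ShortExact {G : Type v} [Group G] {X : Type u} [MulAction G X]
    (A B C : EqBundleData.{u, v, w} G X) : Prop :=
  ∃ (i : ∀ x, A.fib x →ₗ[ℂ] B.fib x) (p : ∀ x, B.fib x →ₗ[ℂ] C.fib x),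
    IsEqHom A B i ∧ IsEqHom B C p ∧
      ∀ x, Function.Injective (i x) ∧ Function.Surjective (p x) ∧
        LinearMap.range (i x) = LinearMap.ker (p x)

end EqBundleData

/-- The `G`-equivariant vector bundles on `X`. -/
def EqVB {G : Type v} [Group G] {X : Type u} [MulAction G X] (𝒢 : FunSpace G) (𝒳 : FunSpace X) :
    Type (max u v (w + 1)) :=
  {E : EqBundleData.{u, v, w} G X // E.IsEquivariantBundle 𝒢 𝒳}

/-- The relations `[B] - [A] - [C]` for short exact sequences `0 → A → B → C → 0`. -/
def KRelations {G : Type v} [Group G] {X : Type u} [MulAction G X]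
    (𝒢 : FunSpace G) (𝒳 : FunSpace X) : AddSubgroup (FreeAbelianGroup (EqVB.{u, v, w} 𝒢 𝒳)) :=
  AddSubgroup.closure {r | ∃ A B C : EqVB.{u, v, w} 𝒢 𝒳, EqBundleData.ShortExact A.1 B.1 C.1 ∧
    r = FreeAbelianGroup.of B - FreeAbelianGroup.of A - FreeAbelianGroup.of C}

/-- The Grothendieck group `K_G(X)` of `G`-equivariant vector bundles on `X`. -/
abbrev KGroup {G : Type v} [Group G] {X : Type u} [MulAction G X]
    (𝒢 : FunSpace G) (𝒳 : FunSpace X) : Type (max u v (w + 1)) :=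
  FreeAbelianGroup (EqVB.{u, v, w} 𝒢 𝒳) ⧸ KRelations.{u, v, w} 𝒢 𝒳

/-- The class in `K_G(X)` of an equivariant vector bundle. -/
def EqVB.cls {G : Type v} [Group G] {X : Type u} [MulAction G X]
    {𝒢 : FunSpace G} {𝒳 : FunSpace X} (E : EqVB.{u, v, w} 𝒢 𝒳) : KGroup.{u, v, w} 𝒢 𝒳 :=
  QuotientAddGroup.mk (FreeAbelianGroup.of E)

/-! # The logarithmic trace -/

namespace EqBundleData

/-- A fibrewise linear endomorphism that commutes with the group action. -/
structure FibreEnd {G : Type v} [Group G] {X : Type u} [MulAction G X]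
    (E : EqBundleData.{u, v, w} G X) where
  toFun : ∀ x, Module.End ℂ (E.fib x)
  comm : ∀ (g : G) {x y : X} (h : g • x = y) (a : E.fib x),
    toFun y (E.act g h a) = E.act g h (toFun x a)

/-- The eigenbundle of `T` for the eigenvalue `exp (2 π i α)`, as a subbundle of `E`. -/
noncomputable def eigenbundle {G : Type v} [Group G] {X : Type u} [MulAction G X]
    (E : EqBundleData.{u, v, w} G X) (T : E.FibreEnd) (α : ℝ) : EqBundleData.{u, v, w} G X where
  fib x := (T.toFun x).eigenspace (Complex.exp (2 * Real.pi * Complex.I * α))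
  RegAt s x := E.RegAt (fun y => (s y : E.fib y)) x
  act g {x y} h := (E.act g h).restrict (by
    intro a ha
    rw [Module.End.mem_eigenspace_iff] at ha ⊢
    rw [T.comm, ha, map_smul])
  act_one h a := Subtype.ext (E.act_one h a)
  act_mul g' g _ _ _ h h' h'' a := Subtype.ext (E.act_mul g' g h h' h'' a)

open Classical in
/-- The class in `K_G(X)` of `E` (with the value `0` if `E` is not an equivariant bundle). -/
noncomputable def cls {G : Type v} [Group G] {X : Type u} [MulAction G X]
    (𝒢 : FunSpace G) (𝒳 : FunSpace X) (E : EqBundleData.{u, v, w} G X) : KGroup.{u, v, w} 𝒢 𝒳 :=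
  if h : E.IsEquivariantBundle 𝒢 𝒳 then EqVB.cls ⟨E, h⟩ else 0

/-- The logarithmic trace `∑ α • [E_α] ∈ K_G(X) ⊗ ℝ`, the sum being over the `α ∈ [0, 1)` for which
`exp (2 π i α)` is an eigenvalue, and `E_α` being the corresponding eigenbundle. -/
noncomputable def logTrace {G : Type v} [Group G] {X : Type u} [MulAction G X]
    (𝒢 : FunSpace G) (𝒳 : FunSpace X) (E : EqBundleData.{u, v, w} G X) (T : E.FibreEnd) :
    ℝ ⊗[ℤ] KGroup.{u, v, w} 𝒢 𝒳 :=
  ∑ᶠ α ∈ Set.Ico (0 : ℝ) 1, α ⊗ₜ[ℤ] (E.eigenbundle T α).cls 𝒢 𝒳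

/-- The logarithmic trace is meaningful: `E` and all eigenbundles are equivariant vector
bundles, only finitely many eigenbundles are nonzero, and `E` is fibrewise the sum of the
eigenbundles with eigenvalues of absolute value one. -/
structure HasLogTrace {G : Type v} [Group G] {X : Type u} [MulAction G X]
    (𝒢 : FunSpace G) (𝒳 : FunSpace X) (E : EqBundleData.{u, v, w} G X) (T : E.FibreEnd) :
    Prop where
  bundle : E.IsEquivariantBundle 𝒢 𝒳
  eigen : ∀ α ∈ Set.Ico (0 : ℝ) 1, (E.eigenbundle T α).IsEquivariantBundle 𝒢 𝒳
  finite : {α ∈ Set.Ico (0 : ℝ) 1 | ∃ x, Nontrivial ((E.eigenbundle T α).fib x)}.Finite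
  span : ∀ x, ⨆ α ∈ Set.Ico (0 : ℝ) 1,
    (T.toFun x).eigenspace (Complex.exp (2 * Real.pi * Complex.I * α)) = ⊤

end EqBundleData

/-! # Fixed loci, centralizers and the classes `V⁺`, `V⁻` -/

/-- The fixed locus `X^{g₁,g₂}`. -/
def fixedLocus {G : Type v} [Group G] (X : Type u) [MulAction G X] (g₁ g₂ : G) : Set X :=
  {x | g₁ • x = x ∧ g₂ • x = x}

/-- The centralizer `Z_G(g₁, g₂)`. -/
abbrev pairCentralizer {G : Type v} [Group G] (g₁ g₂ : G) : Subgroup G :=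
  Subgroup.centralizer {g₁, g₂}

/-- The subgroup generated by `g₁` and `g₂`. -/
abbrev pairSubgroup {G : Type v} [Group G] (g₁ g₂ : G) : Subgroup G :=
  Subgroup.closure {g₁, g₂}

/-- The centralizer of `g₁, g₂` acts on the fixed locus `X^{g₁,g₂}`. -/
instance fixedLocusMulAction {G : Type v} [Group G] {X : Type u} [MulAction G X] (g₁ g₂ : G) :
    MulAction (pairCentralizer g₁ g₂) (fixedLocus X g₁ g₂) where
  smul z x := ⟨(z : G) • (x : X), by
    have h := Subgroup.mem_centralizer_iff.1 z.2
    constructor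
    · rw [← mul_smul, h g₁ (by simp), mul_smul, x.2.1]
    · rw [← mul_smul, h g₂ (by simp), mul_smul, x.2.2]⟩
  one_smul x := Subtype.ext (one_smul G (x : X))
  mul_smul z z' x := Subtype.ext (mul_smul (z : G) (z' : G) (x : X))

theorem pairSubgroup_smul {G : Type v} [Group G] {X : Type u} [MulAction G X] {g₁ g₂ : G}
    (g : pairSubgroup g₁ g₂) (x : fixedLocus X g₁ g₂) : (g : G) • (x : X) = x := by
  have h : pairSubgroup g₁ g₂ ≤ MulAction.stabilizer G (x : X) := by
    rw [Subgroup.closure_le]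
    rintro a (rfl | rfl)
    · exact x.2.1
    · exact x.2.2
  exact h g.2

theorem pairSubgroup_comm {G : Type v} [Group G] {g₁ g₂ : G}
    (g : pairSubgroup g₁ g₂) (z : pairCentralizer g₁ g₂) : (g : G) * z = z * g := by
  have h : pairSubgroup g₁ g₂ ≤ Subgroup.centralizer {(z : G)} := by
    rw [Subgroup.closure_le]
    intro a ha
    rw [SetLike.mem_coe, Subgroup.mem_centralizer_iff]
    rintro _ rfl
    exact (Subgroup.mem_centralizer_iff.1 z.2 a ha).symm
  exact (Subgroup.mem_centralizer_iff.1 (h g.2) z rfl).symm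

/-- `g₁`, as an element of the subgroup generated by `g₁` and `g₂`. -/
def pairFst {G : Type v} [Group G] (g₁ g₂ : G) : pairSubgroup g₁ g₂ :=
  ⟨g₁, Subgroup.subset_closure (by simp)⟩

/-- `g₂`, as an element of the subgroup generated by `g₁` and `g₂`. -/
def pairSnd {G : Type v} [Group G] (g₁ g₂ : G) : pairSubgroup g₁ g₂ :=
  ⟨g₂, Subgroup.subset_closure (by simp)⟩

/-- The induced algebraic structure on the centralizer. -/
abbrev centralizerSpace {G : Type v} [Group G] (𝒢 : FunSpace G) (g₁ g₂ : G) :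
    FunSpace (pairCentralizer g₁ g₂) :=
  𝒢.sub (pairCentralizer g₁ g₂ : Set G)

/-- The induced algebraic structure on the fixed locus. -/
abbrev fixedSpace {G : Type v} [Group G] {X : Type u} [MulAction G X] (𝒳 : FunSpace X)
    (g₁ g₂ : G) : FunSpace (fixedLocus X g₁ g₂) :=
  𝒳.sub (fixedLocus X g₁ g₂)

namespace EqBundleData

/-- The restriction of a `G`-equivariant bundle to `X^{g₁,g₂}`, as a `Z_G(g₁,g₂)`-equivariant
bundle. -/
def restrictFixed {G : Type v} [Group G] {X : Type u} [MulAction G X] (𝒳 : FunSpace X)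
    (V : EqBundleData.{u, v, w} G X) (g₁ g₂ : G) :
    EqBundleData.{u, v, w} (pairCentralizer g₁ g₂) (fixedLocus X g₁ g₂) where
  toBundleData := V.toBundleData.pullback (fixedSpace 𝒳 g₁ g₂) Subtype.val
  act z _ _ h := V.act (z : G) (congrArg Subtype.val h)
  act_one h a := V.act_one (congrArg Subtype.val h) a
  act_mul z' z _ _ _ h h' h'' a := V.act_mul (z' : G) (z : G) (congrArg Subtype.val h)
    (congrArg Subtype.val h') (congrArg Subtype.val h'') a

/-- The automorphism of the fibres of `V|_{X^{g₁,g₂}}` given by an element `g` of the subgroup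
generated by `g₁` and `g₂`. -/
def fibreAut {G : Type v} [Group G] {X : Type u} [MulAction G X] (𝒳 : FunSpace X)
    (V : EqBundleData.{u, v, w} G X) (g₁ g₂ : G) (g : pairSubgroup g₁ g₂) :
    (V.restrictFixed 𝒳 g₁ g₂).FibreEnd where
  toFun x := V.act (g : G) (pairSubgroup_smul g x)
  comm z x y h a := by
    have hz : (z : G) • (x : X) = y := congrArg Subtype.val h
    have h1 : ((g : G) * (z : G)) • (x : X) = y := by
      rw [mul_smul, hz, pairSubgroup_smul g y]
    have h2 : ((z : G) * (g : G)) • (x : X) = y := by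
      rw [mul_smul, pairSubgroup_smul g x, hz]
    have e : ∀ (k k' : G) (hk : k • (x : X) = y) (hk' : k' • (x : X) = y), k = k' →
        V.act k hk a = V.act k' hk' a := by
      rintro k k' hk hk' rfl
      rfl
    exact (V.act_mul g z hz (pairSubgroup_smul g y) h1 a).symm.trans
      ((e _ _ h1 h2 (pairSubgroup_comm g z)).trans
        (V.act_mul z g (pairSubgroup_smul g x) hz h2 a))

/-- `L(g)(V|_{X^{g₁,g₂}})`, an element of `K_Z(X^{g₁,g₂}) ⊗ ℝ`. -/
noncomputable def fixedLogTrace {G : Type v} [Group G] {X : Type u} [MulAction G X]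
    (𝒢 : FunSpace G) (𝒳 : FunSpace X) (V : EqBundleData.{u, v, w} G X) (g₁ g₂ : G)
    (g : pairSubgroup g₁ g₂) :
    ℝ ⊗[ℤ] KGroup.{u, v, w} (centralizerSpace 𝒢 g₁ g₂) (fixedSpace 𝒳 g₁ g₂) :=
  (V.restrictFixed 𝒳 g₁ g₂).logTrace (centralizerSpace 𝒢 g₁ g₂) (fixedSpace 𝒳 g₁ g₂)
    (V.fibreAut 𝒳 g₁ g₂ g)

/-- `V⁺(g₁,g₂) = L(g₁)(V) + L(g₂)(V) - L(g₁g₂)(V)` on `X^{g₁,g₂}`. -/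
noncomputable def plusClass {G : Type v} [Group G] {X : Type u} [MulAction G X]
    (𝒢 : FunSpace G) (𝒳 : FunSpace X) (V : EqBundleData.{u, v, w} G X) (g₁ g₂ : G) :
    ℝ ⊗[ℤ] KGroup.{u, v, w} (centralizerSpace 𝒢 g₁ g₂) (fixedSpace 𝒳 g₁ g₂) :=
  V.fixedLogTrace 𝒢 𝒳 g₁ g₂ (pairFst g₁ g₂) + V.fixedLogTrace 𝒢 𝒳 g₁ g₂ (pairSnd g₁ g₂)
    - V.fixedLogTrace 𝒢 𝒳 g₁ g₂ (pairFst g₁ g₂ * pairSnd g₁ g₂)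

/-- `V⁻(g₁,g₂) = L(g₁⁻¹)(V) + L(g₂⁻¹)(V) - L(g₂⁻¹g₁⁻¹)(V)` on `X^{g₁,g₂}`. -/
noncomputable def minusClass {G : Type v} [Group G] {X : Type u} [MulAction G X]
    (𝒢 : FunSpace G) (𝒳 : FunSpace X) (V : EqBundleData.{u, v, w} G X) (g₁ g₂ : G) :
    ℝ ⊗[ℤ] KGroup.{u, v, w} (centralizerSpace 𝒢 g₁ g₂) (fixedSpace 𝒳 g₁ g₂) :=
  V.fixedLogTrace 𝒢 𝒳 g₁ g₂ (pairFst g₁ g₂)⁻¹ + V.fixedLogTrace 𝒢 𝒳 g₁ g₂ (pairSnd g₁ g₂)⁻¹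
    - V.fixedLogTrace 𝒢 𝒳 g₁ g₂ ((pairSnd g₁ g₂)⁻¹ * (pairFst g₁ g₂)⁻¹)

end EqBundleData

/-!
# Positivity of the virtual classes `V⁺(g₁, g₂)` and `V⁻(g₁, g₂)`

Let `F = X^{g₁,g₂}`, let `W = V|_F`, and let `Γ` be the group generated by `g₁` and `g₂`; it acts on
every fibre of `W`, by endomorphisms of the `Z_G(g₁,g₂)`-equivariant bundle `W`.

*Reduction to matrices.* The action on `V` has regular matrix coefficients, and `Γ` lies in a compact
group, so `Γ` acts on each fibre `W_y` by a bounded group of matrices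
(`EqBundleData.fibreRep_bounded`) and is unitary in a suitable basis (`exists_conj_mem_unitaryGroup`).
The characters `y ↦ tr (γ | W_y)` are therefore regular functions on `F` that are bounded by the rank.
A regular function that is bounded near a point in the Zariski topology is constant near it
(`FunSpace.IsVariety.eventually_eq_of_bounded`, a form of the Nullstellensatz), and `F` is Noetherian,
so only finitely many characters occur (`EqBundleData.exists_finset_characters`). Since unitarity
makes `tr (a* a)` a definite form that depends only on the characters, the algebra `𝔄` generated by
`Γ` in `∏ End (W_y)` is finite dimensional and semisimple, that is, a product of matrix algebras
`Mat_{d_i}`, in each of which `Γ` is again unitarizable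
(`exists_algEquiv_pi_matrix_groupAlgebraImage`).

*Classes of idempotents.* The image of an idempotent of `𝔄` is an equivariant subbundle of `W`. Its
class is additive on orthogonal idempotents and is the same for equivalent idempotents
(`EqBundleData.isIdempotentAdditive_cls_image`), so on `∏ Mat_{d_i}` it is `∑ rank_i • κ_i` for fixed
classes `κ_i` (`IsIdempotentAdditive.apply_conj_diagonal`). The eigenbundles of `γ ∈ Γ` are the images
of its spectral projections, hence `L(γ) = ∑ ℓ(γ_i) ⊗ κ_i`, where `γ_i ∈ Mat_{d_i}` are the components
of `γ` and the logarithmic degree `ℓ` of a matrix is the sum of the angles in `[0, 1)` of its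
eigenvalues (`logDegree`).

*The numbers.* It remains to see that `ℓ(A) + ℓ(B) - ℓ(AB)` is an integer between `0` and `d` for
unitary `d × d` matrices (`exists_nat_logDegree_mul`). It is an integer because `exp (2πiℓ)` is the
determinant. For the bounds `B` may be taken diagonal, and its entries are changed one at a time: two
unitary matrices that agree on a hyperplane have interlacing eigenvalues, so their logarithmic degrees
differ by less than `1` (`logDegree_lt_add_one`). If `k_i` is this integer for the components of `a` and
`b` in `Mat_{d_i}`, then `L(a) + L(b) - L(ab) = ∑ k_i κ_i` is the class of the image of an idempotent
of `𝔄` with ranks `k_i ≤ d_i`.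
-/

/-! ### Bounded groups of matrices are unitarizable -/

section Unitarize

open scoped ComplexOrder MatrixOrder

open Matrix

variable {n : Type*} [Fintype n] [DecidableEq n]

/-- Strict log-concavity of the determinant at the identity: among the positive definite matrices of
determinant one, the identity is the only one whose midpoint with `1` has determinant at most
one. -/
theorem Matrix.PosDef.eq_one_of_det_midpoint_le {Q : Matrix n n ℂ} (hQ : Q.PosDef)
    (hdet : Q.det = 1) (hmid : (((1 / 2 : ℂ) • (1 + Q)).det).re ≤ 1) : Q = 1 := by
  set l := hQ.1.eigenvalues with hl
  have hspec := hQ.1.spectral_theorem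
  rw [Unitary.conjStarAlgAut_apply] at hspec
  set U : Matrix n n ℂ := (hQ.1.eigenvectorUnitary : Matrix n n ℂ) with hU
  have hUU : U * star U = 1 := Unitary.mul_star_self_of_mem hQ.1.eigenvectorUnitary.2
  have hpos : ∀ i, 0 < l i := hQ.eigenvalues_pos
  have hprod : ∏ i, l i = 1 := by
    have := hQ.1.det_eq_prod_eigenvalues
    rw [hdet] at this
    exact Complex.ofReal_injective (by
      rw [Complex.ofReal_one, this, Complex.ofReal_prod]; rfl)
  have hm : ((1 / 2 : ℂ) • (1 + Q)) =
      U * diagonal (fun i => ((((1 + l i) / 2 : ℝ)) : ℂ)) * star U := by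
    have h1 : (diagonal (fun i => ((((1 + l i) / 2 : ℝ)) : ℂ)) : Matrix n n ℂ)
        = (1 / 2 : ℂ) • (1 + diagonal (RCLike.ofReal ∘ l)) := by
      ext i j
      by_cases h : i = j
      · subst h; simp; ring
      · simp [h]
    rw [h1, mul_smul_comm, smul_mul_assoc, mul_add, add_mul, mul_one, hUU]
    conv_lhs => rw [hspec]
  have hd : ((1 / 2 : ℂ) • (1 + Q)).det = ((∏ i, (1 + l i) / 2 : ℝ) : ℂ) := by
    rw [hm, det_mul_comm, ← mul_assoc, (mul_eq_one_comm.1 hUU), one_mul, det_diagonal]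
    push_cast
    rfl
  rw [hd, Complex.ofReal_re] at hmid
  have hle : ∀ i, l i ≤ ((1 + l i) / 2) ^ 2 := fun i => by nlinarith [sq_nonneg (l i - 1)]
  have hall : ∀ i, l i = 1 := by
    by_contra! hne
    obtain ⟨i, hi⟩ := hne
    have hlt : ∏ i, l i < ∏ i, ((1 + l i) / 2) ^ 2 := by
      refine Finset.prod_lt_prod (fun i _ => hpos i) (fun i _ => hle i) ⟨i, Finset.mem_univ i, ?_⟩
      have := sq_pos_of_ne_zero (sub_ne_zero.2 hi)
      nlinarith
    rw [hprod, Finset.prod_pow] at hlt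
    have h0 : 0 ≤ ∏ i, (1 + l i) / 2 := Finset.prod_nonneg fun i _ => by linarith [hpos i]
    nlinarith
  rw [hspec]
  have : (diagonal (RCLike.ofReal ∘ hQ.1.eigenvalues) : Matrix n n ℂ) = 1 := by
    ext i j
    by_cases h : i = j
    · subst h; simp [← hl, hall]
    · simp [h]
  rw [this, mul_one, hUU]

/-- A positive definite matrix is the Gram matrix of an invertible matrix. -/
theorem Matrix.PosDef.exists_isUnit_eq {P : Matrix n n ℂ} (hP : P.PosDef) :
    ∃ R : (Matrix n n ℂ)ˣ, P = (R : Matrix n n ℂ)ᴴ * R := by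
  obtain ⟨R, hR⟩ := CStarAlgebra.nonneg_iff_eq_star_mul_self.1 hP.posSemidef.nonneg
  have hu : IsUnit R := by
    have h := hP.isUnit
    rw [hR, Matrix.isUnit_iff_isUnit_det, det_mul] at h
    rw [Matrix.isUnit_iff_isUnit_det]
    exact isUnit_of_mul_isUnit_right h
  exact ⟨hu.unit, hR⟩

/-- Strict log-concavity of the determinant on positive definite matrices: two of them with the same
determinant, which is not exceeded at their midpoint, are equal. The congruence by the inverse of a
square root of `P` reduces this to `P = 1`. -/
theorem Matrix.PosDef.eq_of_det_midpoint_le {P Q : Matrix n n ℂ} (hP : P.PosDef) (hQ : Q.PosDef)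
    (hdet : Q.det = P.det) (hmid : (((1 / 2 : ℂ) • (P + Q)).det).re ≤ P.det.re) : Q = P := by
  obtain ⟨R, hR⟩ := hP.exists_isUnit_eq
  set S : Matrix n n ℂ := ((R⁻¹ : (Matrix n n ℂ)ˣ) : Matrix n n ℂ) with hS
  have hRS : (R : Matrix n n ℂ) * S = 1 := R.mul_inv
  have hSR : S * (R : Matrix n n ℂ) = 1 := R.inv_mul
  have hRS' : Sᴴ * (R : Matrix n n ℂ)ᴴ = 1 := by rw [← conjTranspose_mul, hRS, conjTranspose_one]
  have hSR' : (R : Matrix n n ℂ)ᴴ * Sᴴ = 1 := by rw [← conjTranspose_mul, hSR, conjTranspose_one]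
  have hSP : Sᴴ * P * S = 1 := by
    rw [hR, ← mul_assoc, hRS', one_mul, hRS]
  have hdd : Sᴴ.det * S.det * P.det = 1 := by
    have := congrArg det hSP
    rw [det_mul, det_mul, det_one] at this
    linear_combination this
  have hPim : P.det = (P.det.re : ℂ) := by
    have := hP.det_pos
    rw [Complex.lt_def] at this
    exact Complex.ext rfl (by simpa using this.2.symm)
  have hPre : 0 < P.det.re := by
    have := hP.det_pos
    rw [Complex.lt_def] at this
    exact this.1
  have hdd' : Sᴴ.det * S.det = ((P.det.re⁻¹ : ℝ) : ℂ) := by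
    rw [hPim] at hdd
    push_cast
    exact eq_inv_of_mul_eq_one_left hdd
  have hQ1 : (Sᴴ * Q * S).PosDef := hQ.conjTranspose_mul_mul_same
    (mulVec_injective_iff_isUnit.2 (R⁻¹).isUnit)
  have h1 : Sᴴ * Q * S = 1 := by
    refine hQ1.eq_one_of_det_midpoint_le ?_ ?_
    · rw [det_mul, det_mul, hdet]; linear_combination hdd
    · have : (1 / 2 : ℂ) • (1 + Sᴴ * Q * S) = Sᴴ * ((1 / 2 : ℂ) • (P + Q)) * S := by
        rw [mul_smul_comm, smul_mul_assoc, mul_add, add_mul, hSP]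
      rw [this, det_mul, det_mul, mul_right_comm, hdd', Complex.re_ofReal_mul]
      rw [inv_mul_le_iff₀ hPre, mul_one]
      exact hmid
  calc Q = (R : Matrix n n ℂ)ᴴ * (Sᴴ * Q * S) * R := by
        rw [mul_assoc, mul_assoc, hSR, mul_one, ← mul_assoc, hSR', one_mul]
    _ = P := by rw [h1, mul_one, hR]

/-- A bounded group of complex matrices preserves a positive definite Hermitian form, hence becomes
unitary after a change of basis. The form is the one of largest determinant in the closed convex
hull of the forms `γᴴ γ`; it is unique because the determinant is strictly log-concave. -/
theorem exists_conj_mem_unitaryGroup {Γ : Type*} [Group Γ] (ρ : Γ →* Matrix n n ℂ)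
    (hb : ∀ i j, ∃ C : ℝ, ∀ γ, ‖ρ γ i j‖ ≤ C) :
    ∃ S : (Matrix n n ℂ)ˣ, ∀ γ,
      (S : Matrix n n ℂ) * ρ γ * ((S⁻¹ : (Matrix n n ℂ)ˣ) : Matrix n n ℂ) ∈ unitaryGroup n ℂ := by
  choose C hC using hb
  set G : Set (Matrix n n ℂ) := Set.range fun γ => (ρ γ)ᴴ * ρ γ with hG
  set H : Set (Matrix n n ℂ) := closure (convexHull ℝ G) with hH
  -- the bounds on the entries of `ρ γ` give bounds `B` on the entries of the generating forms
  have hcompact : IsCompact H := by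
    set B : n → n → ℝ := fun i j => ∑ k, C k i * C k j with hB
    set K : Set (Matrix n n ℂ) :=
      Set.univ.pi fun i => Set.univ.pi fun j => Metric.closedBall (0 : ℂ) (B i j) with hK
    have hKc : IsCompact K :=
      isCompact_univ_pi fun i => isCompact_univ_pi fun j => isCompact_closedBall _ _
    have hKconv : Convex ℝ K :=
      convex_pi fun i _ => convex_pi fun j _ => convex_closedBall _ _
    refine hKc.of_isClosed_subset isClosed_closure ?_
    refine closure_minimal (convexHull_min ?_ hKconv) hKc.isClosed
    rintro _ ⟨γ, rfl⟩
    refine Set.mem_univ_pi.2 fun i => Set.mem_univ_pi.2 fun j => ?_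
    rw [mem_closedBall_zero_iff]
    change ‖((ρ γ)ᴴ * ρ γ) i j‖ ≤ _
    rw [mul_apply]
    refine (norm_sum_le _ _).trans (Finset.sum_le_sum fun k _ => ?_)
    rw [norm_mul, conjTranspose_apply, norm_star]
    exact mul_le_mul (hC k i γ) (hC k j γ) (norm_nonneg _) ((norm_nonneg _).trans (hC k i γ))
  have hHconv : Convex ℝ H := (convex_convexHull ℝ G).closure
  have h1H : (1 : Matrix n n ℂ) ∈ H :=
    subset_closure (subset_convexHull ℝ G ⟨1, by simp⟩)
  have hpsd : ∀ P ∈ H, P.PosSemidef := by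
    have hc : IsClosed {P : Matrix n n ℂ | P.PosSemidef} := by
      have : {P : Matrix n n ℂ | P.PosSemidef} =
          {P | Pᴴ = P} ∩ ⋂ x : n → ℂ, {P | 0 ≤ star x ⬝ᵥ (P *ᵥ x)} := by
        ext P
        simp [posSemidef_iff_dotProduct_mulVec, IsHermitian]
      rw [this]
      refine IsClosed.inter (isClosed_eq (by fun_prop) (by fun_prop)) (isClosed_iInter fun x => ?_)
      exact isClosed_le continuous_const (by fun_prop)
    have hcv : Convex ℝ {P : Matrix n n ℂ | P.PosSemidef} := by
      intro P hP Q hQ a b ha hb _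
      exact (hP.smul ha).add (hQ.smul hb)
    refine fun P hP => closure_minimal (convexHull_min ?_ hcv) hc hP
    rintro _ ⟨γ, rfl⟩
    exact posSemidef_conjTranspose_mul_self _
  have hinv : ∀ γ, ∀ P ∈ H, (ρ γ)ᴴ * P * ρ γ ∈ H := by
    intro γ P hP
    let T : Matrix n n ℂ →ₗ[ℝ] Matrix n n ℂ :=
      { toFun := fun P => (ρ γ)ᴴ * P * ρ γ
        map_add' := fun P Q => by rw [mul_add, add_mul]
        map_smul' := fun c P => by simp }
    have hT : Continuous T := show Continuous fun P : Matrix n n ℂ => (ρ γ)ᴴ * P * ρ γ by fun_prop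
    have hmaps : Set.MapsTo T (convexHull ℝ G) (convexHull ℝ G) := by
      intro Q hQ
      have : T Q ∈ convexHull ℝ (T '' G) := by
        rw [← T.image_convexHull]; exact ⟨Q, hQ, rfl⟩
      refine convexHull_mono ?_ this
      rintro _ ⟨_, ⟨δ, rfl⟩, rfl⟩
      refine ⟨δ * γ, ?_⟩
      change (ρ (δ * γ))ᴴ * ρ (δ * γ) = (ρ γ)ᴴ * ((ρ δ)ᴴ * ρ δ) * ρ γ
      rw [map_mul, conjTranspose_mul]
      simp only [mul_assoc]
    exact map_mem_closure (f := T) hT hP hmaps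
  obtain ⟨P, hPH, hmax⟩ := hcompact.exists_isMaxOn ⟨1, h1H⟩
    (f := fun P => P.det.re) (by fun_prop)
  have hge : 1 ≤ P.det.re := by simpa using hmax h1H
  have hdetre : ∀ Q ∈ H, Q.det = (Q.det.re : ℂ) := by
    intro Q hQ
    have := (hpsd Q hQ).det_nonneg
    rw [Complex.le_def] at this
    exact Complex.ext rfl (by simpa using this.2.symm)
  have hPpd : P.PosDef := (hpsd P hPH).posDef_iff_det_ne_zero.2 fun h => by
    rw [h] at hge; norm_num at hge
  have hdet' : ∀ γ, ((ρ γ)ᴴ * P * ρ γ).det.re = ‖(ρ γ).det‖ ^ 2 * P.det.re := by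
    intro γ
    rw [det_mul, det_mul, det_conjTranspose, mul_right_comm]
    have : star (ρ γ).det * (ρ γ).det = ((‖(ρ γ).det‖ ^ 2 : ℝ) : ℂ) := by
      rw [← starRingEnd_apply, Complex.conj_mul']; push_cast; rfl
    rw [this, Complex.re_ofReal_mul]
  -- maximality of `P` bounds `|det γ|` by `1` for all `γ`; the bound for `γ⁻¹` makes it an equality
  have hle : ∀ γ, ‖(ρ γ).det‖ ≤ 1 := by
    intro γ
    have h : ((ρ γ)ᴴ * P * ρ γ).det.re ≤ P.det.re := hmax (hinv γ P hPH)
    rw [hdet'] at h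
    have : ‖(ρ γ).det‖ ^ 2 ≤ 1 := by
      by_contra! hlt
      nlinarith
    exact (sq_le_one_iff₀ (norm_nonneg _)).1 this
  have hone : ∀ γ, ‖(ρ γ).det‖ = 1 := by
    intro γ
    refine le_antisymm (hle γ) ?_
    have h : ‖(ρ γ).det‖ * ‖(ρ γ⁻¹).det‖ = 1 := by
      rw [← norm_mul, ← det_mul, ← map_mul, mul_inv_cancel, map_one, det_one, norm_one]
    nlinarith [hle γ⁻¹, norm_nonneg (ρ γ).det]
  -- the translate of `P` by `γ` has the same determinant, and the midpoint of both lies in `H`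
  have hfix : ∀ γ, (ρ γ)ᴴ * P * ρ γ = P := by
    intro γ
    have hd : ((ρ γ)ᴴ * P * ρ γ).det = P.det := by
      rw [hdetre _ (hinv γ P hPH), hdetre P hPH, hdet', hone]; simp
    refine hPpd.eq_of_det_midpoint_le ?_ hd ?_
    · refine (hpsd _ (hinv γ P hPH)).posDef_iff_det_ne_zero.2 ?_
      rw [hd]
      exact hPpd.det_pos.ne'
    · have hm := hHconv hPH (hinv γ P hPH) (a := 1 / 2) (b := 1 / 2) (by norm_num) (by norm_num)
        (by norm_num)
      have h2 : (1 / 2 : ℂ) • (P + (ρ γ)ᴴ * P * ρ γ)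
          = (1 / 2 : ℝ) • P + (1 / 2 : ℝ) • ((ρ γ)ᴴ * P * ρ γ) := by
        rw [← smul_add]
        ext i j
        simp [mul_add]
      rw [h2]
      exact hmax hm
  obtain ⟨R, hR⟩ := hPpd.exists_isUnit_eq
  refine ⟨R, fun γ => ?_⟩
  rw [mem_unitaryGroup_iff', star_eq_conjTranspose, conjTranspose_mul, conjTranspose_mul]
  set S : Matrix n n ℂ := ((R⁻¹ : (Matrix n n ℂ)ˣ) : Matrix n n ℂ) with hS
  have hRS : (R : Matrix n n ℂ) * S = 1 := R.mul_inv
  have hRS' : Sᴴ * (R : Matrix n n ℂ)ᴴ = 1 := by rw [← conjTranspose_mul, hRS, conjTranspose_one]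
  have := hfix γ
  calc Sᴴ * ((ρ γ)ᴴ * (R : Matrix n n ℂ)ᴴ) * (↑R * ρ γ * S)
      = Sᴴ * ((ρ γ)ᴴ * ((R : Matrix n n ℂ)ᴴ * R) * ρ γ) * S := by simp only [mul_assoc]
    _ = 1 := by rw [← hR, hfix, hR, ← mul_assoc, hRS', one_mul, hRS]

end Unitarize

/-! ### Diagonalization of unitary operators -/

section Diagonalize

open Module

variable {E : Type*} [NormedAddCommGroup E] [InnerProductSpace ℂ E]

theorem norm_eigenvalue_of_inner_map_map {T : E →ₗ[ℂ] E}
    (hT : ∀ x y, inner ℂ (T x) (T y) = inner ℂ x y) {μ : ℂ} {x : E} (hx : x ≠ 0)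
    (h : T x = μ • x) : ‖μ‖ = 1 := by
  have h1 := hT x x
  rw [h, inner_smul_left, inner_smul_right, ← mul_assoc, Complex.conj_mul',
    mul_eq_right₀ (inner_self_ne_zero.2 hx)] at h1
  have h2 : ‖μ‖ ^ 2 = 1 := by exact_mod_cast h1
  nlinarith [norm_nonneg μ]

theorem inner_eq_conj_mul_inner_of_inner_map_map {T : E →ₗ[ℂ] E}
    (hT : ∀ x y, inner ℂ (T x) (T y) = inner ℂ x y) {μ : ℂ} {x : E} (hμ : ‖μ‖ = 1)
    (h : T x = μ • x) (y : E) : inner ℂ x (T y) = μ * inner ℂ x y := by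
  have h1 := hT x y
  rw [h, inner_smul_left] at h1
  rw [← h1, ← mul_assoc, Complex.mul_conj', hμ]
  simp

/-- An isometry of a finite-dimensional complex inner product space has an orthonormal basis of
eigenvectors: the orthogonal complement of the span of all eigenvectors is invariant, and it
contains no eigenvector. -/
theorem exists_orthonormalBasis_eigenvectors [FiniteDimensional ℂ E] {T : E →ₗ[ℂ] E}
    (hT : ∀ x y, inner ℂ (T x) (T y) = inner ℂ x y) {d : ℕ} (hd : finrank ℂ E = d) :
    ∃ (b : OrthonormalBasis (Fin d) ℂ E) (μ : Fin d → ℂ),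
      ∀ i, ‖μ i‖ = 1 ∧ T (b i) = μ i • b i := by
  classical
  have hfam : OrthogonalFamily ℂ (fun μ : End.Eigenvalues T => End.eigenspace T (μ : ℂ))
      fun μ => (End.eigenspace T (μ : ℂ)).subtypeₗᵢ := by
    rintro ⟨μ, hμ⟩ ⟨ν, hν⟩ hne ⟨x, hx⟩ ⟨y, hy⟩
    change x ∈ End.eigenspace T μ at hx
    change y ∈ End.eigenspace T ν at hy
    rw [End.mem_eigenspace_iff] at hx hy
    change inner ℂ x y = 0
    by_cases hx0 : x = 0
    · rw [hx0, inner_zero_left]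
    have h1 := inner_eq_conj_mul_inner_of_inner_map_map hT
      (norm_eigenvalue_of_inner_map_map hT hx0 hx) hx y
    rw [hy, inner_smul_right] at h1
    have h2 : (ν - μ) * inner ℂ x y = 0 := by rw [sub_mul, h1, sub_self]
    rcases mul_eq_zero.1 h2 with h | h
    · exact absurd (Subtype.ext (sub_eq_zero.1 h).symm) hne
    · exact h
  have horth : (⨆ μ : End.Eigenvalues T, End.eigenspace T (μ : ℂ))ᗮ = ⊥ := by
    set W := ⨆ μ : End.Eigenvalues T, End.eigenspace T (μ : ℂ) with hW
    have hmem : ∀ (μ : ℂ) (x : E), T x = μ • x → x ∈ W := by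
      intro μ x h
      by_cases hx : x = 0
      · rw [hx]; exact W.zero_mem
      have hev : End.HasEigenvalue T μ :=
        End.hasEigenvalue_of_hasEigenvector ⟨End.mem_eigenspace_iff.2 h, hx⟩
      exact (le_iSup (fun μ : End.Eigenvalues T => End.eigenspace T (μ : ℂ)) ⟨μ, hev⟩)
        (End.mem_eigenspace_iff.2 h)
    have hinv : ∀ x ∈ Wᗮ, T x ∈ Wᗮ := by
      intro x hx
      rw [hW, ← Submodule.iInf_orthogonal] at hx ⊢
      simp only [Submodule.mem_iInf] at hx ⊢
      intro μ v hv
      by_cases hv0 : v = 0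
      · rw [hv0, inner_zero_left]
      have hv' := End.mem_eigenspace_iff.1 hv
      rw [inner_eq_conj_mul_inner_of_inner_map_map hT
        (norm_eigenvalue_of_inner_map_map hT hv0 hv') hv' x, hx μ v hv, mul_zero]
    by_contra hne
    have : Nontrivial Wᗮ := Submodule.nontrivial_iff_ne_bot.2 hne
    obtain ⟨μ, hμ⟩ := End.exists_eigenvalue (T.restrict hinv)
    obtain ⟨⟨x, hx⟩, h, hx0⟩ := hμ.exists_hasEigenvector
    have h1 : T x = μ • x := congrArg Subtype.val (End.mem_eigenspace_iff.1 h)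
    have h2 : inner ℂ x x = 0 := hx x (hmem μ x h1)
    exact hx0 (Subtype.ext (inner_self_eq_zero.1 h2))
  have hint : DirectSum.IsInternal fun μ : End.Eigenvalues T => End.eigenspace T (μ : ℂ) :=
    hfam.isInternal_iff.2 horth
  refine ⟨hint.subordinateOrthonormalBasis hd hfam,
    fun i => (hint.subordinateOrthonormalBasisIndex hd i hfam : End.Eigenvalues T), fun i => ?_⟩
  have h := End.mem_eigenspace_iff.1 (hint.subordinateOrthonormalBasis_subordinate hd i hfam)
  exact ⟨norm_eigenvalue_of_inner_map_map hT
    ((hint.subordinateOrthonormalBasis hd hfam).orthonormal.ne_zero i) h, h⟩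

end Diagonalize

section MatrixDiagonalize

open Matrix

variable {d : ℕ}

theorem inner_toEuclideanLin_of_mem_unitaryGroup {A : Matrix (Fin d) (Fin d) ℂ}
    (hA : A ∈ unitaryGroup (Fin d) ℂ) (x y : EuclideanSpace ℂ (Fin d)) :
    inner ℂ (toEuclideanLin A x) (toEuclideanLin A y) = inner ℂ x y := by
  rw [EuclideanSpace.inner_eq_star_dotProduct, EuclideanSpace.inner_eq_star_dotProduct]
  simp only [ofLp_toLpLin, toLin'_apply]
  rw [star_mulVec, ← dotProduct_comm, ← dotProduct_mulVec, mulVec_mulVec,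
    ← star_eq_conjTranspose, mem_unitaryGroup_iff'.1 hA, one_mulVec, dotProduct_comm]

/-- A unitary matrix is diagonalized by a unitary matrix. -/
theorem exists_unitary_diagonalization {A : Matrix (Fin d) (Fin d) ℂ}
    (hA : A ∈ unitaryGroup (Fin d) ℂ) :
    ∃ U ∈ unitaryGroup (Fin d) ℂ, ∃ μ : Fin d → ℂ, (∀ i, ‖μ i‖ = 1) ∧
      A = U * diagonal μ * star U := by
  obtain ⟨b, μ, h⟩ := exists_orthonormalBasis_eigenvectors
    (inner_toEuclideanLin_of_mem_unitaryGroup hA) (finrank_euclideanSpace_fin (𝕜 := ℂ) (n := d))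
  set U := (EuclideanSpace.basisFun (Fin d) ℂ).toBasis.toMatrix b.toBasis with hU
  have hUm : U ∈ unitaryGroup (Fin d) ℂ :=
    (EuclideanSpace.basisFun (Fin d) ℂ).toMatrix_orthonormalBasis_mem_unitary b
  refine ⟨U, hUm, μ, fun i => (h i).1, ?_⟩
  have hAU : A * U = U * diagonal μ := by
    ext i j
    rw [mul_diagonal]
    have h1 := congrArg (fun v : EuclideanSpace ℂ (Fin d) => v i) (h j).2
    simp only [PiLp.smul_apply, smul_eq_mul] at h1
    have hUe : ∀ i j, U i j = b j i := fun i j => by simp [hU, Module.Basis.toMatrix_apply]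
    rw [hUe, mul_comm, ← h1, mul_apply]
    simp only [hUe]
    rfl
  rw [← hAU, mul_assoc, mem_unitaryGroup_iff.1 hUm, mul_one]

end MatrixDiagonalize

/-! ### Logarithms of eigenvalues -/

section EigenAngle

/-- The number `α ∈ [0, 1)` with `exp (2 π i α) = z / ‖z‖` (and `0` for `z = 0`). -/
noncomputable def eigenAngle (z : ℂ) : ℝ := Int.fract (z.arg / (2 * Real.pi))

theorem eigenAngle_nonneg (z : ℂ) : 0 ≤ eigenAngle z := Int.fract_nonneg _

theorem eigenAngle_lt_one (z : ℂ) : eigenAngle z < 1 := Int.fract_lt_one _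

theorem exp_eigenAngle {z : ℂ} (hz : ‖z‖ = 1) :
    Complex.exp (2 * Real.pi * Complex.I * eigenAngle z) = z := by
  have h : (2 * Real.pi * Complex.I * eigenAngle z : ℂ)
      = z.arg * Complex.I - (⌊z.arg / (2 * Real.pi)⌋ : ℤ) * (2 * Real.pi * Complex.I) := by
    have hpi : (Real.pi : ℂ) ≠ 0 := by exact_mod_cast Real.pi_ne_zero
    rw [eigenAngle, Int.fract]
    push_cast
    field_simp
  rw [h, Complex.exp_sub, Complex.exp_int_mul_two_pi_mul_I, div_one]
  have := Complex.norm_mul_exp_arg_mul_I z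
  rwa [hz, Complex.ofReal_one, one_mul] at this

theorem exists_int_of_exp_eq_one {a : ℝ} (h : Complex.exp (2 * Real.pi * Complex.I * a) = 1) :
    ∃ k : ℤ, a = k := by
  obtain ⟨k, hk⟩ := Complex.exp_eq_one_iff.1 h
  refine ⟨k, ?_⟩
  have h2 : (2 * Real.pi * Complex.I : ℂ) ≠ 0 := Complex.two_pi_I_ne_zero
  have h3 : (2 * Real.pi * Complex.I : ℂ) * a = 2 * Real.pi * Complex.I * k := by
    rw [hk]; ring
  have := mul_left_cancel₀ h2 h3
  exact_mod_cast this

theorem exp_two_pi_injOn {a b : ℝ} (ha : a ∈ Set.Ico (0 : ℝ) 1) (hb : b ∈ Set.Ico (0 : ℝ) 1)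
    (h : Complex.exp (2 * Real.pi * Complex.I * a) = Complex.exp (2 * Real.pi * Complex.I * b)) :
    a = b := by
  have h1 : Complex.exp (2 * Real.pi * Complex.I * ((a - b : ℝ) : ℂ)) = 1 := by
    push_cast
    rw [mul_sub, Complex.exp_sub, h, div_self (Complex.exp_ne_zero _)]
  obtain ⟨k, hk⟩ := exists_int_of_exp_eq_one h1
  have h2 : (k : ℝ) < 1 := by linarith [ha.2, hb.1]
  have h3 : (-1 : ℝ) < k := by linarith [ha.1, hb.2]
  have h4 : k < 1 := by exact_mod_cast h2
  have h5 : -1 < k := by exact_mod_cast h3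
  have : k = 0 := by omega
  rw [this] at hk
  push_cast at hk
  linarith

theorem norm_exp_two_pi (a : ℝ) : ‖Complex.exp (2 * Real.pi * Complex.I * a)‖ = 1 := by
  have : (2 * Real.pi * Complex.I * a : ℂ) = ((2 * Real.pi * a : ℝ) : ℂ) * Complex.I := by
    push_cast; ring
  rw [this, Complex.norm_exp_ofReal_mul_I]

theorem eigenAngle_exp {a : ℝ} (ha : a ∈ Set.Ico (0 : ℝ) 1) :
    eigenAngle (Complex.exp (2 * Real.pi * Complex.I * a)) = a :=
  exp_two_pi_injOn ⟨eigenAngle_nonneg _, eigenAngle_lt_one _⟩ ha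
    (exp_eigenAngle (norm_exp_two_pi a))

theorem eigenAngle_one : eigenAngle 1 = 0 := by simp [eigenAngle]

theorem eigenAngle_add_inv_le {z : ℂ} (hz : ‖z‖ = 1) : eigenAngle z + eigenAngle z⁻¹ ≤ 1 := by
  have hz0 : z ≠ 0 := fun h => by simp [h] at hz
  have h :
      Complex.exp (2 * Real.pi * Complex.I * ((eigenAngle z + eigenAngle z⁻¹ : ℝ) : ℂ)) = 1 := by
    push_cast
    rw [mul_add, Complex.exp_add, exp_eigenAngle hz, exp_eigenAngle (by rw [norm_inv, hz, inv_one]),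
      mul_inv_cancel₀ hz0]
  obtain ⟨k, hk⟩ := exists_int_of_exp_eq_one h
  have h2 : (k : ℝ) < 2 := by linarith [eigenAngle_lt_one z, eigenAngle_lt_one z⁻¹]
  have h4 : k < 2 := by exact_mod_cast h2
  have : k ≤ 1 := by omega
  rw [hk]
  exact_mod_cast this

end EigenAngle

/-! ### Interlacing of the eigenvalues of unitary operators -/

section Interlacing

open Module

/-- The number `cos (2 π t - π s)` is the real part of `exp (2 π i t)` after the rotation that makes
the chord from `1` to `exp (2 π i s)` vertical; on the arc `[0, s]` it is at least its value at the two
ends. -/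
theorem cos_le_of_mem_arc {s t : ℝ} (hs : s < 1) (ht0 : 0 ≤ t) (ht : t ≤ s) :
    Real.cos (Real.pi * s) ≤ Real.cos (2 * Real.pi * t - Real.pi * s) := by
  rw [← Real.cos_abs (2 * Real.pi * t - Real.pi * s)]
  have hpi := Real.pi_pos
  refine Real.cos_le_cos_of_nonneg_of_le_pi (abs_nonneg _) (by nlinarith) ?_
  rw [abs_le]
  constructor <;> nlinarith

/-- On the complementary arc `(s, 1)` the rotated real part is less than its value at the ends. -/
theorem cos_lt_of_notMem_arc {s t : ℝ} (hs : 0 < s) (ht1 : t < 1) (ht : s < t) :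
    Real.cos (2 * Real.pi * t - Real.pi * s) < Real.cos (Real.pi * s) := by
  have hpi := Real.pi_pos
  by_cases hle : 2 * Real.pi * t - Real.pi * s ≤ Real.pi
  · exact Real.cos_lt_cos_of_nonneg_of_le_pi (by nlinarith) hle (by nlinarith)
  · rw [← Real.cos_two_pi_sub (2 * Real.pi * t - Real.pi * s)]
    exact Real.cos_lt_cos_of_nonneg_of_le_pi (by nlinarith) (by linarith) (by nlinarith)

variable {E : Type*} [NormedAddCommGroup E] [InnerProductSpace ℂ E]

theorem inner_apply_sum_eigenvectors {d : ℕ} {T : E →ₗ[ℂ] E} (b : OrthonormalBasis (Fin d) ℂ E)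
    {μ : Fin d → ℂ} (h : ∀ i, T (b i) = μ i • b i) (c : Fin d → ℂ) :
    inner ℂ (∑ i, c i • b i) (T (∑ i, c i • b i)) = ∑ i, ((‖c i‖ ^ 2 : ℝ) : ℂ) * μ i := by
  have : T (∑ i, c i • b i) = ∑ i, (c i * μ i) • b i := by
    simp [map_sum, h, smul_smul]
  rw [this, b.orthonormal.inner_sum]
  refine Finset.sum_congr rfl fun i _ => ?_
  rw [← mul_assoc, Complex.conj_mul']
  push_cast
  rfl

theorem re_rotated_inner {d : ℕ} {T : E →ₗ[ℂ] E} (b : OrthonormalBasis (Fin d) ℂ E)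
    {θ : Fin d → ℝ} (h : ∀ i, T (b i) = Complex.exp (2 * Real.pi * Complex.I * θ i) • b i)
    (c : Fin d → ℂ) (s : ℝ) :
    (Complex.exp ((-(Real.pi * s) : ℝ) * Complex.I) *
      inner ℂ (∑ i, c i • b i) (T (∑ i, c i • b i))).re
      = ∑ i, ‖c i‖ ^ 2 * Real.cos (2 * Real.pi * θ i - Real.pi * s) := by
  rw [inner_apply_sum_eigenvectors b h, Finset.mul_sum, Complex.re_sum]
  refine Finset.sum_congr rfl fun i _ => ?_
  rw [mul_left_comm, ← Complex.exp_add, Complex.re_ofReal_mul]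
  have : ((-(Real.pi * s) : ℝ) * Complex.I + 2 * Real.pi * Complex.I * θ i : ℂ)
      = ((2 * Real.pi * θ i - Real.pi * s : ℝ) : ℂ) * Complex.I := by push_cast; ring
  rw [this, Complex.exp_ofReal_mul_I_re]

/-- If two unitary operators agree on a hyperplane, then the number of eigenvalues of the first one
in an arc starting at `1` and the number of those of the second one in the complementary arc add up
to at most the dimension plus one. Otherwise some vector of the hyperplane would lie in both sums of
eigenspaces, and the value of the quadratic form at this vector would be on both sides of the
chord that separates the two arcs. -/
theorem card_add_card_le_of_eq_on_ker {d : ℕ} {T T' : E →ₗ[ℂ] E}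
    (b b' : OrthonormalBasis (Fin d) ℂ E) {θ θ' : Fin d → ℝ}
    (h : ∀ i, T (b i) = Complex.exp (2 * Real.pi * Complex.I * θ i) • b i)
    (h' : ∀ i, T' (b' i) = Complex.exp (2 * Real.pi * Complex.I * θ' i) • b' i)
    (hθ : ∀ i, 0 ≤ θ i) (hθ' : ∀ i, θ' i < 1)
    (φ : E →ₗ[ℂ] ℂ) (hφ : ∀ x, φ x = 0 → T x = T' x)
    {s : ℝ} (hs0 : 0 < s) (hs1 : s < 1) (I I' : Finset (Fin d))
    (hI : ∀ i ∈ I, θ i ≤ s) (hI' : ∀ i ∈ I', s < θ' i) :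
    I.card + I'.card ≤ d + 1 := by
  by_contra! hcard
  have : FiniteDimensional ℂ E := b.toBasis.finiteDimensional_of_finite
  have hfr : finrank ℂ E = d := by rw [finrank_eq_card_basis b.toBasis, Fintype.card_fin]
  let S : (I → ℂ) →ₗ[ℂ] E := Fintype.linearCombination ℂ (fun i : I => b i)
  let S' : (I' → ℂ) →ₗ[ℂ] E := Fintype.linearCombination ℂ (fun i : I' => b' i)
  have hS : ∀ c : I → ℂ, S c = ∑ i : I, c i • b i := fun c => rfl
  have hS' : ∀ c : I' → ℂ, S' c = ∑ i : I', c i • b' i := fun c => rfl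
  -- the kernel of `Ψ` consists of the pairs of equal vectors of the two sums that lie in `ker φ`
  let Ψ : (I → ℂ) × (I' → ℂ) →ₗ[ℂ] E × ℂ :=
    LinearMap.prod (S ∘ₗ LinearMap.fst ℂ _ _ - S' ∘ₗ LinearMap.snd ℂ _ _)
      (φ ∘ₗ S ∘ₗ LinearMap.fst ℂ _ _)
  have hker : LinearMap.ker Ψ ≠ ⊥ := LinearMap.ker_ne_bot_of_finrank_lt (by
    simp only [finrank_prod, finrank_fintype_fun_eq_card, Fintype.card_coe, finrank_self, hfr]
    omega)
  obtain ⟨⟨c, c'⟩, hc, hne⟩ := Submodule.exists_mem_ne_zero_of_ne_bot hker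
  rw [LinearMap.mem_ker] at hc
  have hc1 : S c = S' c' := sub_eq_zero.1 (congrArg Prod.fst hc)
  have hc2 : φ (S c) = 0 := congrArg Prod.snd hc
  let e : Fin d → ℂ := fun i => if hi : i ∈ I then c ⟨i, hi⟩ else 0
  let e' : Fin d → ℂ := fun i => if hi : i ∈ I' then c' ⟨i, hi⟩ else 0
  have he : ∀ i : I, e i = c i := fun i => by simp [e]
  have he' : ∀ i : I', e' i = c' i := fun i => by simp [e']
  have he0 : ∀ i, i ∉ I → e i = 0 := fun i hi => by simp [e, hi]
  have he0' : ∀ i, i ∉ I' → e' i = 0 := fun i hi => by simp [e', hi]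
  have hv : S c = ∑ i, e i • b i := by
    rw [hS, ← Finset.sum_subset (Finset.subset_univ I)
      (fun i _ hi => by rw [he0 i hi, zero_smul]), ← Finset.sum_coe_sort I fun i => e i • b i]
    exact Finset.sum_congr rfl fun i _ => by rw [he]
  have hv' : S c = ∑ i, e' i • b' i := by
    rw [hc1, hS', ← Finset.sum_subset (Finset.subset_univ I')
      (fun i _ hi => by rw [he0' i hi, zero_smul]), ← Finset.sum_coe_sort I' fun i => e' i • b' i]
    exact Finset.sum_congr rfl fun i _ => by rw [he']
  have hn : ‖S c‖ ^ 2 = ∑ i, ‖e i‖ ^ 2 := by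
    rw [← b.sum_sq_norm_inner_right (S c)]
    refine Finset.sum_congr rfl fun i _ => ?_
    rw [hv, b.orthonormal.inner_right_fintype]
  have hn' : ‖S c‖ ^ 2 = ∑ i, ‖e' i‖ ^ 2 := by
    rw [← b'.sum_sq_norm_inner_right (S c)]
    refine Finset.sum_congr rfl fun i _ => ?_
    rw [hv', b'.orthonormal.inner_right_fintype]
  have key : ∑ i, ‖e i‖ ^ 2 * Real.cos (2 * Real.pi * θ i - Real.pi * s)
      = ∑ i, ‖e' i‖ ^ 2 * Real.cos (2 * Real.pi * θ' i - Real.pi * s) := by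
    rw [← re_rotated_inner b h e s, ← re_rotated_inner b' h' e' s, ← hv, ← hv', hφ _ hc2]
  have h1 : ∑ i, ‖e i‖ ^ 2 * Real.cos (Real.pi * s)
      ≤ ∑ i, ‖e i‖ ^ 2 * Real.cos (2 * Real.pi * θ i - Real.pi * s) := by
    refine Finset.sum_le_sum fun i _ => ?_
    by_cases hi : i ∈ I
    · exact mul_le_mul_of_nonneg_left (cos_le_of_mem_arc hs1 (hθ i) (hI i hi)) (by positivity)
    · simp [he0 i hi]
  have hne' : ∃ i, e' i ≠ 0 := by
    by_contra! hall
    have hv0 : S c = 0 := by rw [hv']; simp [hall]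
    refine hne (Prod.ext ?_ ?_)
    · funext i
      have : ∑ i, ‖e i‖ ^ 2 = 0 := by rw [← hn, hv0]; simp
      have := (Finset.sum_eq_zero_iff_of_nonneg (fun i _ => by positivity)).1 this i
        (Finset.mem_univ _)
      change c i = 0
      rw [← he]
      simpa using this
    · funext i
      change c' i = 0
      rw [← he']
      exact hall _
  have h2 : ∑ i, ‖e' i‖ ^ 2 * Real.cos (2 * Real.pi * θ' i - Real.pi * s)
      < ∑ i, ‖e' i‖ ^ 2 * Real.cos (Real.pi * s) := by
    obtain ⟨j, hj⟩ := hne'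
    refine Finset.sum_lt_sum (fun i _ => ?_) ⟨j, Finset.mem_univ _, ?_⟩
    · by_cases hi : i ∈ I'
      · exact mul_le_mul_of_nonneg_left (cos_lt_of_notMem_arc hs0 (hθ' i) (hI' i hi)).le
          (by positivity)
      · simp [he0' i hi]
    · have hjI : j ∈ I' := by
        by_contra hjI
        exact hj (he0' j hjI)
      exact mul_lt_mul_of_pos_left (cos_lt_of_notMem_arc hs0 (hθ' j) (hI' j hjI)) (by positivity)
  rw [← Finset.sum_mul, ← hn] at h1
  rw [← Finset.sum_mul, ← hn'] at h2
  linarith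

/-- A counting criterion for two families of numbers in `[0, 1)` to have sums differing by less
than one: it makes the sorted families interlace. -/
theorem sum_lt_sum_add_one_of_card_add_card_le {d : ℕ} {θ θ' : Fin d → ℝ}
    (hθ : ∀ i, 0 ≤ θ i) (hθ' : ∀ i, θ' i < 1)
    (H : ∀ (s : ℝ) (I I' : Finset (Fin d)), 0 < s → s < 1 → (∀ i ∈ I, θ i ≤ s) →
      (∀ i ∈ I', s < θ' i) → I.card + I'.card ≤ d + 1) :
    ∑ i, θ' i < ∑ i, θ i + 1 := by
  rcases d with _ | m
  · simp
  set σ := Tuple.sort θ with hσ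
  set σ' := Tuple.sort θ' with hσ'
  have hmono : Monotone (θ ∘ σ) := Tuple.monotone_sort θ
  have hmono' : Monotone (θ' ∘ σ') := Tuple.monotone_sort θ'
  -- otherwise a number `s` between the two would have `i + 2` of the `θ` below it and `m + 1 - i`
  -- of the `θ'` above it
  have hle : ∀ i : Fin m, θ' (σ' i.castSucc) ≤ θ (σ i.succ) := by
    intro i
    by_contra! hlt
    obtain ⟨s, hs1, hs2⟩ := exists_between hlt
    have := H s ((Finset.Iic i.succ).map σ.toEmbedding)
      ((Finset.Ici i.castSucc).map σ'.toEmbedding)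
      (lt_of_le_of_lt (hθ _) hs1) (hs2.trans (hθ' _))
      (by
        intro j hj
        obtain ⟨k, hk, rfl⟩ := Finset.mem_map.1 hj
        exact (hmono (Finset.mem_Iic.1 hk)).trans hs1.le)
      (by
        intro j hj
        obtain ⟨k, hk, rfl⟩ := Finset.mem_map.1 hj
        exact hs2.trans_le (hmono' (Finset.mem_Ici.1 hk)))
    rw [Finset.card_map, Finset.card_map, Fin.card_Iic, Fin.card_Ici] at this
    simp only [Fin.val_succ, Fin.val_castSucc] at this
    have := i.2
    omega
  rw [← Equiv.sum_comp σ θ, ← Equiv.sum_comp σ' θ', Fin.sum_univ_castSucc, Fin.sum_univ_succ]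
  have h1 : ∑ i : Fin m, θ' (σ' i.castSucc) ≤ ∑ i : Fin m, θ (σ i.succ) :=
    Finset.sum_le_sum fun i _ => hle i
  linarith [hθ (σ 0), hθ' (σ' (Fin.last m))]

end Interlacing

/-! ### The logarithmic degree of a unitary matrix -/

section LogDegree

open Matrix

variable {d : ℕ}

/-- The sum of the numbers `α ∈ [0, 1)` such that `exp (2 π i α)` is an eigenvalue of `A`, counted
with algebraic multiplicity (for matrices whose eigenvalues have absolute value one). -/
noncomputable def logDegree (A : Matrix (Fin d) (Fin d) ℂ) : ℝ :=
  (A.charpoly.roots.map eigenAngle).sum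

theorem charpoly_mul_mul_of_mul_eq_one {U U' : Matrix (Fin d) (Fin d) ℂ} (h : U' * U = 1)
    (A : Matrix (Fin d) (Fin d) ℂ) : (U * A * U').charpoly = A.charpoly := by
  rw [charpoly_mul_comm, ← mul_assoc, h, one_mul]

theorem logDegree_conj {U U' : Matrix (Fin d) (Fin d) ℂ} (h : U' * U = 1)
    (A : Matrix (Fin d) (Fin d) ℂ) : logDegree (U * A * U') = logDegree A := by
  rw [logDegree, charpoly_mul_mul_of_mul_eq_one h, logDegree]

theorem logDegree_diagonal (μ : Fin d → ℂ) :
    logDegree (diagonal μ) = ∑ i, eigenAngle (μ i) := by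
  rw [logDegree, charpoly_diagonal, Polynomial.roots_prod _ _
    (Finset.prod_ne_zero_iff.2 fun i _ => Polynomial.X_sub_C_ne_zero _)]
  simp [Multiset.bind_singleton, List.sum_ofFn]

theorem exp_logDegree {A : Matrix (Fin d) (Fin d) ℂ} (hA : A ∈ unitaryGroup (Fin d) ℂ) :
    Complex.exp (2 * Real.pi * Complex.I * logDegree A) = A.det := by
  obtain ⟨U, hU, μ, hμ, rfl⟩ := exists_unitary_diagonalization hA
  rw [logDegree_conj (mem_unitaryGroup_iff'.1 hU), logDegree_diagonal, det_mul_comm, ← mul_assoc,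
    mem_unitaryGroup_iff'.1 hU, one_mul, det_diagonal]
  push_cast
  rw [Finset.mul_sum, Complex.exp_sum]
  exact Finset.prod_congr rfl fun i _ => exp_eigenAngle (hμ i)

theorem diagonal_mem_unitaryGroup {μ : Fin d → ℂ} (hμ : ∀ i, ‖μ i‖ = 1) :
    diagonal μ ∈ unitaryGroup (Fin d) ℂ := by
  rw [mem_unitaryGroup_iff, star_eq_conjTranspose, diagonal_conjTranspose, diagonal_mul_diagonal,
    ← diagonal_one]
  congr 1
  funext i
  simp [Complex.mul_conj', hμ]

theorem exists_orthonormalBasis_logDegree {A : Matrix (Fin d) (Fin d) ℂ}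
    (hA : A ∈ unitaryGroup (Fin d) ℂ) :
    ∃ (b : OrthonormalBasis (Fin d) ℂ (EuclideanSpace ℂ (Fin d))) (θ : Fin d → ℝ),
      (∀ i, 0 ≤ θ i) ∧ (∀ i, θ i < 1) ∧ logDegree A = ∑ i, θ i ∧
      ∀ i, toEuclideanLin A (b i) = Complex.exp (2 * Real.pi * Complex.I * θ i) • b i := by
  obtain ⟨b, μ, h⟩ := exists_orthonormalBasis_eigenvectors
    (inner_toEuclideanLin_of_mem_unitaryGroup hA) (finrank_euclideanSpace_fin (𝕜 := ℂ) (n := d))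
  refine ⟨b, fun i => eigenAngle (μ i), fun i => eigenAngle_nonneg _, fun i => eigenAngle_lt_one _,
    ?_, fun i => by rw [exp_eigenAngle (h i).1]; exact (h i).2⟩
  have hc : A.charpoly = (diagonal μ).charpoly := by
    have e : LinearMap.toMatrix (EuclideanSpace.basisFun (Fin d) ℂ).toBasis
        (EuclideanSpace.basisFun (Fin d) ℂ).toBasis (toEuclideanLin A) = A := by
      rw [toEuclideanLin_eq_toLin_orthonormal, LinearMap.toMatrix_toLin]
    conv_lhs => rw [← e]
    rw [LinearMap.charpoly_toMatrix, ← LinearMap.charpoly_toMatrix (toEuclideanLin A) b.toBasis]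
    congr 1
    ext i j
    rw [LinearMap.toMatrix_apply, b.coe_toBasis, (h j).2, map_smul, ← b.coe_toBasis]
    by_cases hij : i = j
    · subst hij; simp
    · simp [hij]
  rw [← logDegree_diagonal, logDegree, logDegree, hc]

/-- Two unitary matrices that agree on a hyperplane have logarithmic degrees differing by less than
one. -/
theorem logDegree_lt_add_one {A A' : Matrix (Fin d) (Fin d) ℂ} (hA : A ∈ unitaryGroup (Fin d) ℂ)
    (hA' : A' ∈ unitaryGroup (Fin d) ℂ) (φ : EuclideanSpace ℂ (Fin d) →ₗ[ℂ] ℂ)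
    (hφ : ∀ x, φ x = 0 → toEuclideanLin A x = toEuclideanLin A' x) :
    logDegree A' < logDegree A + 1 := by
  obtain ⟨b, θ, h0, h1, hl, hb⟩ := exists_orthonormalBasis_logDegree hA
  obtain ⟨b', θ', h0', h1', hl', hb'⟩ := exists_orthonormalBasis_logDegree hA'
  rw [hl, hl']
  exact sum_lt_sum_add_one_of_card_add_card_le h0 h1' fun s I I' hs0 hs1 hI hI' =>
    card_add_card_le_of_eq_on_ker b b' hb hb' h0 h1' φ hφ hs0 hs1 I I' hI hI'

theorem exists_int_logDegree_mul {A B : Matrix (Fin d) (Fin d) ℂ}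
    (hA : A ∈ unitaryGroup (Fin d) ℂ) (hB : B ∈ unitaryGroup (Fin d) ℂ) :
    ∃ k : ℤ, logDegree A + logDegree B - logDegree (A * B) = k := by
  refine exists_int_of_exp_eq_one ?_
  push_cast
  rw [mul_sub, mul_add, Complex.exp_sub, Complex.exp_add, exp_logDegree hA, exp_logDegree hB,
    exp_logDegree (mul_mem hA hB), ← det_mul]
  refine div_self ?_
  rw [← exp_logDegree (mul_mem hA hB)]
  exact Complex.exp_ne_zero _

/-- Rotating a single vector of the standard basis by `exp (2 π i α)`, with `α ∈ [0, 1)`, increases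
the logarithmic degree by at most `α`: it does so modulo `1`, by the determinant, and the increase
is less than `1` by interlacing. -/
theorem logDegree_mul_diagonal_update_le {A : Matrix (Fin d) (Fin d) ℂ}
    (hA : A ∈ unitaryGroup (Fin d) ℂ) (j : Fin d) {ζ : ℂ} (hζ : ‖ζ‖ = 1) :
    logDegree (A * diagonal (Function.update 1 j ζ)) ≤ logDegree A + eigenAngle ζ := by
  have hD : diagonal (Function.update (1 : Fin d → ℂ) j ζ) ∈ unitaryGroup (Fin d) ℂ :=
    diagonal_mem_unitaryGroup fun i => by
      by_cases h : i = j
      · subst h; simpa using hζ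
      · simp [h]
  have hDl : logDegree (diagonal (Function.update (1 : Fin d → ℂ) j ζ)) = eigenAngle ζ := by
    rw [logDegree_diagonal, Finset.sum_eq_single j]
    · simp
    · intro i _ hij; simp [hij, eigenAngle_one]
    · simp
  have hlt : logDegree (A * diagonal (Function.update 1 j ζ)) < logDegree A + 1 := by
    refine logDegree_lt_add_one hA (mul_mem hA hD)
      (LinearMap.proj j ∘ₗ (WithLp.linearEquiv 2 ℂ (Fin d → ℂ)).toLinearMap) fun x hx => ?_
    have hx' : x j = 0 := hx
    have hDx : diagonal (Function.update (1 : Fin d → ℂ) j ζ) *ᵥ x.ofLp = x.ofLp := by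
      funext i
      rw [mulVec_diagonal]
      by_cases h : i = j
      · subst h; simp [hx']
      · simp [h]
    rw [toLpLin_apply, toLpLin_apply, ← mulVec_mulVec, hDx]
  obtain ⟨k, hk⟩ := exists_int_logDegree_mul hA hD
  rw [hDl] at hk
  have h1 : (-1 : ℝ) < k := by linarith [eigenAngle_nonneg ζ]
  have h2 : -1 < k := by exact_mod_cast h1
  have h3 : (0 : ℝ) ≤ k := by exact_mod_cast (by omega : 0 ≤ k)
  linarith

theorem logDegree_mul_diagonal_le {A : Matrix (Fin d) (Fin d) ℂ}
    (hA : A ∈ unitaryGroup (Fin d) ℂ) {μ : Fin d → ℂ} (hμ : ∀ i, ‖μ i‖ = 1) :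
    logDegree (A * diagonal μ) ≤ logDegree A + ∑ i, eigenAngle (μ i) := by
  classical
  have key : ∀ s : Finset (Fin d),
      logDegree (A * diagonal fun i => if i ∈ s then μ i else 1)
        ≤ logDegree A + ∑ i ∈ s, eigenAngle (μ i) := by
    intro s
    induction s using Finset.induction_on with
    | empty => simp
    | insert j s hj ih =>
      have hD : (diagonal fun i => if i ∈ s then μ i else 1) ∈ unitaryGroup (Fin d) ℂ :=
        diagonal_mem_unitaryGroup fun i => by split_ifs <;> simp [hμ]
      have hmul : (diagonal fun i => if i ∈ insert j s then μ i else 1)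
          = (diagonal fun i => if i ∈ s then μ i else 1) *
            diagonal (Function.update (1 : Fin d → ℂ) j (μ j)) := by
        rw [diagonal_mul_diagonal]
        congr 1
        funext i
        by_cases h : i = j
        · subst h; simp [hj]
        · simp [h]
      rw [hmul, ← mul_assoc, Finset.sum_insert hj]
      have := logDegree_mul_diagonal_update_le (mul_mem hA hD) j (hμ j)
      linarith
  simpa using key Finset.univ

/-- The logarithmic degree is subadditive on unitary matrices. -/
theorem logDegree_mul_le {A B : Matrix (Fin d) (Fin d) ℂ} (hA : A ∈ unitaryGroup (Fin d) ℂ)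
    (hB : B ∈ unitaryGroup (Fin d) ℂ) : logDegree (A * B) ≤ logDegree A + logDegree B := by
  obtain ⟨U, hU, μ, hμ, rfl⟩ := exists_unitary_diagonalization hB
  have h1 : star U * U = 1 := mem_unitaryGroup_iff'.1 hU
  have h2 : U * star U = 1 := mem_unitaryGroup_iff.1 hU
  have h := logDegree_mul_diagonal_le (mul_mem (mul_mem (Unitary.star_mem hU) hA) hU) hμ
  have e : A * (U * diagonal μ * star U) = U * (star U * A * U * diagonal μ) * star U := by
    simp only [← mul_assoc]
    rw [h2, one_mul]
  rw [e, logDegree_conj h1, logDegree_conj h1, logDegree_diagonal]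
  rwa [logDegree_conj h2] at h

theorem logDegree_add_star_le {B : Matrix (Fin d) (Fin d) ℂ} (hB : B ∈ unitaryGroup (Fin d) ℂ) :
    logDegree B + logDegree (star B) ≤ d := by
  obtain ⟨U, hU, μ, hμ, rfl⟩ := exists_unitary_diagonalization hB
  have h1 : star U * U = 1 := mem_unitaryGroup_iff'.1 hU
  have e : star (U * diagonal μ * star U) = U * diagonal (fun i => (μ i)⁻¹) * star U := by
    rw [star_mul, star_mul, star_star, mul_assoc, star_eq_conjTranspose (diagonal μ),
      diagonal_conjTranspose]
    congr 4
    funext i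
    exact (Complex.inv_eq_conj (hμ i)).symm
  rw [e, logDegree_conj h1, logDegree_conj h1, logDegree_diagonal, logDegree_diagonal,
    ← Finset.sum_add_distrib]
  refine (Finset.sum_le_sum fun i _ => eigenAngle_add_inv_le (hμ i)).trans ?_
  simp

/-- For matrices that are simultaneously unitarizable, the defect `ℓ(A) + ℓ(B) - ℓ(AB)` of the
logarithmic degree is a natural number not exceeding the size. -/
theorem exists_nat_logDegree_mul {A B S S' : Matrix (Fin d) (Fin d) ℂ} (hS : S' * S = 1)
    (hA : S * A * S' ∈ unitaryGroup (Fin d) ℂ) (hB : S * B * S' ∈ unitaryGroup (Fin d) ℂ) :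
    ∃ k : ℕ, k ≤ d ∧ logDegree A + logDegree B - logDegree (A * B) = k := by
  have hmul : S * A * S' * (S * B * S') = S * (A * B) * S' := by
    calc S * A * S' * (S * B * S') = S * A * (S' * S) * B * S' := by simp only [mul_assoc]
      _ = S * (A * B) * S' := by rw [hS, mul_one]; simp only [mul_assoc]
  -- non-negativity is subadditivity; the upper bound is subadditivity for `A = (A B) B⁻¹`, together
  -- with `ℓ(B) + ℓ(B⁻¹) ≤ d`
  have h0 := logDegree_mul_le hA hB
  have h1 := logDegree_mul_le (mul_mem hA hB) (Unitary.star_mem hB)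
  rw [mul_assoc (S * A * S'), mem_unitaryGroup_iff.1 hB, mul_one] at h1
  have h2 := logDegree_add_star_le hB
  obtain ⟨k, hk⟩ := exists_int_logDegree_mul hA hB
  rw [hmul] at h0 h1 hk
  rw [logDegree_conj hS, logDegree_conj hS, logDegree_conj hS] at hk
  rw [logDegree_conj hS, logDegree_conj hS, logDegree_conj hS] at h0
  rw [logDegree_conj hS, logDegree_conj hS] at h1
  rw [logDegree_conj hS] at h2
  have hk0 : (0 : ℝ) ≤ k := by linarith
  have hk1 : (k : ℝ) ≤ d := by linarith
  lift k to ℕ using (by exact_mod_cast hk0)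
  exact ⟨k, by exact_mod_cast hk1, by rw [hk]; simp⟩

end LogDegree

/-! ### Additive functions of idempotents in a product of matrix algebras -/

section Idempotents

open Matrix

/-- A function on the idempotents of a ring that is additive on orthogonal idempotents and takes
the same value on equivalent ones (that is, on `x y` and `y x`), such as the class of the image of
an idempotent endomorphism in a Grothendieck group. -/
structure IsIdempotentAdditive {R M : Type*} [Ring R] [AddCommGroup M] (f : R → M) : Prop where
  add : ∀ p q : R, p * p = p → q * q = q → p * q = 0 → q * p = 0 → f (p + q) = f p + f q
  conj : ∀ x y p q : R, p * p = p → q * q = q → x * y = p → y * x = q → f p = f q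

namespace IsIdempotentAdditive

variable {R M : Type*} [Ring R] [AddCommGroup M] {f : R → M}

theorem map_zero (hf : IsIdempotentAdditive f) : f 0 = 0 := by
  have := hf.add 0 0 (by simp) (by simp) (by simp) (by simp)
  simpa using this

theorem map_sum (hf : IsIdempotentAdditive f) {ι : Type*} (s : Finset ι) (p : ι → R)
    (hp : ∀ i ∈ s, p i * p i = p i) (hpq : ∀ i ∈ s, ∀ j ∈ s, i ≠ j → p i * p j = 0) :
    f (∑ i ∈ s, p i) = ∑ i ∈ s, f (p i) := by
  classical
  induction s using Finset.induction_on with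
  | empty => simpa using hf.map_zero
  | insert j s hj ih =>
    have hne : ∀ i ∈ s, i ≠ j := fun i hi h => hj (h ▸ hi)
    have hs : (∑ i ∈ s, p i) * (∑ i ∈ s, p i) = ∑ i ∈ s, p i := by
      rw [Finset.sum_mul_sum]
      refine Finset.sum_congr rfl fun i hi => ?_
      rw [Finset.sum_eq_single_of_mem i hi fun k hk hki =>
        hpq i (Finset.mem_insert_of_mem hi) k (Finset.mem_insert_of_mem hk) (Ne.symm hki)]
      exact hp i (Finset.mem_insert_of_mem hi)
    rw [Finset.sum_insert hj, Finset.sum_insert hj,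
      hf.add _ _ (hp j (Finset.mem_insert_self _ _)) hs,
      ih (fun i hi => hp i (Finset.mem_insert_of_mem hi)) fun i hi k hk =>
        hpq i (Finset.mem_insert_of_mem hi) k (Finset.mem_insert_of_mem hk)]
    · rw [Finset.mul_sum]
      exact Finset.sum_eq_zero fun i hi => hpq j (Finset.mem_insert_self _ _) i
        (Finset.mem_insert_of_mem hi) (hne i hi).symm
    · rw [Finset.sum_mul]
      exact Finset.sum_eq_zero fun i hi => hpq i (Finset.mem_insert_of_mem hi) j
        (Finset.mem_insert_self _ _) (hne i hi)

/-- In a product of matrix algebras, such a function is determined by its values at the elementary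
idempotents `E₀₀` of the factors. -/
theorem apply_conj_diagonal {n : ℕ} {d : Fin n → ℕ} [∀ i, NeZero (d i)]
    {f : (∀ i, Matrix (Fin (d i)) (Fin (d i)) ℂ) → M} (hf : IsIdempotentAdditive f)
    (U U' : ∀ i, Matrix (Fin (d i)) (Fin (d i)) ℂ) (h : ∀ i, U' i * U i = 1)
    (s : ∀ i, Finset (Fin (d i))) :
    f (fun i => U i * diagonal (fun j => if j ∈ s i then 1 else 0) * U' i)
      = ∑ i, (s i).card • f (Pi.single i (Matrix.single 0 0 1)) := by
  -- the idempotent is a sum of orthogonal idempotents `p ⟨i, k⟩` of rank one, and `p ⟨i, k⟩` is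
  -- equivalent to `E₀₀` in the factor `i`
  let p : (Σ i, Fin (d i)) → ∀ i, Matrix (Fin (d i)) (Fin (d i)) ℂ := fun x =>
    Pi.single x.1 (U x.1 * Matrix.single x.2 x.2 1 * U' x.1)
  have hsingle : ∀ (i : Fin n) (a b : Matrix (Fin (d i)) (Fin (d i)) ℂ),
      U i * a * U' i * (U i * b * U' i) = U i * (a * b) * U' i := by
    intro i a b
    calc U i * a * U' i * (U i * b * U' i) = U i * a * (U' i * U i) * b * U' i := by
          simp only [mul_assoc]
      _ = U i * (a * b) * U' i := by rw [h, mul_one]; simp only [mul_assoc]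
  have hp : ∀ x, p x * p x = p x := by
    rintro ⟨i, k⟩
    simp only [p]
    rw [← Pi.single_mul, hsingle, single_mul_single_same, mul_one]
  have hpq : ∀ x y, x ≠ y → p x * p y = 0 := by
    rintro ⟨i, k⟩ ⟨j, l⟩ hne
    simp only [p]
    by_cases hij : i = j
    · subst hij
      have hkl : k ≠ l := fun e => hne (by rw [e])
      rw [← Pi.single_mul, hsingle, single_mul_single_of_ne _ _ _ _ hkl, mul_zero, zero_mul,
        Pi.single_zero]
    · funext m
      by_cases hm : m = i
      · subst hm; simp [hij]
      · simp [hm]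
  have hsum : (fun i => U i * diagonal (fun j => if j ∈ s i then (1 : ℂ) else 0) * U' i)
      = ∑ x ∈ Finset.univ.sigma s, p x := by
    rw [Finset.sum_sigma]
    funext i
    have hdiag : (diagonal fun j => if j ∈ s i then (1 : ℂ) else 0)
        = ∑ k ∈ s i, Matrix.single k k 1 := by
      ext a b
      rw [Matrix.sum_apply, diagonal_apply]
      by_cases hab : a = b
      · subst hab; simp [Matrix.single_apply]
      · rw [if_neg hab, Finset.sum_eq_zero]
        intro k _
        rw [Matrix.single_apply, if_neg]
        rintro ⟨rfl, rfl⟩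
        exact hab rfl
    rw [hdiag, Finset.mul_sum, Finset.sum_mul, Finset.sum_apply,
      Finset.sum_eq_single_of_mem i (Finset.mem_univ i)]
    · rw [Finset.sum_apply]
      simp [p]
    · intro j _ hji
      rw [Finset.sum_apply]
      exact Finset.sum_eq_zero fun k _ => by simp [p, Ne.symm hji]
  rw [hsum, hf.map_sum _ _ (fun x _ => hp x) fun x _ y _ => hpq x y, Finset.sum_sigma]
  refine Finset.sum_congr rfl fun i _ => ?_
  rw [← Finset.sum_const]
  refine Finset.sum_congr rfl fun k _ => ?_
  refine hf.conj (Pi.single i (U i * Matrix.single k 0 1))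
    (Pi.single i (Matrix.single 0 k 1 * U' i)) _ _ (hp _) ?_ ?_ ?_
  · rw [← Pi.single_mul, single_mul_single_same, mul_one]
  · rw [← Pi.single_mul]
    simp only [p]
    congr 1
    calc U i * Matrix.single k 0 1 * (Matrix.single 0 k 1 * U' i)
        = U i * (Matrix.single k 0 (1 : ℂ) * Matrix.single 0 k 1) * U' i := by
          simp only [mul_assoc]
      _ = _ := by rw [single_mul_single_same, mul_one]
  · rw [← Pi.single_mul]
    congr 1
    calc Matrix.single 0 k 1 * U' i * (U i * Matrix.single k 0 1)
        = Matrix.single 0 k (1 : ℂ) * (U' i * U i) * Matrix.single k 0 1 := by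
          simp only [mul_assoc]
      _ = _ := by rw [h, mul_one, single_mul_single_same, mul_one]

end IsIdempotentAdditive

end Idempotents

/-! ### Spectral projections as polynomials -/

section SpectralProjection

open Polynomial

variable {A : Type*} [Ring A] [Algebra ℂ A]

/-- The polynomial in `T` that projects onto the eigenspace for `μ`, when `T` is annihilated by
`∏ (X - ν)`, the product being over the finite set `R`. -/
noncomputable def spectralProjection (R : Finset ℂ) (T : A) (μ : ℂ) : A :=
  aeval T (Lagrange.basis R id μ)

variable {R : Finset ℂ} {T : A}

theorem mul_spectralProjection (hT : aeval T (∏ ν ∈ R, (X - C ν)) = 0) {μ : ℂ} (hμ : μ ∈ R) :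
    T * spectralProjection R T μ = μ • spectralProjection R T μ := by
  have h : ∃ c : ℂ, (X - C μ) * Lagrange.basis R id μ = C c * ∏ ν ∈ R, (X - C ν) := by
    refine ⟨∏ ν ∈ R.erase μ, (μ - ν)⁻¹, ?_⟩
    rw [Lagrange.basis, ← Finset.mul_prod_erase R _ hμ, map_prod]
    simp only [Lagrange.basisDivisor, id]
    rw [Finset.prod_mul_distrib]
    ring
  obtain ⟨c, hc⟩ := h
  have h2 := congrArg (aeval T) hc
  rw [map_mul, map_mul, hT, mul_zero, map_sub, aeval_X, aeval_C, sub_mul, sub_eq_zero,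
    ← Algebra.smul_def] at h2
  exact h2

theorem sum_spectralProjection (hR : R.Nonempty) :
    ∑ μ ∈ R, spectralProjection R T μ = 1 := by
  simp only [spectralProjection]
  rw [← map_sum, Lagrange.sum_basis Function.injective_id.injOn hR, map_one]

theorem aeval_mul_of_mul_eq_smul {T e : A} {μ : ℂ} (h : T * e = μ • e) (p : ℂ[X]) :
    aeval T p * e = p.eval μ • e := by
  induction p using Polynomial.induction_on' with
  | add p q hp hq => rw [map_add, add_mul, hp, hq, eval_add, add_smul]
  | monomial n a =>
    have : ∀ n : ℕ, T ^ n * e = μ ^ n • e := by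
      intro n
      induction n with
      | zero => simp
      | succ n ih => rw [pow_succ', mul_assoc, ih, mul_smul_comm, h, smul_smul, pow_succ]
    rw [aeval_monomial, mul_assoc, this, eval_monomial, ← Algebra.smul_def, smul_smul]

theorem spectralProjection_mul_spectralProjection (hT : aeval T (∏ ν ∈ R, (X - C ν)) = 0)
    {μ ν : ℂ} (hμ : μ ∈ R) (hν : ν ∈ R) :
    spectralProjection R T μ * spectralProjection R T ν =
      if μ = ν then spectralProjection R T μ else 0 := by
  rw [spectralProjection, aeval_mul_of_mul_eq_smul (mul_spectralProjection hT hν)]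
  split_ifs with h
  · subst h
    rw [show (Lagrange.basis R id μ).eval μ = 1 from
      Lagrange.eval_basis_self Function.injective_id.injOn hμ, one_smul]
    rfl
  · rw [show (Lagrange.basis R id μ).eval ν = 0 from Lagrange.eval_basis_of_ne (v := id) h hν,
      zero_smul]

theorem map_spectralProjection {B : Type*} [Ring B] [Algebra ℂ B] (φ : A →ₐ[ℂ] B) (μ : ℂ) :
    φ (spectralProjection R T μ) = spectralProjection R (φ T) μ := by
  rw [spectralProjection, spectralProjection, Polynomial.aeval_algHom_apply]

end SpectralProjection

/-! ### Spaces with functions whose regular functions form local rings -/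

namespace FunSpace

/-- The neighbourhoods of a point in the Zariski topology. -/
abbrev nbhd {X : Type u} (𝒳 : FunSpace X) (x : X) : Filter X := @nhds X 𝒳.top x

/-- The regular functions contain the constants, are closed under the ring operations and under
inverses where they do not vanish, and have closed zero loci. Every variety has these properties,
which are not part of the definition of a space with functions. -/
structure IsRinged {X : Type u} (𝒳 : FunSpace X) : Prop where
  const : ∀ (c : ℂ) (x : X), 𝒳.RegAt (fun _ => c) x
  add : ∀ {f g : X → ℂ} {x : X}, 𝒳.RegAt f x → 𝒳.RegAt g x → 𝒳.RegAt (fun y => f y + g y) x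
  mul : ∀ {f g : X → ℂ} {x : X}, 𝒳.RegAt f x → 𝒳.RegAt g x → 𝒳.RegAt (fun y => f y * g y) x
  inv : ∀ {f : X → ℂ} {x : X}, 𝒳.RegAt f x → f x ≠ 0 → 𝒳.RegAt (fun y => (f y)⁻¹) x
  ne_zero : ∀ {f : X → ℂ} {x : X}, 𝒳.RegAt f x → f x ≠ 0 → ∀ᶠ y in 𝒳.nbhd x, f y ≠ 0

theorem eventually_iff {X : Type u} (𝒳 : FunSpace X) {x : X} {p : X → Prop} :
    (∀ᶠ y in 𝒳.nbhd x, p y) ↔ ∃ U, 𝒳.Open U ∧ x ∈ U ∧ ∀ y ∈ U, p y := by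
  let _ := 𝒳.top
  rw [_root_.eventually_nhds_iff]
  constructor
  · rintro ⟨U, h1, h2, h3⟩; exact ⟨U, h2, h3, h1⟩
  · rintro ⟨U, h1, h2, h3⟩; exact ⟨U, h3, h1, h2⟩

theorem Open.eventually_mem {X : Type u} {𝒳 : FunSpace X} {U : Set X} (hU : 𝒳.Open U) {x : X}
    (hx : x ∈ U) : ∀ᶠ y in 𝒳.nbhd x, y ∈ U :=
  𝒳.eventually_iff.2 ⟨U, hU, hx, fun _ h => h⟩

theorem open_iff {X : Type u} {𝒳 : FunSpace X} {U : Set X} :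
    𝒳.Open U ↔ ∀ x ∈ U, ∀ᶠ y in 𝒳.nbhd x, y ∈ U := by
  let _ := 𝒳.top
  exact isOpen_iff_mem_nhds

theorem Open.inter {X : Type u} {𝒳 : FunSpace X} {U V : Set X} (hU : 𝒳.Open U) (hV : 𝒳.Open V) :
    𝒳.Open (U ∩ V) :=
  @IsOpen.inter X 𝒳.top U V hU hV

theorem open_univ {X : Type u} (𝒳 : FunSpace X) : 𝒳.Open Set.univ := @isOpen_univ X 𝒳.top

theorem eventually_self {X : Type u} {𝒳 : FunSpace X} {x : X} {p : X → Prop}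
    (h : ∀ᶠ y in 𝒳.nbhd x, p y) : p x := by
  obtain ⟨U, -, hx, hp⟩ := 𝒳.eventually_iff.1 h
  exact hp x hx

namespace IsRinged

variable {X : Type u} {𝒳 : FunSpace X} (h𝒳 : 𝒳.IsRinged)

include h𝒳

theorem neg {f : X → ℂ} {x : X} (hf : 𝒳.RegAt f x) : 𝒳.RegAt (fun y => -f y) x := by
  simpa using h𝒳.mul (h𝒳.const (-1) x) hf

theorem sub {f g : X → ℂ} {x : X} (hf : 𝒳.RegAt f x) (hg : 𝒳.RegAt g x) :
    𝒳.RegAt (fun y => f y - g y) x := by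
  simpa [sub_eq_add_neg] using h𝒳.add hf (h𝒳.neg hg)

theorem sum {ι : Type*} (s : Finset ι) {f : ι → X → ℂ} {x : X} (hf : ∀ i ∈ s, 𝒳.RegAt (f i) x) :
    𝒳.RegAt (fun y => ∑ i ∈ s, f i y) x := by
  classical
  induction s using Finset.induction_on with
  | empty => simpa using h𝒳.const 0 x
  | insert j s hj ih =>
    simp only [Finset.sum_insert hj]
    exact h𝒳.add (hf _ (Finset.mem_insert_self _ _))
      (ih fun i hi => hf i (Finset.mem_insert_of_mem hi))

theorem prod {ι : Type*} (s : Finset ι) {f : ι → X → ℂ} {x : X} (hf : ∀ i ∈ s, 𝒳.RegAt (f i) x) :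
    𝒳.RegAt (fun y => ∏ i ∈ s, f i y) x := by
  classical
  induction s using Finset.induction_on with
  | empty => simpa using h𝒳.const 1 x
  | insert j s hj ih =>
    simp only [Finset.prod_insert hj]
    exact h𝒳.mul (hf _ (Finset.mem_insert_self _ _))
      (ih fun i hi => hf i (Finset.mem_insert_of_mem hi))

theorem det {ι : Type*} [Fintype ι] [DecidableEq ι] {M : X → Matrix ι ι ℂ} {x : X}
    (hM : ∀ i j, 𝒳.RegAt (fun y => M y i j) x) : 𝒳.RegAt (fun y => (M y).det) x := by
  simp only [Matrix.det_apply', mul_comm ((Equiv.Perm.sign _ : ℤ) : ℂ)]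
  exact h𝒳.sum _ fun σ _ => h𝒳.mul (h𝒳.prod _ fun i _ => hM _ _) (h𝒳.const _ _)

theorem div {f g : X → ℂ} {x : X} (hf : 𝒳.RegAt f x) (hg : 𝒳.RegAt g x) (h0 : g x ≠ 0) :
    𝒳.RegAt (fun y => f y / g y) x := by
  simpa [div_eq_mul_inv] using h𝒳.mul hf (h𝒳.inv hg h0)

theorem matrix_inv {ι : Type*} [Fintype ι] [DecidableEq ι] {M : X → Matrix ι ι ℂ} {x : X}
    (hM : ∀ i j, 𝒳.RegAt (fun y => M y i j) x) (h0 : (M x).det ≠ 0) (i j : ι) :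
    𝒳.RegAt (fun y => (M y)⁻¹ i j) x := by
  have : ∀ y, (M y)⁻¹ i j = ((M y).det)⁻¹ * ((M y).updateRow j (Pi.single i 1)).det := by
    intro y
    rw [Matrix.inv_def, Matrix.smul_apply, Ring.inverse_eq_inv', smul_eq_mul, Matrix.adjugate_apply]
  simp only [this]
  refine h𝒳.mul (h𝒳.inv (h𝒳.det hM) h0) (h𝒳.det fun a b => ?_)
  by_cases ha : a = j
  · subst ha
    simpa using h𝒳.const _ x
  · simpa [Matrix.updateRow_ne ha] using hM a b

theorem eventually_ne {f : X → ℂ} {x : X} (hf : 𝒳.RegAt f x) {c : ℂ} (h : f x ≠ c) :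
    ∀ᶠ y in 𝒳.nbhd x, f y ≠ c := by
  filter_upwards [h𝒳.ne_zero (h𝒳.sub hf (h𝒳.const c x)) (sub_ne_zero.2 h)] with y hy
  exact sub_ne_zero.1 hy

end IsRinged

/-! ### Morphisms -/

section Morphisms

variable {X : Type*} {Y : Type*} {Z : Type*} {𝒳 : FunSpace X} {𝒴 : FunSpace Y} {𝒵 : FunSpace Z}

theorem IsMorphism.eventually {φ : X → Y} (hφ : IsMorphism 𝒳 𝒴 φ) {x : X} {p : Y → Prop}
    (h : ∀ᶠ y in 𝒴.nbhd (φ x), p y) : ∀ᶠ z in 𝒳.nbhd x, p (φ z) := by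
  let _ := 𝒳.top
  let _ := 𝒴.top
  have hc : Continuous φ := hφ.1
  exact hc.continuousAt.eventually h

theorem IsMorphism.open_preimage {φ : X → Y} (hφ : IsMorphism 𝒳 𝒴 φ) {U : Set Y}
    (hU : 𝒴.Open U) : 𝒳.Open (φ ⁻¹' U) :=
  @IsOpen.preimage X Y 𝒳.top 𝒴.top φ hφ.1 U hU

theorem IsMorphism.regAt {φ : X → Y} (hφ : IsMorphism 𝒳 𝒴 φ) {f : Y → ℂ} {x : X}
    (h : 𝒴.RegAt f (φ x)) : 𝒳.RegAt (fun z => f (φ z)) x :=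
  hφ.2 f x h

theorem IsMorphism.comp {ψ : Y → Z} {φ : X → Y} (hψ : IsMorphism 𝒴 𝒵 ψ) (hφ : IsMorphism 𝒳 𝒴 φ) :
    IsMorphism 𝒳 𝒵 (fun x => ψ (φ x)) :=
  ⟨@Continuous.comp X Y Z 𝒳.top 𝒴.top 𝒵.top φ ψ hψ.1 hφ.1,
    fun f x hf => hφ.2 (f ∘ ψ) x (hψ.2 f (φ x) hf)⟩

theorem isMorphism_id : IsMorphism 𝒳 𝒳 (fun x => x) :=
  ⟨@continuous_id X 𝒳.top, fun _ _ hf => hf⟩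

theorem isMorphism_const (h𝒳 : 𝒳.IsRinged) (y : Y) : IsMorphism 𝒳 𝒴 (fun _ => y) :=
  ⟨@continuous_const X Y 𝒳.top 𝒴.top y, fun f x _ => h𝒳.const (f y) x⟩

theorem isMorphism_val (S : Set X) : IsMorphism (𝒳.sub S) 𝒳 Subtype.val := by
  refine ⟨@continuous_induced_dom S X Subtype.val 𝒳.top, fun f x hf => ⟨f, hf, ?_⟩⟩
  exact Filter.Eventually.of_forall fun _ => rfl

theorem isMorphism_sub_mk {S : Set Y} {φ : X → Y} (hφ : IsMorphism 𝒳 𝒴 φ) (h : ∀ x, φ x ∈ S) :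
    IsMorphism 𝒳 (𝒴.sub S) (fun x => (⟨φ x, h x⟩ : S)) := by
  have hc : @Continuous X S 𝒳.top (𝒴.sub S).top (fun x => (⟨φ x, h x⟩ : S)) := by
    let _ := 𝒳.top
    let _ := 𝒴.top
    have : Continuous φ := hφ.1
    exact this.subtype_mk h
  refine ⟨hc, ?_⟩
  rintro f x ⟨F, hF, hfF⟩
  refine 𝒳.congr' (hφ.2 F x hF) ?_
  let _ := 𝒳.top
  let _ := (𝒴.sub S).top
  filter_upwards [hc.continuousAt.eventually hfF] with y hy
  exact hy.symm

end Morphisms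

/-! ### Subspaces, affine spaces and varieties -/

section Sub

variable {X : Type*} {𝒳 : FunSpace X}

theorem IsRinged.sub_isRinged (h𝒳 : 𝒳.IsRinged) (S : Set X) : (𝒳.sub S).IsRinged where
  const c x := ⟨fun _ => c, h𝒳.const c x, Filter.Eventually.of_forall fun _ => rfl⟩
  add := by
    rintro f g x ⟨F, hF, hf⟩ ⟨G, hG, hg⟩
    refine ⟨_, h𝒳.add hF hG, ?_⟩
    filter_upwards [hf, hg] with y h1 h2
    rw [h1, h2]
  mul := by
    rintro f g x ⟨F, hF, hf⟩ ⟨G, hG, hg⟩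
    refine ⟨_, h𝒳.mul hF hG, ?_⟩
    filter_upwards [hf, hg] with y h1 h2
    rw [h1, h2]
  inv := by
    rintro f x ⟨F, hF, hf⟩ h0
    have hx : f x = F x := eventually_self (𝒳 := 𝒳.sub S) hf
    refine ⟨_, h𝒳.inv hF (hx ▸ h0), ?_⟩
    filter_upwards [hf] with y h1
    rw [h1]
  ne_zero := by
    rintro f x ⟨F, hF, hf⟩ h0
    have hx : f x = F x := eventually_self (𝒳 := 𝒳.sub S) hf
    filter_upwards [hf, (isMorphism_val (𝒳 := 𝒳) S).eventually (h𝒳.ne_zero hF (hx ▸ h0))]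
      with y h1 h2
    rwa [h1]

theorem Open.eventually_sub_iff {U : Set X} (hU : 𝒳.Open U) {x : U} {p : X → Prop} :
    (∀ᶠ y : U in (𝒳.sub U).nbhd x, p y) ↔ ∀ᶠ y in 𝒳.nbhd (x : X), p y := by
  let _ := 𝒳.top
  have hU' : IsOpen U := hU
  have h := map_nhds_subtype_coe_eq_nhds x.2 (hU'.mem_nhds x.2)
  change _ ↔ ∀ᶠ y in nhds (x : X), p y
  rw [← h]
  exact Filter.eventually_map.symm

theorem Open.sub_regAt_iff {U : Set X} (hU : 𝒳.Open U) {x : U} {f : X → ℂ} :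
    (𝒳.sub U).RegAt (fun y => f y) x ↔ 𝒳.RegAt f x := by
  constructor
  · rintro ⟨F, hF, h⟩
    refine 𝒳.congr' hF ?_
    filter_upwards [(hU.eventually_sub_iff (p := fun y => f y = F y)).1 h] with y hy
    exact hy.symm
  · intro h
    exact (isMorphism_val U).regAt h

theorem isRinged_of_local (h : ∀ x, ∃ U, 𝒳.Open U ∧ x ∈ U ∧ (𝒳.sub U).IsRinged) :
    𝒳.IsRinged where
  const c x := by
    obtain ⟨U, hU, hx, hr⟩ := h x
    exact (hU.sub_regAt_iff (x := ⟨x, hx⟩) (f := fun _ => c)).1 (hr.const c ⟨x, hx⟩)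
  add := by
    intro f g x hf hg
    obtain ⟨U, hU, hx, hr⟩ := h x
    exact (hU.sub_regAt_iff (x := ⟨x, hx⟩)).1
      (hr.add (hU.sub_regAt_iff.2 hf) (hU.sub_regAt_iff.2 hg))
  mul := by
    intro f g x hf hg
    obtain ⟨U, hU, hx, hr⟩ := h x
    exact (hU.sub_regAt_iff (x := ⟨x, hx⟩)).1
      (hr.mul (hU.sub_regAt_iff.2 hf) (hU.sub_regAt_iff.2 hg))
  inv := by
    intro f x hf h0
    obtain ⟨U, hU, hx, hr⟩ := h x
    exact (hU.sub_regAt_iff (x := ⟨x, hx⟩) (f := fun y => (f y)⁻¹)).1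
      (hr.inv (hU.sub_regAt_iff.2 hf) h0)
  ne_zero := by
    intro f x hf h0
    obtain ⟨U, hU, hx, hr⟩ := h x
    exact (hU.eventually_sub_iff (x := ⟨x, hx⟩) (p := fun y => f y ≠ 0)).1
      (hr.ne_zero (hU.sub_regAt_iff.2 hf) h0)

theorem IsRinged.of_isIsomorphic {Y : Type*} {𝒴 : FunSpace Y} (h : IsIsomorphic 𝒳 𝒴)
    (h𝒴 : 𝒴.IsRinged) : 𝒳.IsRinged := by
  obtain ⟨e, h1, h2⟩ := h
  have push : ∀ {f : X → ℂ} {x : X}, 𝒳.RegAt f x → 𝒴.RegAt (fun y => f (e.symm y)) (e x) :=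
    fun {f x} hf => h2.2 f (e x) (by rwa [e.symm_apply_apply])
  have pull : ∀ {f : X → ℂ} {x : X}, 𝒴.RegAt (fun y => f (e.symm y)) (e x) → 𝒳.RegAt f x := by
    intro f x hf
    have := h1.regAt hf
    simpa using this
  exact
    { const := fun c x => pull (h𝒴.const c (e x))
      add := fun hf hg => pull (h𝒴.add (push hf) (push hg))
      mul := fun hf hg => pull (h𝒴.mul (push hf) (push hg))
      inv := fun {f x} hf h0 => pull (f := fun y => (f y)⁻¹)
        (h𝒴.inv (push hf) (by simpa using h0))
      ne_zero := fun {f x} hf h0 => by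
        have := h1.eventually (h𝒴.ne_zero (push hf) (by simpa using h0))
        simpa using this }

end Sub

theorem affineSpace_open {n : ℕ} (q : MvPolynomial (Fin n) ℂ) :
    (affineSpace n).Open {z | MvPolynomial.eval z q ≠ 0} :=
  TopologicalSpace.isOpen_generateFrom_of_mem ⟨q, rfl⟩

theorem affineSpace_isRinged (n : ℕ) : (affineSpace n).IsRinged where
  const c x := ⟨MvPolynomial.C c, 1, by simp, Filter.Eventually.of_forall fun z => by simp⟩
  add := by
    rintro f g x ⟨p, q, hq, h⟩ ⟨p', q', hq', h'⟩
    refine ⟨p * q' + p' * q, q * q', by simp [hq, hq'], ?_⟩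
    filter_upwards [h, h', (affineSpace_open q).eventually_mem hq,
      (affineSpace_open q').eventually_mem hq'] with y h1 h2 h3 h4
    rw [h1, h2, div_add_div _ _ h3 h4]
    simp [mul_comm]
  mul := by
    rintro f g x ⟨p, q, hq, h⟩ ⟨p', q', hq', h'⟩
    refine ⟨p * p', q * q', by simp [hq, hq'], ?_⟩
    filter_upwards [h, h'] with y h1 h2
    rw [h1, h2, div_mul_div_comm]
    simp
  inv := by
    rintro f x ⟨p, q, hq, h⟩ h0
    have hx : f x = _ := eventually_self (𝒳 := affineSpace n) h
    refine ⟨q, p, fun hp => h0 (by rw [hx, hp, zero_div]), ?_⟩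
    filter_upwards [h] with y h1
    rw [h1, inv_div]
  ne_zero := by
    rintro f x ⟨p, q, hq, h⟩ h0
    have hx : f x = _ := eventually_self (𝒳 := affineSpace n) h
    have hp : MvPolynomial.eval x p ≠ 0 := fun hp => h0 (by rw [hx, hp, zero_div])
    filter_upwards [h, (affineSpace_open q).eventually_mem hq,
      (affineSpace_open p).eventually_mem hp] with y h1 h2 h3
    rw [h1]
    exact div_ne_zero h3 h2

theorem IsAffine.isRinged {X : Type*} {𝒳 : FunSpace X} (h : 𝒳.IsAffine) : 𝒳.IsRinged := by
  obtain ⟨n, P, h⟩ := h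
  exact IsRinged.of_isIsomorphic h ((affineSpace_isRinged n).sub_isRinged _)

theorem IsVariety.isRinged {X : Type*} {𝒳 : FunSpace X} (h : 𝒳.IsVariety) : 𝒳.IsRinged :=
  isRinged_of_local fun x =>
    let ⟨U, hU, hx, ha⟩ := h.locallyAffine x
    ⟨U, hU, hx, ha.isRinged⟩

end FunSpace

/-! ### Products of spaces with functions -/

namespace FunSpace

section Prod

variable {X : Type u} {Y : Type v} {𝒳 : FunSpace X} {𝒴 : FunSpace Y}

namespace IsTensorOn

variable {U U' : Set X} {V V' : Set Y} {N N' : X × Y → ℂ}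

theorem of_fintype {ι : Type*} [Fintype ι] {f : ι → X → ℂ} {g : ι → Y → ℂ}
    (hf : ∀ i, 𝒳.RegOn (f i) U) (hg : ∀ i, 𝒴.RegOn (g i) V)
    (h : ∀ x ∈ U, ∀ y ∈ V, N (x, y) = ∑ i, f i x * g i y) : IsTensorOn 𝒳 𝒴 U V N := by
  refine ⟨Fintype.card ι, fun i => f ((Fintype.equivFin ι).symm i),
    fun i => g ((Fintype.equivFin ι).symm i), fun i => hf _, fun i => hg _, fun x hx y hy => ?_⟩
  rw [h x hx y hy]
  exact (Equiv.sum_comp (Fintype.equivFin ι).symm fun i => f i x * g i y).symm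

theorem mono (h : IsTensorOn 𝒳 𝒴 U V N) (hU : U' ⊆ U) (hV : V' ⊆ V) :
    IsTensorOn 𝒳 𝒴 U' V' N := by
  obtain ⟨n, f, g, hf, hg, hN⟩ := h
  exact ⟨n, f, g, fun i x hx => hf i x (hU hx), fun i y hy => hg i y (hV hy),
    fun x hx y hy => hN x (hU hx) y (hV hy)⟩

theorem const (h𝒳 : 𝒳.IsRinged) (h𝒴 : 𝒴.IsRinged) (c : ℂ) :
    IsTensorOn 𝒳 𝒴 U V (fun _ => c) :=
  ⟨1, fun _ _ => c, fun _ _ => 1, fun _ x _ => h𝒳.const c x, fun _ y _ => h𝒴.const 1 y,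
    fun x _ y _ => by simp⟩

theorem fst (h𝒴 : 𝒴.IsRinged) {f : X → ℂ} (hf : 𝒳.RegOn f U) :
    IsTensorOn 𝒳 𝒴 U V (fun p => f p.1) :=
  ⟨1, fun _ => f, fun _ _ => 1, fun _ => hf, fun _ y _ => h𝒴.const 1 y, fun x _ y _ => by simp⟩

theorem snd (h𝒳 : 𝒳.IsRinged) {g : Y → ℂ} (hg : 𝒴.RegOn g V) :
    IsTensorOn 𝒳 𝒴 U V (fun p => g p.2) :=
  ⟨1, fun _ _ => 1, fun _ => g, fun _ x _ => h𝒳.const 1 x, fun _ => hg, fun x _ y _ => by simp⟩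

theorem add (h : IsTensorOn 𝒳 𝒴 U V N) (h' : IsTensorOn 𝒳 𝒴 U V N') :
    IsTensorOn 𝒳 𝒴 U V (fun p => N p + N' p) := by
  obtain ⟨n, f, g, hf, hg, hN⟩ := h
  obtain ⟨n', f', g', hf', hg', hN'⟩ := h'
  refine of_fintype (ι := Fin n ⊕ Fin n') (f := Sum.elim f f') (g := Sum.elim g g') ?_ ?_ ?_
  · rintro (i | i); exacts [hf i, hf' i]
  · rintro (i | i); exacts [hg i, hg' i]
  · intro x hx y hy
    simp [hN x hx y hy, hN' x hx y hy]

theorem mul (h𝒳 : 𝒳.IsRinged) (h𝒴 : 𝒴.IsRinged) (h : IsTensorOn 𝒳 𝒴 U V N)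
    (h' : IsTensorOn 𝒳 𝒴 U V N') : IsTensorOn 𝒳 𝒴 U V (fun p => N p * N' p) := by
  obtain ⟨n, f, g, hf, hg, hN⟩ := h
  obtain ⟨n', f', g', hf', hg', hN'⟩ := h'
  refine of_fintype (ι := Fin n × Fin n') (f := fun i x => f i.1 x * f' i.2 x)
    (g := fun i y => g i.1 y * g' i.2 y) (fun i x hx => h𝒳.mul (hf _ x hx) (hf' _ x hx))
    (fun i y hy => h𝒴.mul (hg _ y hy) (hg' _ y hy)) fun x hx y hy => ?_
  rw [hN x hx y hy, hN' x hx y hy, Finset.sum_mul_sum, Fintype.sum_prod_type]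
  exact Finset.sum_congr rfl fun i _ => Finset.sum_congr rfl fun j _ => by ring

end IsTensorOn

theorem prod_open {U : Set X} {V : Set Y} {N : X × Y → ℂ} (hU : 𝒳.Open U) (hV : 𝒴.Open V)
    (hN : IsTensorOn 𝒳 𝒴 U V N) : (prod 𝒳 𝒴).Open {p | p.1 ∈ U ∧ p.2 ∈ V ∧ N p ≠ 0} :=
  TopologicalSpace.isOpen_generateFrom_of_mem ⟨U, V, N, hU, hV, hN, rfl⟩

theorem prod_regAt_of_isTensorOn (h𝒳 : 𝒳.IsRinged) (h𝒴 : 𝒴.IsRinged) {U : Set X} {V : Set Y}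
    {N : X × Y → ℂ} (hU : 𝒳.Open U) (hV : 𝒴.Open V) (hN : IsTensorOn 𝒳 𝒴 U V N) {p : X × Y}
    (h1 : p.1 ∈ U) (h2 : p.2 ∈ V) : (prod 𝒳 𝒴).RegAt N p :=
  ⟨U, V, N, fun _ => 1, hU, hV, h1, h2, hN, IsTensorOn.const h𝒳 h𝒴 1, one_ne_zero,
    Filter.Eventually.of_forall fun _ => by simp⟩

theorem prod_isRinged (h𝒳 : 𝒳.IsRinged) (h𝒴 : 𝒴.IsRinged) : (prod 𝒳 𝒴).IsRinged where
  const c p := prod_regAt_of_isTensorOn h𝒳 h𝒴 𝒳.open_univ 𝒴.open_univ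
    (IsTensorOn.const h𝒳 h𝒴 c) trivial trivial
  add := by
    rintro f g p ⟨U, V, N, D, hU, hV, hpU, hpV, hN, hD, hp, h⟩
      ⟨U', V', N', D', hU', hV', hpU', hpV', hN', hD', hp', h'⟩
    have hD1 := hD.mono (Set.inter_subset_left (t := U')) (Set.inter_subset_left (t := V'))
    have hD2 := hD'.mono (Set.inter_subset_right (s := U)) (Set.inter_subset_right (s := V))
    refine ⟨U ∩ U', V ∩ V', _, _, hU.inter hU', hV.inter hV', ⟨hpU, hpU'⟩, ⟨hpV, hpV'⟩,
      (IsTensorOn.mul h𝒳 h𝒴 (hN.mono Set.inter_subset_left Set.inter_subset_left) hD2).add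
        (IsTensorOn.mul h𝒳 h𝒴 hD1 (hN'.mono Set.inter_subset_right Set.inter_subset_right)),
      IsTensorOn.mul h𝒳 h𝒴 hD1 hD2, mul_ne_zero hp hp', ?_⟩
    filter_upwards [h, h', (prod_open hU hV hD).eventually_mem ⟨hpU, hpV, hp⟩,
      (prod_open hU' hV' hD').eventually_mem ⟨hpU', hpV', hp'⟩] with q h1 h2 h3 h4
    rw [h1, h2, div_add_div _ _ h3.2.2 h4.2.2]
  mul := by
    rintro f g p ⟨U, V, N, D, hU, hV, hpU, hpV, hN, hD, hp, h⟩
      ⟨U', V', N', D', hU', hV', hpU', hpV', hN', hD', hp', h'⟩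
    refine ⟨U ∩ U', V ∩ V', _, _, hU.inter hU', hV.inter hV', ⟨hpU, hpU'⟩, ⟨hpV, hpV'⟩,
      IsTensorOn.mul h𝒳 h𝒴 (hN.mono Set.inter_subset_left Set.inter_subset_left)
        (hN'.mono Set.inter_subset_right Set.inter_subset_right),
      IsTensorOn.mul h𝒳 h𝒴 (hD.mono Set.inter_subset_left Set.inter_subset_left)
        (hD'.mono Set.inter_subset_right Set.inter_subset_right), mul_ne_zero hp hp', ?_⟩
    filter_upwards [h, h'] with q h1 h2
    rw [h1, h2, div_mul_div_comm]
  inv := by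
    rintro f p ⟨U, V, N, D, hU, hV, hpU, hpV, hN, hD, hp, h⟩ h0
    have hx : f p = _ := eventually_self (𝒳 := prod 𝒳 𝒴) h
    refine ⟨U, V, D, N, hU, hV, hpU, hpV, hD, hN, fun hp => h0 (by rw [hx, hp, zero_div]), ?_⟩
    filter_upwards [h] with y h1
    rw [h1, inv_div]
  ne_zero := by
    rintro f p ⟨U, V, N, D, hU, hV, hpU, hpV, hN, hD, hp, h⟩ h0
    have hx : f p = _ := eventually_self (𝒳 := prod 𝒳 𝒴) h
    have hN0 : N p ≠ 0 := fun hp => h0 (by rw [hx, hp, zero_div])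
    filter_upwards [h, (prod_open hU hV hD).eventually_mem ⟨hpU, hpV, hp⟩,
      (prod_open hU hV hN).eventually_mem ⟨hpU, hpV, hN0⟩] with q h1 h2 h3
    rw [h1]
    exact div_ne_zero h3.2.2 h2.2.2

theorem exists_regOn_of_regAt {f : X → ℂ} {x : X} (hf : 𝒳.RegAt f x) :
    ∃ U, 𝒳.Open U ∧ x ∈ U ∧ 𝒳.RegOn f U :=
  𝒳.eventually_iff.1 (𝒳.nearby hf)

theorem isMorphism_fst (h𝒳 : 𝒳.IsRinged) (h𝒴 : 𝒴.IsRinged) :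
    IsMorphism (prod 𝒳 𝒴) 𝒳 (fun p => p.1) := by
  constructor
  · let _ := 𝒳.top
    let _ := (prod 𝒳 𝒴).top
    refine continuous_def.2 fun U hU => ?_
    have := prod_open (𝒳 := 𝒳) (𝒴 := 𝒴) (N := fun _ => 1) (show 𝒳.Open U from hU) 𝒴.open_univ
      (IsTensorOn.const h𝒳 h𝒴 1)
    simpa using! this
  · intro f p hf
    obtain ⟨U, hU, hx, hr⟩ := exists_regOn_of_regAt hf
    exact prod_regAt_of_isTensorOn h𝒳 h𝒴 hU 𝒴.open_univ (IsTensorOn.fst h𝒴 hr) hx trivial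

theorem isMorphism_snd (h𝒳 : 𝒳.IsRinged) (h𝒴 : 𝒴.IsRinged) :
    IsMorphism (prod 𝒳 𝒴) 𝒴 (fun p => p.2) := by
  constructor
  · let _ := 𝒴.top
    let _ := (prod 𝒳 𝒴).top
    refine continuous_def.2 fun V hV => ?_
    have := prod_open (𝒳 := 𝒳) (𝒴 := 𝒴) (N := fun _ => 1) 𝒳.open_univ (show 𝒴.Open V from hV)
      (IsTensorOn.const h𝒳 h𝒴 1)
    simpa using! this
  · intro f p hf
    obtain ⟨V, hV, hx, hr⟩ := exists_regOn_of_regAt hf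
    exact prod_regAt_of_isTensorOn h𝒳 h𝒴 𝒳.open_univ hV (IsTensorOn.snd h𝒳 hr) trivial hx

theorem isMorphism_prodMk {Z : Type*} {𝒵 : FunSpace Z} (h𝒵 : 𝒵.IsRinged) {φ : Z → X} {ψ : Z → Y}
    (hφ : IsMorphism 𝒵 𝒳 φ) (hψ : IsMorphism 𝒵 𝒴 ψ) :
    IsMorphism 𝒵 (prod 𝒳 𝒴) (fun z => (φ z, ψ z)) := by
  have hT : ∀ (U : Set X) (V : Set Y) (N : X × Y → ℂ) (z : Z), 𝒳.Open U → 𝒴.Open V →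
      IsTensorOn 𝒳 𝒴 U V N → φ z ∈ U → ψ z ∈ V → 𝒵.RegAt (fun z => N (φ z, ψ z)) z := by
    rintro U V N z hU hV ⟨n, f, g, hf, hg, hN⟩ h1 h2
    refine 𝒵.congr' (h𝒵.sum Finset.univ (f := fun i z => f i (φ z) * g i (ψ z)) fun i _ =>
      h𝒵.mul (hφ.regAt (hf i _ h1)) (hψ.regAt (hg i _ h2))) ?_
    filter_upwards [hφ.eventually (hU.eventually_mem h1), hψ.eventually (hV.eventually_mem h2)]
      with y h3 h4
    exact (hN _ h3 _ h4).symm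
  have hc : @Continuous Z (X × Y) 𝒵.top (prod 𝒳 𝒴).top (fun z => (φ z, ψ z)) := by
    let _ := 𝒵.top
    refine continuous_generateFrom_iff.2 ?_
    rintro _ ⟨U, V, N, hU, hV, hN, rfl⟩
    refine (open_iff (𝒳 := 𝒵)).2 ?_
    rintro z ⟨h1, h2, h3⟩
    filter_upwards [hφ.eventually (hU.eventually_mem h1), hψ.eventually (hV.eventually_mem h2),
      h𝒵.ne_zero (hT U V N z hU hV hN h1 h2) h3] with y h4 h5 h6
    exact ⟨h4, h5, h6⟩
  refine ⟨hc, ?_⟩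
  rintro f z ⟨U, V, N, D, hU, hV, hpU, hpV, hN, hD, hp, h⟩
  refine 𝒵.congr' (h𝒵.div (hT U V N z hU hV hN hpU hpV) (hT U V D z hU hV hD hpU hpV) hp) ?_
  let _ := 𝒵.top
  let _ := (prod 𝒳 𝒴).top
  filter_upwards [hc.continuousAt.eventually h] with y hy
  exact hy.symm

theorem isMorphism_prodMap {X' : Type*} {Y' : Type*} {𝒳' : FunSpace X'} {𝒴' : FunSpace Y'}
    (h𝒳 : 𝒳.IsRinged) (h𝒴 : 𝒴.IsRinged) {φ : X → X'} {ψ : Y → Y'}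
    (hφ : IsMorphism 𝒳 𝒳' φ) (hψ : IsMorphism 𝒴 𝒴' ψ) :
    IsMorphism (prod 𝒳 𝒴) (prod 𝒳' 𝒴') (fun p => (φ p.1, ψ p.2)) :=
  isMorphism_prodMk (prod_isRinged h𝒳 h𝒴) (hφ.comp (isMorphism_fst h𝒳 h𝒴))
    (hψ.comp (isMorphism_snd h𝒳 h𝒴))

end Prod

/-- The locus where two morphisms to a variety differ is open. -/
theorem IsVariety.open_ne {X : Type*} {Z : Type*} {𝒳 : FunSpace X} {𝒵 : FunSpace Z}
    (h : 𝒳.IsVariety) (h𝒵 : 𝒵.IsRinged) {φ ψ : Z → X} (hφ : IsMorphism 𝒵 𝒳 φ)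
    (hψ : IsMorphism 𝒵 𝒳 ψ) : 𝒵.Open {z | φ z ≠ ψ z} :=
  (isMorphism_prodMk h𝒵 hφ hψ).open_preimage h.separated

end FunSpace

/-! ### Bounded regular functions are locally constant -/

namespace FunSpace

section Bounded

open MvPolynomial Cardinal

variable {n : ℕ}

theorem polynomial_div_pow_mem_span {W : Type} (z : W → Fin n → ℂ) (h : MvPolynomial (Fin n) ℂ)
    (p : MvPolynomial (Fin n) ℂ) (N : ℕ) :
    (fun y => eval (z y) p / eval (z y) h ^ N) ∈ Submodule.span ℂ
      (Set.range fun (i : (Fin n →₀ ℕ) × ℕ) (y : W) =>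
        eval (z y) (monomial i.1 (1 : ℂ)) / eval (z y) h ^ i.2) := by
  induction p using MvPolynomial.induction_on' with
  | monomial m a =>
    have : (fun y => eval (z y) (monomial m a) / eval (z y) h ^ N)
        = a • fun y => eval (z y) (monomial m (1 : ℂ)) / eval (z y) h ^ N := by
      funext y
      simp [eval_monomial, mul_div_assoc]
    rw [this]
    exact Submodule.smul_mem _ _ (Submodule.subset_span ⟨(m, N), rfl⟩)
  | add p q hp hq =>
    have : (fun y => eval (z y) (p + q) / eval (z y) h ^ N)
        = (fun y => eval (z y) p / eval (z y) h ^ N) +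
          fun y => eval (z y) q / eval (z y) h ^ N := by
      funext y
      simp [add_div]
    rw [this]
    exact Submodule.add_mem _ hp hq

/-- A function whose translates by uncountably many constants `t` have their inverses in a space of
functions of countable dimension takes finitely many values: a linear relation between the functions
`1 / (f - t)` is an algebraic equation for `f`. -/
theorem finite_range_of_inv_sub_mem_span {W : Type} {ι : Type} [Countable ι] (B : ι → W → ℂ)
    (f : W → ℂ) (C : ℝ) (hf : ∀ t : ℝ, C < t → ∀ y, f y ≠ t)
    (hB : ∀ t : ℝ, C < t → (fun y => (f y - t)⁻¹) ∈ Submodule.span ℂ (Set.range B)) :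
    (Set.range f).Finite := by
  classical
  -- uncountably many functions cannot be independent in a space of countable dimension
  let F : Set.Ioi C → Submodule.span ℂ (Set.range B) := fun t => ⟨_, hB t t.2⟩
  have hdep : ¬ LinearIndependent ℂ F := by
    intro hli
    have h1 := hli.cardinal_le_rank.trans (rank_span_le (Set.range B))
    rw [mk_Ioi_real] at h1
    exact absurd (h1.trans (mk_le_aleph0_iff.2 (Set.countable_range B).to_subtype))
      (not_le.2 aleph0_lt_continuum)
  obtain ⟨s, g, hsum, t₀, ht₀, hg⟩ := not_linearIndependent_iff.1 hdep
  have hrel : ∀ y, ∑ t ∈ s, g t * (f y - (t : ℝ))⁻¹ = 0 := by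
    intro y
    have h1 := congrFun (congrArg Subtype.val hsum) y
    simp only [AddSubmonoidClass.coe_finsetSum, Finset.sum_apply] at h1
    exact h1
  -- the relation with the denominators cleared; its value at `t₀` shows that it is not trivial
  let p : Polynomial ℂ := ∑ t ∈ s, Polynomial.C (g t) *
    ∏ r ∈ s.erase t, (Polynomial.X - Polynomial.C ((r : ℝ) : ℂ))
  have hp0 : p ≠ 0 := by
    intro h0
    have h1 : p.eval ((t₀ : ℝ) : ℂ) = 0 := by rw [h0, Polynomial.eval_zero]
    simp only [p, Polynomial.eval_finsetSum, Polynomial.eval_mul, Polynomial.eval_C,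
      Polynomial.eval_prod, Polynomial.eval_sub, Polynomial.eval_X] at h1
    rw [Finset.sum_eq_single_of_mem t₀ ht₀ fun t ht htne => by
      rw [Finset.prod_eq_zero (Finset.mem_erase.2 ⟨htne.symm, ht₀⟩) (sub_self _), mul_zero]] at h1
    rcases mul_eq_zero.1 h1 with h2 | h2
    · exact hg h2
    · obtain ⟨r, hr, hr0⟩ := Finset.prod_eq_zero_iff.1 h2
      refine (Finset.mem_erase.1 hr).1 (Subtype.ext ?_)
      exact_mod_cast (sub_eq_zero.1 hr0).symm
  refine (p.roots.toFinset.finite_toSet).subset ?_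
  rintro _ ⟨y, rfl⟩
  rw [Finset.mem_coe, Multiset.mem_toFinset, Polynomial.mem_roots hp0, Polynomial.IsRoot]
  simp only [p, Polynomial.eval_finsetSum, Polynomial.eval_mul, Polynomial.eval_C,
    Polynomial.eval_prod, Polynomial.eval_sub, Polynomial.eval_X]
  have h2 : ∀ t ∈ s, g t * ∏ r ∈ s.erase t, (f y - ((r : ℝ) : ℂ))
      = (∏ r ∈ s, (f y - ((r : ℝ) : ℂ))) * (g t * (f y - ((t : ℝ) : ℂ))⁻¹) := by
    intro t ht
    rw [← Finset.mul_prod_erase s _ ht]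
    have := sub_ne_zero.2 (hf t t.2 y)
    field_simp
  rw [Finset.sum_congr rfl h2, ← Finset.mul_sum, hrel, mul_zero]

/-- A bounded regular function on a principal open subset of an affine variety takes finitely many
values. For large constants `t` the function `f - t` has no zeros, hence is invertible by the
Nullstellensatz, and the coordinate ring has countable dimension. -/
theorem finite_values_of_bounded (J : Set (MvPolynomial (Fin n) ℂ)) (h P Q : MvPolynomial (Fin n) ℂ)
    (C : ℝ) (H : ∀ z, (∀ p ∈ J, eval z p = 0) → eval z h ≠ 0 →
      eval z Q ≠ 0 ∧ ‖eval z P / eval z Q‖ ≤ C) :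
    {c | ∃ z, (∀ p ∈ J, eval z p = 0) ∧ eval z h ≠ 0 ∧ c = eval z P / eval z Q}.Finite := by
  let W : Type := {z : Fin n → ℂ // (∀ p ∈ J, eval z p = 0) ∧ eval z h ≠ 0}
  let f : W → ℂ := fun y => eval y.1 P / eval y.1 Q
  have hf : ∀ t : ℝ, C < t → ∀ y, f y ≠ t := by
    intro t ht y hy
    have h1 := (H y.1 y.2.1 y.2.2).2
    change ‖f y‖ ≤ C at h1
    rw [hy, Complex.norm_real, Real.norm_eq_abs] at h1
    linarith [le_abs_self t]
  have hfin := finite_range_of_inv_sub_mem_span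
    (fun (i : (Fin n →₀ ℕ) × ℕ) (y : W) => eval y.1 (monomial i.1 (1 : ℂ)) / eval y.1 h ^ i.2)
    f C hf (by
      intro t ht
      -- `P - t Q` has no zeros where `J` vanishes and `h` does not
      set I : Ideal (MvPolynomial (Fin n) ℂ) :=
        Ideal.span J ⊔ Ideal.span {P - MvPolynomial.C (t : ℂ) * Q} with hI
      have hrad : h ∈ I.radical := by
        rw [← vanishingIdeal_zeroLocus_eq_radical (K := ℂ), mem_vanishingIdeal_iff]
        intro z hz
        simp only [mem_zeroLocus_iff, aeval_eq_eval] at hz ⊢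
        by_contra h0
        have hzJ : ∀ p ∈ J, eval z p = 0 := fun p hp =>
          hz p (Ideal.mem_sup_left (Ideal.subset_span hp))
        have hz1 : eval z (P - MvPolynomial.C (t : ℂ) * Q) = 0 :=
          hz _ (Ideal.mem_sup_right (Ideal.subset_span rfl))
        have hQ := (H z hzJ h0).1
        refine hf t ht ⟨z, hzJ, h0⟩ ?_
        simp only [f]
        rw [div_eq_iff hQ]
        rw [map_sub, map_mul, eval_C] at hz1
        exact sub_eq_zero.1 hz1
      obtain ⟨N, hN⟩ := hrad
      obtain ⟨j, hj, k, hk, hjk⟩ := Submodule.mem_sup.1 hN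
      obtain ⟨a, rfl⟩ := Ideal.mem_span_singleton'.1 hk
      have hj0 : ∀ y : W, eval y.1 j = 0 := by
        intro y
        have : Ideal.span J ≤ RingHom.ker (eval y.1) := Ideal.span_le.2 y.2.1
        exact this hj
      convert polynomial_div_pow_mem_span (fun y : W => y.1) h (a * Q) N using 1
      funext y
      have h1 := congrArg (eval y.1) hjk
      rw [map_add, hj0, zero_add, map_mul, map_sub, map_mul, eval_C, map_pow] at h1
      have hQ := (H y.1 y.2.1 y.2.2).1
      have h2 : f y - t ≠ 0 := sub_ne_zero.2 (hf t ht y)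
      have h3 : f y - t = (eval y.1 P - t * eval y.1 Q) / eval y.1 Q := by
        simp only [f]; field_simp
      have h4 : eval y.1 P - t * eval y.1 Q ≠ 0 := fun h0 => h2 (by rw [h3, h0, zero_div])
      rw [h3, inv_div, ← h1, map_mul, mul_comm (eval y.1 a), mul_comm (eval y.1 a),
        mul_div_mul_right _ _ (fun ha => by
          rw [ha, zero_mul] at h1
          exact pow_ne_zero N y.2.2 h1.symm)])
  refine hfin.subset ?_
  rintro c ⟨z, h1, h2, rfl⟩
  exact ⟨⟨z, h1, h2⟩, rfl⟩

/-- The sets where a polynomial does not vanish form a basis of the topology of affine space. -/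
theorem affineSpace_exists_polynomial {U : Set (Fin n → ℂ)} (hU : (affineSpace n).Open U)
    {x : Fin n → ℂ} (hx : x ∈ U) :
    ∃ h : MvPolynomial (Fin n) ℂ, eval x h ≠ 0 ∧ ∀ z, eval z h ≠ 0 → z ∈ U := by
  have hU' : TopologicalSpace.GenerateOpen
    {U | ∃ q : MvPolynomial (Fin n) ℂ, U = {z | MvPolynomial.eval z q ≠ 0}} U := hU
  clear hU
  induction hU' with
  | basic s hs =>
    obtain ⟨q, rfl⟩ := hs
    exact ⟨q, hx, fun z hz => hz⟩
  | univ => exact ⟨1, by simp, fun _ _ => trivial⟩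
  | inter s t _ _ ihs iht =>
    obtain ⟨h, hh, hs⟩ := ihs hx.1
    obtain ⟨k, hk, ht⟩ := iht hx.2
    refine ⟨h * k, by simp [hh, hk], fun z hz => ?_⟩
    rw [map_mul, mul_ne_zero_iff] at hz
    exact ⟨hs z hz.1, ht z hz.2⟩
  | sUnion S _ ih =>
    obtain ⟨s, hs, hxs⟩ := hx
    obtain ⟨h, hh, h'⟩ := ih s hs hxs
    exact ⟨h, hh, fun z hz => ⟨s, hs, h' z hz⟩⟩

end Bounded

/-- A regular function on a closed subset of a variety that is bounded near a point is constant near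
this point (in the Zariski topology). -/
theorem IsVariety.eventually_eq_of_bounded {X : Type u} {𝒳 : FunSpace X} (h𝒳 : 𝒳.IsVariety)
    {F : Set X} (hF : 𝒳.Open Fᶜ) {f : F → ℂ} {x : F} (hf : (𝒳.sub F).RegAt f x)
    (hb : ∃ C : ℝ, ∀ᶠ y in (𝒳.sub F).nbhd x, ‖f y‖ ≤ C) :
    ∀ᶠ y in (𝒳.sub F).nbhd x, f y = f x := by
  obtain ⟨C, hC⟩ := hb
  obtain ⟨g, hg, hfg⟩ := hf
  obtain ⟨U, hU, hxU, n, P₀, e, he, he'⟩ := h𝒳.locallyAffine x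
  let Y : Set (Fin n → ℂ) := {z | ∀ p ∈ P₀, MvPolynomial.eval z p = 0}
  -- near `x`, both the comparison of `f` with `g` and the bound extend to conditions on `X`
  have hnear : ∀ᶠ y in 𝒳.nbhd (x : X), ∀ hy : y ∈ F, f ⟨y, hy⟩ = g y ∧ ‖g y‖ ≤ C := by
    let _ := 𝒳.top
    have h1 : ∀ᶠ y in (𝒳.sub F).nbhd x, f y = g y ∧ ‖g y‖ ≤ C := by
      filter_upwards [hfg, hC] with y h1 h2
      exact ⟨h1, h1 ▸ h2⟩
    have h2 : (𝒳.sub F).nbhd x = Filter.comap Subtype.val (nhds (x : X)) := nhds_induced _ _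
    rw [h2, Filter.eventually_comap] at h1
    filter_upwards [h1] with y hy hyF
    exact hy ⟨y, hyF⟩ rfl
  set x' : U := ⟨x, hxU⟩ with hx'
  have hgY : ((affineSpace n).sub Y).RegAt (fun z => g (e.symm z)) (e x') :=
    he'.regAt (f := fun u : U => g u) (x := e x')
      (by rw [e.symm_apply_apply]; exact (isMorphism_val U).regAt hg)
  obtain ⟨G, ⟨P, Q, hQ, hG⟩, hgG⟩ := hgY
  have hnearY : ∀ᶠ z : Y in ((affineSpace n).sub Y).nbhd (e x'), ∀ hy : (e.symm z : X) ∈ F,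
      f ⟨e.symm z, hy⟩ = g (e.symm z) ∧ ‖g (e.symm z)‖ ≤ C :=
    he'.eventually (p := fun u : U => ∀ hy : (u : X) ∈ F, f ⟨u, hy⟩ = g u ∧ ‖g u‖ ≤ C)
      (by
        rw [e.symm_apply_apply]
        exact (isMorphism_val (𝒳 := 𝒳) U).eventually (x := x')
          (p := fun y => ∀ hy : y ∈ F, f ⟨y, hy⟩ = g y ∧ ‖g y‖ ≤ C) hnear)
  have hall : ∀ᶠ z : Y in ((affineSpace n).sub Y).nbhd (e x'),
      MvPolynomial.eval (z : Fin n → ℂ) Q ≠ 0 ∧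
      g (e.symm z) = MvPolynomial.eval (z : Fin n → ℂ) P / MvPolynomial.eval (z : Fin n → ℂ) Q ∧
      ∀ hy : (e.symm z : X) ∈ F, f ⟨e.symm z, hy⟩ = g (e.symm z) ∧ ‖g (e.symm z)‖ ≤ C := by
    filter_upwards [hnearY, hgG, (isMorphism_val (𝒳 := affineSpace n) Y).eventually hG,
      (isMorphism_val (𝒳 := affineSpace n) Y).eventually ((affineSpace_open Q).eventually_mem hQ)]
      with z h1 h2 h3 h4
    exact ⟨h4, h2.trans h3, h1⟩
  obtain ⟨h, hh, hO⟩ : ∃ h : MvPolynomial (Fin n) ℂ, MvPolynomial.eval (e x' : Fin n → ℂ) h ≠ 0 ∧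
      ∀ z : Y, MvPolynomial.eval (z : Fin n → ℂ) h ≠ 0 → MvPolynomial.eval (z : Fin n → ℂ) Q ≠ 0 ∧
      g (e.symm z) = MvPolynomial.eval (z : Fin n → ℂ) P / MvPolynomial.eval (z : Fin n → ℂ) Q ∧
      ∀ hy : (e.symm z : X) ∈ F, f ⟨e.symm z, hy⟩ = g (e.symm z) ∧ ‖g (e.symm z)‖ ≤ C := by
    let _ := (affineSpace n).top
    have h2 : ((affineSpace n).sub Y).nbhd (e x')
      = Filter.comap Subtype.val (nhds (e x' : Fin n → ℂ)) := nhds_induced _ _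
    rw [h2, Filter.eventually_comap] at hall
    obtain ⟨O, hO, hxO, hO'⟩ := (affineSpace n).eventually_iff.1 hall
    obtain ⟨h, hh, hhO⟩ := affineSpace_exists_polynomial hO hxO
    exact ⟨h, hh, fun z hz => hO' z (hhO z hz) z rfl⟩
  -- the part of `F` in the affine piece, as a zero locus
  set J : Set (MvPolynomial (Fin n) ℂ) :=
    {p | ∀ z : Y, (e.symm z : X) ∈ F → MvPolynomial.eval (z : Fin n → ℂ) p = 0} with hJ
  have hJY : ∀ z, (∀ p ∈ J, MvPolynomial.eval z p = 0) →
      ∃ hz : z ∈ Y, (e.symm ⟨z, hz⟩ : X) ∈ F := by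
    intro z hz
    have hzY : z ∈ Y := fun p hp => hz p fun y _ => y.2 p hp
    refine ⟨hzY, ?_⟩
    by_contra hzF
    have hop : ((affineSpace n).sub Y).Open ((fun z : Y => (e.symm z : X)) ⁻¹' Fᶜ) :=
      ((isMorphism_val U).comp he').open_preimage hF
    have hev := hop.eventually_mem (x := ⟨z, hzY⟩) hzF
    let _ := (affineSpace n).top
    have h2 : ((affineSpace n).sub Y).nbhd ⟨z, hzY⟩
      = Filter.comap Subtype.val (nhds z) := nhds_induced _ _
    rw [h2, Filter.eventually_comap] at hev
    obtain ⟨O, hO, hxO, hO'⟩ := (affineSpace n).eventually_iff.1 hev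
    obtain ⟨k, hk, hkO⟩ := affineSpace_exists_polynomial hO hxO
    refine hk (hz k fun y hy => ?_)
    by_contra hky
    exact hO' y (hkO y hky) y rfl hy
  have hfin := finite_values_of_bounded J h P Q C (by
    intro z hzJ hzh
    obtain ⟨hzY, hzF⟩ := hJY z hzJ
    obtain ⟨h1, h2, h3⟩ := hO ⟨z, hzY⟩ hzh
    refine ⟨h1, ?_⟩
    have h4 := (h3 hzF).2
    rw [h2] at h4
    exact h4)
  set V := {c | ∃ z, (∀ p ∈ J, MvPolynomial.eval z p = 0) ∧ MvPolynomial.eval z h ≠ 0 ∧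
    c = MvPolynomial.eval z P / MvPolynomial.eval z Q} with hV
  have hmem : ∀ᶠ y in (𝒳.sub F).nbhd x, f y ∈ V := by
    have h1 : ∀ᶠ y in 𝒳.nbhd (x : X), ∃ hy : y ∈ U,
        MvPolynomial.eval (e ⟨y, hy⟩ : Fin n → ℂ) h ≠ 0 := by
      refine (hU.eventually_sub_iff (x := x')).1 ?_
      have := he.eventually (x := x') ((isMorphism_val (𝒳 := affineSpace n) Y).eventually
        ((affineSpace_open h).eventually_mem hh))
      filter_upwards [this] with y hy
      exact ⟨y.2, hy⟩
    filter_upwards [(isMorphism_val (𝒳 := 𝒳) F).eventually h1] with y hy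
    obtain ⟨hyU, hyh⟩ := hy
    obtain ⟨h1, h2, h3⟩ := hO (e ⟨y, hyU⟩) hyh
    simp only [e.symm_apply_apply] at h2 h3
    refine ⟨_, fun p hp => hp (e ⟨y, hyU⟩) ?_, hyh, ?_⟩
    · rw [e.symm_apply_apply]; exact y.2
    · rw [← h2]; exact (h3 y.2).1
  have hr : (𝒳.sub F).IsRinged := h𝒳.isRinged.sub_isRinged F
  -- `f` has values in a finite set, and avoids each of its elements other than `f x` near `x`
  have havoid : ∀ᶠ y in (𝒳.sub F).nbhd x, ∀ c ∈ V \ {f x}, f y ≠ c := by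
    refine (Filter.eventually_all_finite (hfin.subset Set.sdiff_subset)).2 fun c hc => ?_
    exact hr.eventually_ne ⟨g, hg, hfg⟩ fun h0 => hc.2 h0.symm
  filter_upwards [hmem, havoid] with y h1 h2
  by_contra hne
  exact h2 (f y) ⟨h1, hne⟩ rfl

/-! ### Varieties are Noetherian spaces -/

/-- The vanishing ideal of the complement is a strictly monotone function of an open set. -/
theorem affineSpace_noetherianSpace (n : ℕ) :
    @TopologicalSpace.NoetherianSpace _ (affineSpace n).top := by
  let _ := (affineSpace n).top
  let I : TopologicalSpace.Opens (Fin n → ℂ) → Ideal (MvPolynomial (Fin n) ℂ) := fun U =>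
    MvPolynomial.vanishingIdeal ℂ (U : Set (Fin n → ℂ))ᶜ
  have hI : StrictMono I := by
    intro U U' hlt
    refine lt_of_le_not_ge
      (MvPolynomial.vanishingIdeal_anti_mono (Set.compl_subset_compl.2 hlt.le)) fun hle => ?_
    obtain ⟨x, hx', hx⟩ := Set.exists_of_ssubset (show (U : Set (Fin n → ℂ)) ⊂ U' from hlt)
    obtain ⟨h, hh, hU⟩ := affineSpace_exists_polynomial U'.2 hx'
    have h1 : h ∈ I U' := by
      intro z hz
      by_contra h0
      rw [MvPolynomial.aeval_eq_eval] at h0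
      exact hz (hU z h0)
    have h2 := hle h1 x hx
    rw [MvPolynomial.aeval_eq_eval] at h2
    exact hh h2
  exact hI.wellFoundedGT

theorem IsVariety.noetherianSpace {X : Type u} {𝒳 : FunSpace X} (h𝒳 : 𝒳.IsVariety) :
    @TopologicalSpace.NoetherianSpace _ 𝒳.top := by
  let _ := 𝒳.top
  choose U hU hxU hA using h𝒳.locallyAffine
  have : CompactSpace X := h𝒳.quasiCompact
  obtain ⟨t, ht⟩ := isCompact_univ.elim_finite_subcover U (fun x => hU x)
    fun x _ => Set.mem_iUnion.2 ⟨x, hxU x⟩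
  have hN : ∀ x, TopologicalSpace.NoetherianSpace (U x) := by
    intro x
    obtain ⟨n, P, e, he, he'⟩ := hA x
    let _ := (affineSpace n).top
    have := @TopologicalSpace.NoetherianSpace.set _ (affineSpace n).top
      (affineSpace_noetherianSpace n) {z | ∀ p ∈ P, MvPolynomial.eval z p = 0}
    exact @TopologicalSpace.noetherianSpace_of_surjective _ _ ((affineSpace n).sub _).top
      (𝒳.sub (U x)).top this e.symm he'.1 e.symm.surjective
  have h2 := TopologicalSpace.NoetherianSpace.iUnion fun x : t => U x
  rw [← TopologicalSpace.noetherian_univ_iff]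
  have h3 : (⋃ x : t, U x) = Set.univ := by
    rw [Set.iUnion_subtype]
    exact Set.univ_subset_iff.1 ht
  rwa [h3] at h2

/-- For any family of locally constant functions on a subset of a variety, finitely many points
suffice to realize all the joint values, because the subset has finitely many irreducible
components. -/
theorem IsVariety.exists_finset_joint_values {X : Type u} {𝒳 : FunSpace X} (h𝒳 : 𝒳.IsVariety)
    (F : Set X) {ι : Type*} (f : ι → F → ℂ)
    (hf : ∀ i x, ∀ᶠ y in (𝒳.sub F).nbhd x, f i y = f i x) :
    ∃ s : Finset F, ∀ x, ∃ y ∈ s, ∀ i, f i y = f i x := by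
  let _ := 𝒳.top
  have := h𝒳.noetherianSpace
  have hN : TopologicalSpace.NoetherianSpace F := inferInstance
  have hfin := TopologicalSpace.NoetherianSpace.finite_irreducibleComponents (α := F)
  have hne : ∀ s ∈ irreducibleComponents F, s.Nonempty := fun s hs => hs.1.1
  rcases isEmpty_or_nonempty F with hF | hF
  · exact ⟨∅, fun x => hF.elim x⟩
  choose! p hp using hne
  refine ⟨(hfin.image p).toFinset, fun x => ⟨p (irreducibleComponent x), ?_, fun i => ?_⟩⟩
  · rw [Set.Finite.mem_toFinset]
    exact ⟨_, irreducibleComponent_mem_irreducibleComponents x, rfl⟩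
  · have hlc : IsLocallyConstant (f i) := (IsLocallyConstant.iff_eventually_eq _).2 (hf i)
    exact hlc.apply_eq_of_isPreconnected isIrreducible_irreducibleComponent.2.isPreconnected
      (hp _ (irreducibleComponent_mem_irreducibleComponents x)) mem_irreducibleComponent

end FunSpace

/-! ### Frames of vector bundles -/

namespace BundleData

/-- A frame over an open set `U`: a family of sections that is a basis of each fibre over `U`, such
that the regular sections are the combinations with regular coefficients. -/
structure IsFrame {X : Type u} (𝒳 : FunSpace X) (E : BundleData.{u, w} X) {ι : Type*} [Fintype ι]
    (U : Set X) (e : ι → ∀ x, E.fib x) : Prop where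
  isOpen : 𝒳.Open U
  linearIndependent : ∀ x ∈ U, LinearIndependent ℂ fun i => e i x
  span_eq_top : ∀ x ∈ U, Submodule.span ℂ (Set.range fun i => e i x) = ⊤
  regAt_iff : ∀ (s : ∀ x, E.fib x), ∀ x ∈ U, E.RegAt s x ↔
    ∃ c : ι → X → ℂ, (∀ i, 𝒳.RegAt (c i) x) ∧ ∀ᶠ y in 𝒳.nbhd x, s y = ∑ i, c i y • e i y

variable {X : Type u} {𝒳 : FunSpace X} {E : BundleData.{u, w} X}

theorem IsFrame.reindex {ι κ : Type*} [Fintype ι] [Fintype κ] {U : Set X} {e : ι → ∀ x, E.fib x}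
    (he : IsFrame 𝒳 E U e) (σ : κ ≃ ι) : IsFrame 𝒳 E U (fun k => e (σ k)) where
  isOpen := he.isOpen
  linearIndependent x hx := (he.linearIndependent x hx).comp σ σ.injective
  span_eq_top x hx := by
    rw [← he.span_eq_top x hx]
    congr 1
    exact σ.surjective.range_comp fun i => e i x
  regAt_iff s x hx := by
    rw [he.regAt_iff s x hx]
    constructor
    · rintro ⟨c, hc, h⟩
      refine ⟨fun k => c (σ k), fun k => hc _, ?_⟩
      filter_upwards [h] with y hy
      rw [hy, ← Equiv.sum_comp σ]
    · rintro ⟨c, hc, h⟩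
      refine ⟨fun i => c (σ.symm i), fun i => hc _, ?_⟩
      filter_upwards [h] with y hy
      rw [hy, ← Equiv.sum_comp σ]
      simp

theorem isVectorBundle_iff : E.IsVectorBundle 𝒳 ↔
    ∀ x, ∃ (U : Set X) (n : ℕ) (e : Fin n → ∀ x, E.fib x), x ∈ U ∧ IsFrame 𝒳 E U e := by
  constructor
  · intro h x
    obtain ⟨U, n, e, hU, hx, hb, hr⟩ := h x
    exact ⟨U, n, e, hx, hU, fun x hx => (hb x hx).1, fun x hx => (hb x hx).2, hr⟩
  · intro h x
    obtain ⟨U, n, e, hx, he⟩ := h x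
    exact ⟨U, n, e, he.isOpen, hx,
      fun x hx => ⟨he.linearIndependent x hx, he.span_eq_top x hx⟩, he.regAt_iff⟩

theorem isVectorBundle_of_frames (h : ∀ x, ∃ (U : Set X) (ι : Type) (_ : Fintype ι)
    (e : ι → ∀ x, E.fib x), x ∈ U ∧ IsFrame 𝒳 E U e) : E.IsVectorBundle 𝒳 := by
  rw [isVectorBundle_iff]
  intro x
  obtain ⟨U, ι, _, e, hx, he⟩ := h x
  exact ⟨U, Fintype.card ι, _, hx, he.reindex (Fintype.equivFin ι).symm⟩

/-! ### Regular sections -/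

section Sections

variable (h𝒳 : 𝒳.IsRinged) (hE : E.IsVectorBundle 𝒳)

include hE in
theorem IsVectorBundle.congr {s t : ∀ x, E.fib x} {x : X} (hs : E.RegAt s x)
    (h : ∀ᶠ y in 𝒳.nbhd x, s y = t y) : E.RegAt t x := by
  obtain ⟨U, n, e, hx, he⟩ := isVectorBundle_iff.1 hE x
  rw [he.regAt_iff _ _ hx] at hs ⊢
  obtain ⟨c, hc, hs⟩ := hs
  refine ⟨c, hc, ?_⟩
  filter_upwards [hs, h] with y h1 h2
  rw [← h2, h1]

include h𝒳 hE

theorem IsVectorBundle.zero (x : X) : E.RegAt (fun _ => 0) x := by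
  obtain ⟨U, n, e, hx, he⟩ := isVectorBundle_iff.1 hE x
  rw [he.regAt_iff _ _ hx]
  exact ⟨fun _ _ => 0, fun _ => h𝒳.const 0 x, Filter.Eventually.of_forall fun y => by simp⟩

theorem IsVectorBundle.add {s t : ∀ x, E.fib x} {x : X} (hs : E.RegAt s x) (ht : E.RegAt t x) :
    E.RegAt (fun y => s y + t y) x := by
  obtain ⟨U, n, e, hx, he⟩ := isVectorBundle_iff.1 hE x
  rw [he.regAt_iff _ _ hx] at hs ht ⊢
  obtain ⟨c, hc, hs⟩ := hs
  obtain ⟨d, hd, ht⟩ := ht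
  refine ⟨fun i y => c i y + d i y, fun i => h𝒳.add (hc i) (hd i), ?_⟩
  filter_upwards [hs, ht] with y h1 h2
  rw [h1, h2, ← Finset.sum_add_distrib]
  exact Finset.sum_congr rfl fun i _ => (add_smul _ _ _).symm

theorem IsVectorBundle.smul {f : X → ℂ} {s : ∀ x, E.fib x} {x : X} (hf : 𝒳.RegAt f x)
    (hs : E.RegAt s x) : E.RegAt (fun y => f y • s y) x := by
  obtain ⟨U, n, e, hx, he⟩ := isVectorBundle_iff.1 hE x
  rw [he.regAt_iff _ _ hx] at hs ⊢
  obtain ⟨c, hc, hs⟩ := hs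
  refine ⟨fun i y => f y * c i y, fun i => h𝒳.mul hf (hc i), ?_⟩
  filter_upwards [hs] with y h1
  rw [h1, Finset.smul_sum]
  exact Finset.sum_congr rfl fun i _ => smul_smul _ _ _

theorem IsVectorBundle.sum {ι : Type*} (t : Finset ι) {s : ι → ∀ x, E.fib x} {x : X}
    (hs : ∀ i ∈ t, E.RegAt (s i) x) : E.RegAt (fun y => ∑ i ∈ t, s i y) x := by
  classical
  induction t using Finset.induction_on with
  | empty => simpa using hE.zero h𝒳 x
  | insert j t hj ih =>
    simp only [Finset.sum_insert hj]
    exact hE.add h𝒳 (hs _ (Finset.mem_insert_self _ _))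
      (ih fun i hi => hs i (Finset.mem_insert_of_mem hi))

theorem IsVectorBundle.sub {s t : ∀ x, E.fib x} {x : X} (hs : E.RegAt s x) (ht : E.RegAt t x) :
    E.RegAt (fun y => s y - t y) x := by
  have := hE.add h𝒳 hs (hE.smul h𝒳 (h𝒳.const (-1) x) ht)
  simpa [sub_eq_add_neg] using this

omit hE in
theorem IsFrame.regAt {ι : Type*} [Fintype ι] {U : Set X} {e : ι → ∀ x, E.fib x}
    (he : IsFrame 𝒳 E U e) (i : ι) {x : X} (hx : x ∈ U) : E.RegAt (e i) x := by
  classical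
  rw [he.regAt_iff _ _ hx]
  refine ⟨fun j _ => if j = i then 1 else 0, fun j => h𝒳.const _ x,
    Filter.Eventually.of_forall fun y => by simp⟩

omit hE in
/-- Regular sections that form a basis of one fibre are a frame near the corresponding point. -/
theorem IsFrame.exists_frame_of_basis {ι κ : Type*} [Fintype ι] [Fintype κ] {U : Set X}
    {e : ι → ∀ x, E.fib x} (he : IsFrame 𝒳 E U e) {x₀ : X} (hx₀ : x₀ ∈ U) (f : κ → ∀ x, E.fib x)
    (hf : ∀ k, E.RegAt (f k) x₀) (hli : LinearIndependent ℂ fun k => f k x₀)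
    (hsp : Submodule.span ℂ (Set.range fun k => f k x₀) = ⊤) :
    ∃ U', x₀ ∈ U' ∧ IsFrame 𝒳 E U' f := by
  classical
  let b := Module.Basis.mk (he.linearIndependent x₀ hx₀) (he.span_eq_top x₀ hx₀).ge
  let b' := Module.Basis.mk hli hsp.ge
  let σ : ι ≃ κ := b.indexEquiv b'
  suffices h : ∃ U', x₀ ∈ U' ∧ IsFrame 𝒳 E U' (fun i => f (σ i)) by
    obtain ⟨U', hx, h⟩ := h
    refine ⟨U', hx, ?_⟩
    have := h.reindex σ.symm
    simpa using this
  have hM : ∀ j, ∃ c : ι → X → ℂ, (∀ i, 𝒳.RegAt (c i) x₀) ∧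
      ∀ᶠ y in 𝒳.nbhd x₀, f (σ j) y = ∑ i, c i y • e i y :=
    fun j => (he.regAt_iff _ _ hx₀).1 (hf (σ j))
  choose c hc hce using hM
  -- the matrix of the new sections in the given frame is invertible at `x₀`, hence near `x₀`
  let M : X → Matrix ι ι ℂ := fun y => Matrix.of fun i j => c j i y
  have hMr : ∀ i j, 𝒳.RegAt (fun y => M y i j) x₀ := fun i j => hc j i
  have hdet : (M x₀).det ≠ 0 := by
    have h1 : M x₀ = b.toMatrix (b'.reindex σ.symm) := by
      ext i j
      have h2 : f (σ j) x₀ = ∑ i, c j i x₀ • e i x₀ := FunSpace.eventually_self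
        (p := fun y => f (σ j) y = ∑ i, c j i y • e i y) (hce j)
      have h3 : (b'.reindex σ.symm) j = ∑ i, c j i x₀ • b i := by
        rw [Module.Basis.reindex_apply, Equiv.symm_symm]
        simp only [b, b', Module.Basis.mk_apply]
        exact h2
      rw [Module.Basis.toMatrix_apply, h3, b.repr_sum_self]
      rfl
    rw [h1]
    have h4 := b.toMatrix_mul_toMatrix_flip (b'.reindex σ.symm)
    intro h0
    have h5 := congrArg Matrix.det h4
    rw [Matrix.det_mul, h0, zero_mul, Matrix.det_one] at h5
    exact zero_ne_one h5
  have hev : ∀ᶠ y in 𝒳.nbhd x₀, y ∈ U ∧ (∀ j, f (σ j) y = ∑ i, M y i j • e i y) ∧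
      (∀ i j, 𝒳.RegAt (fun y => M y i j) y) ∧ (M y).det ≠ 0 := by
    have h1 : ∀ᶠ y in 𝒳.nbhd x₀, ∀ j, f (σ j) y = ∑ i, M y i j • e i y :=
      Filter.eventually_all.2 hce
    have h2 : ∀ᶠ y in 𝒳.nbhd x₀, ∀ i j, 𝒳.RegAt (fun y => M y i j) y :=
      Filter.eventually_all.2 fun i => Filter.eventually_all.2 fun j => 𝒳.nearby (hMr i j)
    filter_upwards [he.isOpen.eventually_mem hx₀, h1, h2, h𝒳.ne_zero (h𝒳.det hMr) hdet]
      with y h1 h2 h3 h4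
    exact ⟨h1, h2, h3, h4⟩
  obtain ⟨U', hU', hx', H⟩ := 𝒳.eventually_iff.1 hev
  have hinv : ∀ y ∈ U', ∀ i, e i y = ∑ j, (M y)⁻¹ j i • f (σ j) y := by
    intro y hy i
    obtain ⟨-, h2, -, h4⟩ := H y hy
    have h5 : M y * (M y)⁻¹ = 1 := Matrix.mul_nonsing_inv _ (Ne.isUnit h4)
    simp only [h2, Finset.smul_sum, smul_smul]
    rw [Finset.sum_comm]
    have h6 : ∀ k, ∑ j, ((M y)⁻¹ j i * M y k j) • e k y =
        (if k = i then (1 : ℂ) else 0) • e k y := by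
      intro k
      rw [← Finset.sum_smul]
      congr 1
      have := congrFun (congrFun h5 k) i
      rw [Matrix.mul_apply, Matrix.one_apply] at this
      rw [← this]
      exact Finset.sum_congr rfl fun j _ => mul_comm _ _
    simp [h6]
  have hspan : ∀ y ∈ U', Submodule.span ℂ (Set.range fun j => f (σ j) y) = ⊤ := by
    intro y hy
    rw [eq_top_iff, ← he.span_eq_top y (H y hy).1, Submodule.span_le]
    rintro _ ⟨i, rfl⟩
    change e i y ∈ _
    rw [hinv y hy i]
    exact Submodule.sum_mem _ fun j _ => Submodule.smul_mem _ _ (Submodule.subset_span ⟨j, rfl⟩)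
  refine ⟨U', hx', hU', fun y hy => ?_, hspan, fun s y hy => ?_⟩
  · have hb := Module.Basis.mk (he.linearIndependent y (H y hy).1)
      (he.span_eq_top y (H y hy).1).ge
    exact linearIndependent_of_top_le_span_of_card_eq_finrank (hspan y hy).ge
      (Module.finrank_eq_card_basis hb).symm
  · obtain ⟨h1, -, h3, h4⟩ := H y hy
    rw [he.regAt_iff s y h1]
    have hyU' : ∀ᶠ z in 𝒳.nbhd y, z ∈ U' := hU'.eventually_mem hy
    constructor
    · rintro ⟨d, hd, hs⟩
      refine ⟨fun j z => ∑ i, (M z)⁻¹ j i * d i z, fun j => h𝒳.sum _ fun i _ =>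
        h𝒳.mul (h𝒳.matrix_inv h3 h4 j i) (hd i), ?_⟩
      filter_upwards [hs, hyU'] with z hz hz'
      rw [hz]
      simp only [Finset.sum_smul]
      rw [Finset.sum_comm]
      refine Finset.sum_congr rfl fun i _ => ?_
      conv_lhs => rw [hinv z hz' i, Finset.smul_sum]
      refine Finset.sum_congr rfl fun j _ => ?_
      rw [smul_smul, mul_comm]
    · rintro ⟨d, hd, hs⟩
      refine ⟨fun i z => ∑ j, M z i j * d j z, fun i => h𝒳.sum _ fun j _ =>
        h𝒳.mul (h3 i j) (hd j), ?_⟩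
      filter_upwards [hs, hyU'] with z hz hz'
      rw [hz]
      simp only [Finset.sum_smul]
      rw [Finset.sum_comm]
      refine Finset.sum_congr rfl fun j _ => ?_
      rw [(H z hz').2.1 j, Finset.smul_sum]
      refine Finset.sum_congr rfl fun i _ => ?_
      rw [smul_smul, mul_comm]

end Sections

/-! ### Pull backs -/

section Pullback

variable {Y : Type v} {𝒴 : FunSpace Y} {φ : Y → X}

theorem pullback_regAt_of_fintype {ι : Type*} [Fintype ι] {s : ∀ y, E.fib (φ y)} {y : Y}
    (c : ι → Y → ℂ) (σ : ι → ∀ x, E.fib x) (hc : ∀ i, 𝒴.RegAt (c i) y)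
    (hσ : ∀ i, E.RegAt (σ i) (φ y)) (hs : ∀ᶠ z in 𝒴.nbhd y, s z = ∑ i, c i z • σ i (φ z)) :
    (E.pullback 𝒴 φ).RegAt s y := by
  refine ⟨Fintype.card ι, fun i => c ((Fintype.equivFin ι).symm i),
    fun i => σ ((Fintype.equivFin ι).symm i), fun i => hc _, fun i => hσ _, ?_⟩
  filter_upwards [hs] with z hz
  rw [hz]
  exact (Equiv.sum_comp (Fintype.equivFin ι).symm fun i => c i z • σ i (φ z)).symm

theorem pullback_regAt_comp (h𝒴 : 𝒴.IsRinged) {σ : ∀ x, E.fib x} {y : Y}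
    (hσ : E.RegAt σ (φ y)) : (E.pullback 𝒴 φ).RegAt (fun z => σ (φ z)) y :=
  pullback_regAt_of_fintype (ι := Unit) (fun _ _ => 1) (fun _ => σ) (fun _ => h𝒴.const 1 y)
    (fun _ => hσ) (Filter.Eventually.of_forall fun z => by simp)

theorem IsFrame.pullback (h𝒳 : 𝒳.IsRinged) (h𝒴 : 𝒴.IsRinged) (hφ : FunSpace.IsMorphism 𝒴 𝒳 φ)
    {ι : Type*} [Fintype ι] {U : Set X} {e : ι → ∀ x, E.fib x} (he : IsFrame 𝒳 E U e) :
    IsFrame 𝒴 (E.pullback 𝒴 φ) (φ ⁻¹' U) (fun i y => e i (φ y)) where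
  isOpen := hφ.open_preimage he.isOpen
  linearIndependent y hy := he.linearIndependent (φ y) hy
  span_eq_top y hy := he.span_eq_top (φ y) hy
  regAt_iff s y hy := by
    constructor
    · rintro ⟨n, c, σ, hc, hσ, hs⟩
      have hd : ∀ k, ∃ d : ι → X → ℂ, (∀ i, 𝒳.RegAt (d i) (φ y)) ∧
          ∀ᶠ z in 𝒳.nbhd (φ y), σ k z = ∑ i, d i z • e i z :=
        fun k => (he.regAt_iff _ _ hy).1 (hσ k)
      choose d hd hde using hd
      refine ⟨fun i z => ∑ k, c k z * d k i (φ z), fun i => h𝒴.sum _ fun k _ =>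
        h𝒴.mul (hc k) (hφ.regAt (hd k i)), ?_⟩
      filter_upwards [hs, hφ.eventually (Filter.eventually_all.2 hde)] with z h1 h2
      refine h1.trans ?_
      change (∑ k, c k z • σ k (φ z) : E.fib (φ z))
        = ∑ i, (∑ k, c k z * d k i (φ z)) • (e i (φ z) : E.fib (φ z))
      simp only [Finset.sum_smul]
      rw [Finset.sum_comm]
      refine Finset.sum_congr rfl fun k _ => ?_
      rw [h2 k, Finset.smul_sum]
      exact Finset.sum_congr rfl fun i _ => smul_smul _ _ _
    · rintro ⟨c, hc, hs⟩
      exact pullback_regAt_of_fintype c e hc (fun i => he.regAt h𝒳 i hy) hs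

theorem IsVectorBundle.pullback (h𝒳 : 𝒳.IsRinged) (h𝒴 : 𝒴.IsRinged)
    (hφ : FunSpace.IsMorphism 𝒴 𝒳 φ) (hE : E.IsVectorBundle 𝒳) :
    (E.pullback 𝒴 φ).IsVectorBundle 𝒴 := by
  rw [isVectorBundle_iff]
  intro y
  obtain ⟨U, n, e, hx, he⟩ := isVectorBundle_iff.1 hE (φ y)
  exact ⟨φ ⁻¹' U, n, _, hx, he.pullback h𝒳 h𝒴 hφ⟩

end Pullback

end BundleData

/-! ### Images of idempotent endomorphisms -/

namespace BundleData

/-- A family of subspaces, with the regular sections of the ambient bundle that lie in it. -/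
def sub {X : Type u} (E : BundleData.{u, w} X) (S : ∀ x, Submodule ℂ (E.fib x)) :
    BundleData.{u, w} X where
  fib x := S x
  RegAt s x := E.RegAt (fun y => (s y : E.fib y)) x

variable {X : Type u} {𝒳 : FunSpace X} {E : BundleData.{u, w} X}

/-- The image of an idempotent endomorphism of a vector bundle is a vector bundle. A basis of a
fibre that is adapted to the idempotent extends to a frame adapted to it. -/
theorem IsVectorBundle.sub_of_idempotent (h𝒳 : 𝒳.IsRinged) (hE : E.IsVectorBundle 𝒳)
    {S : ∀ x, Submodule ℂ (E.fib x)} {T : ∀ x, E.fib x →ₗ[ℂ] E.fib x} (hT : IsHom E E T)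
    (hmem : ∀ x a, T x a ∈ S x) (hid : ∀ x, ∀ a ∈ S x, T x a = a) :
    (E.sub S).IsVectorBundle 𝒳 := by
  classical
  have hTT : ∀ x a, T x (T x a) = T x a := fun x a => hid x _ (hmem x a)
  refine isVectorBundle_of_frames fun x₀ => ?_
  obtain ⟨U, n, e, hx₀, he⟩ := isVectorBundle_iff.1 hE x₀
  let b₀ := Module.Basis.mk (he.linearIndependent x₀ hx₀) (he.span_eq_top x₀ hx₀).ge
  have : FiniteDimensional ℂ (E.fib x₀) := b₀.finiteDimensional_of_finite
  have hext : ∀ a : E.fib x₀, ∃ s : ∀ x, E.fib x, E.RegAt s x₀ ∧ s x₀ = a := by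
    intro a
    refine ⟨fun x => ∑ i, b₀.repr a i • e i x, hE.sum h𝒳 _ fun i _ =>
      hE.smul h𝒳 (h𝒳.const _ x₀) (he.regAt h𝒳 i hx₀), ?_⟩
    conv_rhs => rw [← b₀.sum_repr a]
    exact Finset.sum_congr rfl fun i _ => by simp only [b₀, Module.Basis.mk_apply]
  have hcompl : IsCompl (S x₀) (LinearMap.ker (T x₀)) := by
    constructor
    · rw [Submodule.disjoint_def]
      intro a ha ha'
      rw [← hid x₀ a ha]
      exact ha'
    · rw [codisjoint_iff, eq_top_iff]
      intro a _
      have : a = T x₀ a + (a - T x₀ a) := by abel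
      rw [this]
      refine Submodule.add_mem_sup (hmem x₀ a) ?_
      rw [LinearMap.mem_ker, map_sub, hTT, sub_self]
  let b := (Module.finBasis ℂ (S x₀)).prod (Module.finBasis ℂ (LinearMap.ker (T x₀)))
  let b' := b.map (Submodule.prodEquivOfIsCompl _ _ hcompl)
  choose s₀ hs₀ hs₀' using hext
  let r := Module.finrank ℂ (S x₀)
  let k := Module.finrank ℂ (LinearMap.ker (T x₀))
  -- sections through an adapted basis at `x₀`, projected to the image and to the kernel of `T`
  let f : Fin r ⊕ Fin k → ∀ x, E.fib x := Sum.elim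
    (fun i x => T x (s₀ (Module.finBasis ℂ (S x₀) i) x))
    (fun i x => s₀ (Module.finBasis ℂ (LinearMap.ker (T x₀)) i) x -
      T x (s₀ (Module.finBasis ℂ (LinearMap.ker (T x₀)) i) x))
  have hfb : (fun i => f i x₀) = b' := by
    funext i
    rcases i with i | i
    · simp [f, b', b, hs₀', hid]
    · simp [f, b', b, hs₀']
  obtain ⟨U', hx', hf⟩ := he.exists_frame_of_basis h𝒳 hx₀ f (by
    rintro (i | i)
    · exact hT _ _ (hs₀ _)
    · exact hE.sub h𝒳 (hs₀ _) (hT _ _ (hs₀ _))) (by rw [hfb]; exact b'.linearIndependent)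
    (by rw [hfb]; exact b'.span_eq)
  have hTl : ∀ i x, T x (f (Sum.inl i) x) = f (Sum.inl i) x := fun i x => hTT x _
  have hTr : ∀ i x, T x (f (Sum.inr i) x) = 0 := fun i x => by
    simp only [f, Sum.elim_inr, map_sub, hTT, sub_self]
  refine ⟨U', Fin r, inferInstance, fun i x => ⟨f (Sum.inl i) x, hmem x _⟩, hx', hf.isOpen,
    fun x hx => ?_, fun x hx => ?_, fun s x hx => ?_⟩
  · have h1 := (hf.linearIndependent x hx).comp Sum.inl Sum.inl_injective
    exact LinearIndependent.of_comp (S x).subtype h1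
  · rw [eq_top_iff]
    rintro ⟨a, ha⟩ -
    have h1 : a ∈ Submodule.span ℂ (Set.range fun i => f i x) := by
      rw [hf.span_eq_top x hx]; trivial
    obtain ⟨c, hc⟩ := (Submodule.mem_span_range_iff_exists_fun ℂ).1 h1
    refine (Submodule.mem_span_range_iff_exists_fun (M := S x) ℂ).2
      ⟨fun i => c (Sum.inl i), Subtype.ext ?_⟩
    replace hc : ∑ i, c i • f i x = a := hc
    have h2 := congrArg (T x) hc
    rw [hid x a ha, map_sum, Fintype.sum_sum_type] at h2
    simp only [map_smul, hTl, hTr, smul_zero, Finset.sum_const_zero, add_zero] at h2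
    refine Eq.trans (b := ∑ i, c (Sum.inl i) • f (Sum.inl i) x) ?_ h2
    exact map_sum (S x).subtype (fun i => c (Sum.inl i) •
      (⟨f (Sum.inl i) x, hmem x _⟩ : S x)) Finset.univ
  · change E.RegAt (fun y => (S y).subtype (s y)) x ↔ _
    rw [hf.regAt_iff _ x hx]
    constructor
    · rintro ⟨c, hc, h⟩
      refine ⟨fun i => c (Sum.inl i), fun i => hc _, ?_⟩
      filter_upwards [h] with y hy
      have h2 := congrArg (T y) hy
      replace h2 := (hid y _ (show S y from s y).2).symm.trans h2
      rw [map_sum, Fintype.sum_sum_type] at h2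
      simp only [map_smul, hTl, hTr, smul_zero, Finset.sum_const_zero, add_zero] at h2
      exact Subtype.ext (h2.trans (map_sum (S y).subtype (fun i => c (Sum.inl i) y •
        (⟨f (Sum.inl i) y, hmem y _⟩ : S y)) Finset.univ).symm)
    · rintro ⟨c, hc, h⟩
      refine ⟨Sum.elim c fun _ _ => 0, ?_, ?_⟩
      · rintro (i | i)
        · exact hc i
        · exact h𝒳.const 0 x
      · filter_upwards [h] with y hy
        rw [hy, Fintype.sum_sum_type]
        simp only [Sum.elim_inl, Sum.elim_inr, zero_smul, Finset.sum_const_zero, add_zero]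
        exact map_sum (S y).subtype _ _

end BundleData

namespace EqBundleData

variable {G : Type v} [Group G] {X : Type u} [MulAction G X] {𝒢 : FunSpace G} {𝒳 : FunSpace X}

/-- A family of subspaces that is stable under the group, as an equivariant subbundle. -/
def sub (E : EqBundleData.{u, v, w} G X) (S : ∀ x, Submodule ℂ (E.fib x))
    (hS : ∀ (g : G) {x y : X} (h : g • x = y), ∀ a ∈ S x, E.act g h a ∈ S y) :
    EqBundleData.{u, v, w} G X where
  toBundleData := E.toBundleData.sub S
  act g _ _ h := (E.act g h).restrict (hS g h)
  act_one h a := Subtype.ext (E.act_one h (Subtype.val a))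
  act_mul g' g _ _ _ h h' h'' a := Subtype.ext (E.act_mul g' g h h' h'' (Subtype.val a))

/-- The image of an idempotent endomorphism of an equivariant bundle is an equivariant bundle. -/
theorem IsEquivariantBundle.sub_of_idempotent (h𝒢 : 𝒢.IsRinged) (h𝒳 : 𝒳.IsRinged)
    (hact : FunSpace.IsAlgebraicAction 𝒢 𝒳) {E : EqBundleData.{u, v, w} G X}
    (hE : E.IsEquivariantBundle 𝒢 𝒳) {S : ∀ x, Submodule ℂ (E.fib x)}
    (hS : ∀ (g : G) {x y : X} (h : g • x = y), ∀ a ∈ S x, E.act g h a ∈ S y)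
    {T : ∀ x, E.fib x →ₗ[ℂ] E.fib x} (hT : BundleData.IsHom E.toBundleData E.toBundleData T)
    (hmem : ∀ x a, T x a ∈ S x) (hid : ∀ x, ∀ a ∈ S x, T x a = a) :
    (E.sub S hS).IsEquivariantBundle 𝒢 𝒳 := by
  have hVB := hE.isVectorBundle.sub_of_idempotent h𝒳 hT hmem hid
  have hprod := FunSpace.prod_isRinged h𝒢 h𝒳
  have hVB' : (BundleData.pullback (FunSpace.prod 𝒢 𝒳) (fun p : G × X => p.1 • p.2)
    (E.toBundleData.sub S)).IsVectorBundle (FunSpace.prod 𝒢 𝒳) := hVB.pullback h𝒳 hprod hact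
  refine ⟨hVB, ?_⟩
  rintro s p ⟨n, c, σ, hc, hσ, hs⟩
  -- the coefficients of the action on `E` also serve for `S`, with the sections projected by `T`
  have key : ∀ i, (BundleData.pullback (FunSpace.prod 𝒢 𝒳) (fun p : G × X => p.1 • p.2)
      (E.toBundleData.sub S)).RegAt (fun q => (E.sub S hS).act q.1 rfl (σ i q.2)) p := by
    intro i
    have h1 := hE.act_regular (fun q : G × X => ((S q.2).subtype (σ i q.2))) p
      (BundleData.pullback_regAt_comp (E := E.toBundleData) (φ := fun p : G × X => p.2)
        (σ := fun x => (S x).subtype (σ i x)) hprod (hσ i))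
    obtain ⟨m, k, ω, hk, hω, h⟩ := h1
    refine ⟨m, k, fun l x => ⟨T x (ω l x), hmem x _⟩, hk, fun l => hT _ _ (hω l), ?_⟩
    filter_upwards [h] with q hq
    refine Subtype.ext ?_
    have h2 : T (q.1 • q.2) (E.act q.1 rfl ((S q.2).subtype (σ i q.2))) =
        E.act q.1 rfl ((S q.2).subtype (σ i q.2)) :=
      hid _ _ (hS q.1 rfl _ (show S q.2 from σ i q.2).2)
    change E.act q.1 rfl ((S q.2).subtype (σ i q.2)) = _
    rw [← h2]
    refine (congrArg (T (q.1 • q.2)) hq).trans ?_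
    rw [map_sum]
    simp only [map_smul]
    exact (map_sum (S (q.1 • q.2)).subtype
      (fun l => k l q • (⟨T _ (ω l _), hmem _ _⟩ : S (q.1 • q.2))) Finset.univ).symm
  refine hVB'.congr (hVB'.sum hprod Finset.univ fun i _ => hVB'.smul hprod (hc i) (key i)) ?_
  filter_upwards [hs] with q hq
  refine Eq.trans ?_ (congrArg ((E.sub S hS).act q.1 rfl) hq).symm
  rw [map_sum]
  simp only [map_smul]
  rfl

/-! ### Restriction to the fixed locus -/

theorem act_eq_sum_of_act_eq_sum (V : EqBundleData.{u, v, w} G X) {g : G} {x y : X} (h : g • x = y)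
    (a : V.fib x) {n : ℕ} (k : Fin n → ℂ) (ω : Fin n → ∀ x, V.fib x)
    (ha : V.act g rfl a = ∑ l, k l • ω l (g • x)) : V.act g h a = ∑ l, k l • ω l y := by
  subst h
  exact ha

section Fixed

variable (h𝒢 : 𝒢.IsRinged) (h𝒳 : 𝒳.IsRinged) (hact : FunSpace.IsAlgebraicAction 𝒢 𝒳)
  {V : EqBundleData.{u, v, w} G X} (hV : V.IsEquivariantBundle 𝒢 𝒳) (g₁ g₂ : G)

include h𝒢 h𝒳 hact in
theorem isAlgebraicAction_fixed :
    FunSpace.IsAlgebraicAction (centralizerSpace 𝒢 g₁ g₂) (fixedSpace 𝒳 g₁ g₂) :=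
  FunSpace.isMorphism_sub_mk (hact.comp (FunSpace.isMorphism_prodMap (h𝒢.sub_isRinged _)
    (h𝒳.sub_isRinged _) (FunSpace.isMorphism_val _) (FunSpace.isMorphism_val _)))
    fun p : pairCentralizer g₁ g₂ × fixedLocus X g₁ g₂ => (p.1 • p.2).2

include h𝒳 hV in
theorem restrictFixed_isVectorBundle :
    (V.restrictFixed 𝒳 g₁ g₂).IsVectorBundle (fixedSpace 𝒳 g₁ g₂) :=
  hV.isVectorBundle.pullback h𝒳 (h𝒳.sub_isRinged _) (FunSpace.isMorphism_val _)

include h𝒢 h𝒳 hact hV in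
/-- The restriction to the fixed locus is equivariant for the centralizer. -/
theorem restrictFixed_isEquivariantBundle : (V.restrictFixed 𝒳 g₁ g₂).IsEquivariantBundle
    (centralizerSpace 𝒢 g₁ g₂) (fixedSpace 𝒳 g₁ g₂) := by
  have hZ : (centralizerSpace 𝒢 g₁ g₂).IsRinged := h𝒢.sub_isRinged _
  have hF : (fixedSpace 𝒳 g₁ g₂).IsRinged := h𝒳.sub_isRinged _
  have hVB := restrictFixed_isVectorBundle h𝒳 hV g₁ g₂
  have hprod := FunSpace.prod_isRinged hZ hF
  have hj : FunSpace.IsMorphism (FunSpace.prod (centralizerSpace 𝒢 g₁ g₂) (fixedSpace 𝒳 g₁ g₂))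
      (FunSpace.prod 𝒢 𝒳) (fun p => ((p.1 : G), (p.2 : X))) :=
    FunSpace.isMorphism_prodMap hZ hF (FunSpace.isMorphism_val _) (FunSpace.isMorphism_val _)
  have hVB' : (BundleData.pullback (FunSpace.prod (centralizerSpace 𝒢 g₁ g₂) (fixedSpace 𝒳 g₁ g₂))
      (fun p : pairCentralizer g₁ g₂ × fixedLocus X g₁ g₂ => p.1 • p.2)
      (V.restrictFixed 𝒳 g₁ g₂).toBundleData).IsVectorBundle
      (FunSpace.prod (centralizerSpace 𝒢 g₁ g₂) (fixedSpace 𝒳 g₁ g₂)) :=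
    hVB.pullback hF hprod (isAlgebraicAction_fixed h𝒢 h𝒳 hact g₁ g₂)
  refine ⟨hVB, ?_⟩
  rintro s p ⟨n, c, σ, hc, hσ, hs⟩
  have key : ∀ τ : ∀ x, V.fib x, V.RegAt τ (p.2 : X) →
      (BundleData.pullback (FunSpace.prod (centralizerSpace 𝒢 g₁ g₂) (fixedSpace 𝒳 g₁ g₂))
      (fun p : pairCentralizer g₁ g₂ × fixedLocus X g₁ g₂ => p.1 • p.2)
      (V.restrictFixed 𝒳 g₁ g₂).toBundleData).RegAt
        (fun q => (V.restrictFixed 𝒳 g₁ g₂).act q.1 rfl (τ q.2)) p := by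
    intro τ hτ
    have h1 := hV.act_regular (fun q : G × X => τ q.2) ((p.1 : G), (p.2 : X))
      (BundleData.pullback_regAt_comp (FunSpace.prod_isRinged h𝒢 h𝒳) hτ)
    obtain ⟨m, k, ω, hk, hω, h⟩ := h1
    refine ⟨m, fun l q => k l ((q.1 : G), (q.2 : X)), fun l x => ω l (x : X),
      fun l => hj.regAt (hk l), fun l => ?_, ?_⟩
    · exact BundleData.pullback_regAt_comp (φ := Subtype.val) hF (hω l)
    · filter_upwards [hj.eventually h] with q hq
      exact hq
  have key2 : ∀ i, (BundleData.pullback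
      (FunSpace.prod (centralizerSpace 𝒢 g₁ g₂) (fixedSpace 𝒳 g₁ g₂))
      (fun p : pairCentralizer g₁ g₂ × fixedLocus X g₁ g₂ => p.1 • p.2)
      (V.restrictFixed 𝒳 g₁ g₂).toBundleData).RegAt
        (fun q => (V.restrictFixed 𝒳 g₁ g₂).act q.1 rfl (σ i q.2)) p := by
    intro i
    obtain ⟨m, d, τ, hd, hτ, h⟩ := hσ i
    refine hVB'.congr (hVB'.sum hprod Finset.univ fun l _ => hVB'.smul hprod
      ((FunSpace.isMorphism_snd hZ hF).regAt (hd l)) (key (τ l) (hτ l))) ?_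
    filter_upwards [(FunSpace.isMorphism_snd hZ hF).eventually (x := p) h] with q hq
    refine Eq.trans ?_ (congrArg ((V.restrictFixed 𝒳 g₁ g₂).act q.1 rfl) hq).symm
    refine Eq.trans ?_ (map_sum ((V.restrictFixed 𝒳 g₁ g₂).act q.1 rfl) _ _).symm
    refine Finset.sum_congr rfl fun l _ => ?_
    exact (map_smul ((V.restrictFixed 𝒳 g₁ g₂).act q.1 (rfl : q.1 • q.2 = _)) _ _).symm
  refine hVB'.congr (hVB'.sum hprod Finset.univ fun i _ => hVB'.smul hprod (hc i) (key2 i)) ?_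
  filter_upwards [hs] with q hq
  refine Eq.trans ?_ (congrArg ((V.restrictFixed 𝒳 g₁ g₂).act q.1 rfl) hq).symm
  refine Eq.trans ?_ (map_sum ((V.restrictFixed 𝒳 g₁ g₂).act q.1 rfl) _ _).symm
  refine Finset.sum_congr rfl fun l _ => ?_
  exact (map_smul ((V.restrictFixed 𝒳 g₁ g₂).act q.1 (rfl : q.1 • q.2 = _)) _ _).symm

include h𝒢 h𝒳 hV in
/-- The elements of the group generated by `g₁` and `g₂` act on the restriction to the fixed locus
by bundle homomorphisms. -/
theorem fibreAut_isHom (g : pairSubgroup g₁ g₂) :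
    BundleData.IsHom (V.restrictFixed 𝒳 g₁ g₂).toBundleData (V.restrictFixed 𝒳 g₁ g₂).toBundleData
      (V.fibreAut 𝒳 g₁ g₂ g).toFun := by
  have hF : (fixedSpace 𝒳 g₁ g₂).IsRinged := h𝒳.sub_isRinged _
  have hVB := restrictFixed_isVectorBundle h𝒳 hV g₁ g₂
  have hj : FunSpace.IsMorphism (fixedSpace 𝒳 g₁ g₂) (FunSpace.prod 𝒢 𝒳)
      (fun x => ((g : G), (x : X))) :=
    FunSpace.isMorphism_prodMk hF (FunSpace.isMorphism_const hF _) (FunSpace.isMorphism_val _)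
  rintro s y ⟨n, c, σ, hc, hσ, hs⟩
  have key : ∀ i, (V.restrictFixed 𝒳 g₁ g₂).RegAt
      (fun x => (V.fibreAut 𝒳 g₁ g₂ g).toFun x (σ i x)) y := by
    intro i
    have hgy : (g : G) • (y : X) = y := pairSubgroup_smul g y
    have h1 := hV.act_regular (fun q : G × X => σ i q.2) ((g : G), (y : X))
      (BundleData.pullback_regAt_comp (FunSpace.prod_isRinged h𝒢 h𝒳) (hσ i))
    obtain ⟨m, k, ω, hk, hω, h⟩ := h1
    refine ⟨m, fun l x => k l ((g : G), (x : X)), ω, fun l => hj.regAt (hk l), fun l => ?_, ?_⟩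
    · have h2 := hω l
      simp only [hgy] at h2
      exact h2
    · filter_upwards [hj.eventually h] with x hx
      exact V.act_eq_sum_of_act_eq_sum (pairSubgroup_smul g x) _ _ _ hx
  refine hVB.congr (hVB.sum hF Finset.univ fun i _ => hVB.smul hF (hc i) (key i)) ?_
  filter_upwards [hs] with x hx
  refine Eq.trans ?_ (congrArg ((V.fibreAut 𝒳 g₁ g₂ g).toFun x) hx).symm
  refine Eq.trans ?_ (map_sum ((V.fibreAut 𝒳 g₁ g₂ g).toFun x) _ _).symm
  refine Finset.sum_congr rfl fun l _ => ?_
  exact (map_smul ((V.fibreAut 𝒳 g₁ g₂ g).toFun x) _ _).symm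

end Fixed

end EqBundleData

/-! ### Classes of images of idempotents in the Grothendieck group -/

namespace EqBundleData

variable {G : Type v} [Group G] {X : Type u} [MulAction G X] {𝒢 : FunSpace G} {𝒳 : FunSpace X}

theorem IsEquivariantBundle.cls_eq {E : EqBundleData.{u, v, w} G X}
    (hE : E.IsEquivariantBundle 𝒢 𝒳) : E.cls 𝒢 𝒳 = EqVB.cls ⟨E, hE⟩ := dif_pos hE

theorem ShortExact.cls_eq_add {A B C : EqBundleData.{u, v, w} G X} (h : ShortExact A B C)
    (hA : A.IsEquivariantBundle 𝒢 𝒳) (hB : B.IsEquivariantBundle 𝒢 𝒳)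
    (hC : C.IsEquivariantBundle 𝒢 𝒳) : B.cls 𝒢 𝒳 = A.cls 𝒢 𝒳 + C.cls 𝒢 𝒳 := by
  rw [hA.cls_eq, hB.cls_eq, hC.cls_eq]
  have h1 : (QuotientAddGroup.mk (FreeAbelianGroup.of (⟨B, hB⟩ : EqVB.{u, v, w} 𝒢 𝒳) -
      FreeAbelianGroup.of ⟨A, hA⟩ - FreeAbelianGroup.of ⟨C, hC⟩) : KGroup.{u, v, w} 𝒢 𝒳) = 0 :=
    (QuotientAddGroup.eq_zero_iff _).2
      (AddSubgroup.subset_closure ⟨⟨A, hA⟩, ⟨B, hB⟩, ⟨C, hC⟩, h, rfl⟩)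
  have h2 : EqVB.cls ⟨B, hB⟩ - EqVB.cls ⟨A, hA⟩ - EqVB.cls ⟨C, hC⟩ = (0 : KGroup.{u, v, w} 𝒢 𝒳) :=
    h1
  rw [sub_sub, sub_eq_zero] at h2
  exact h2

theorem shortExact_of_exact {A B C : EqBundleData.{u, v, w} G X} {i : ∀ x, A.fib x →ₗ[ℂ] B.fib x}
    {p : ∀ x, B.fib x →ₗ[ℂ] C.fib x} (hi : IsEqHom A B i) (hp : IsEqHom B C p)
    (hinj : ∀ x a, i x a = 0 → a = 0) (hsurj : ∀ x c, ∃ b, p x b = c)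
    (hexact : ∀ x b, (∃ a, i x a = b) ↔ p x b = 0) : ShortExact A B C :=
  ⟨i, p, hi, hp, fun x => ⟨(injective_iff_map_eq_zero (i x)).2 (hinj x), hsurj x,
    Submodule.ext fun b => hexact x b⟩⟩

/-- A bundle with zero fibres has class zero. -/
theorem cls_eq_zero_of_subsingleton {E : EqBundleData.{u, v, w} G X}
    (hE : E.IsEquivariantBundle 𝒢 𝒳) (h : ∀ x, Subsingleton (E.fib x)) : E.cls 𝒢 𝒳 = 0 := by
  have h1 : IsEqHom E E fun _ => LinearMap.id := ⟨fun s x hs => hs, fun _ _ _ _ _ => rfl⟩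
  have h2 : ShortExact E E E := ⟨fun _ => LinearMap.id, fun _ => LinearMap.id, h1, h1, fun x =>
    ⟨Function.injective_id, Function.surjective_id, Subsingleton.elim _ _⟩⟩
  simpa using h2.cls_eq_add hE hE hE

/-- The algebra of endomorphisms of an equivariant bundle. -/
def endAlgebra (E : EqBundleData.{u, v, w} G X) (h𝒳 : 𝒳.IsRinged)
    (hE : E.toBundleData.IsVectorBundle 𝒳) : Subalgebra ℂ (∀ x, Module.End ℂ (E.fib x)) where
  carrier := {T | IsEqHom E E T}
  mul_mem' {S T} hS hT := ⟨fun s x hs => hS.1 _ x (hT.1 s x hs), fun g x y h a => by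
    rw [Pi.mul_apply, Module.End.mul_apply, hT.2, hS.2]; rfl⟩
  add_mem' {S T} hS hT := ⟨fun s x hs => hE.add h𝒳 (hS.1 _ x hs) (hT.1 s x hs), fun g x y h a => by
    rw [Pi.add_apply, LinearMap.add_apply, hT.2, hS.2, ← map_add]; rfl⟩
  algebraMap_mem' c := ⟨fun s x hs => hE.smul h𝒳 (h𝒳.const c x) hs, fun g x y h a =>
    (map_smul (E.act g h) c a).symm⟩

variable {E : EqBundleData.{u, v, w} G X} {h𝒳 : 𝒳.IsRinged} {hE : E.toBundleData.IsVectorBundle 𝒳}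

/-- The image of an endomorphism of an equivariant bundle. It is a bundle if the endomorphism is
idempotent. -/
def image (q : E.endAlgebra h𝒳 hE) : EqBundleData.{u, v, w} G X :=
  E.sub (fun x => LinearMap.range (q.1 x)) (by
    rintro g x y h _ ⟨a, rfl⟩
    exact ⟨E.act g h a, q.2.2 g x y h a⟩)

theorem endAlgebra_mul_apply (p q : E.endAlgebra h𝒳 hE) (x : X) (a : E.fib x) :
    (p * q).1 x a = p.1 x (q.1 x a) := rfl

theorem image_isEquivariantBundle (h𝒢 : 𝒢.IsRinged) (hact : FunSpace.IsAlgebraicAction 𝒢 𝒳)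
    (hE' : E.IsEquivariantBundle 𝒢 𝒳) {q : E.endAlgebra h𝒳 hE} (hq : q * q = q) :
    (image q).IsEquivariantBundle 𝒢 𝒳 := by
  refine hE'.sub_of_idempotent h𝒢 h𝒳 hact _ q.2.1 (fun x a => ⟨a, rfl⟩) ?_
  rintro x _ ⟨a, rfl⟩
  rw [← endAlgebra_mul_apply, hq]

/-- An endomorphism that maps the image of `p` into the image of `q` restricts to a homomorphism
between these images. -/
theorem isEqHom_image {p q y : E.endAlgebra h𝒳 hE}
    (h : ∀ x, ∀ a ∈ LinearMap.range (p.1 x), y.1 x a ∈ LinearMap.range (q.1 x)) :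
    IsEqHom (image p) (image q) fun x => (y.1 x).restrict (h x) :=
  ⟨fun s x hs => y.2.1 (fun z => (LinearMap.range (p.1 z)).subtype (s z)) x hs,
    fun g x z e a => Subtype.ext (y.2.2 g x z e a.1)⟩

/-- The class of the image of an idempotent is additive, by the exact sequence
`0 → pE → (p + q)E → qE → 0`, and the same for `x y` and `y x`, by the isomorphism
`y : xyE → yxE`. -/
theorem isIdempotentAdditive_cls_image (h𝒢 : 𝒢.IsRinged)
    (hact : FunSpace.IsAlgebraicAction 𝒢 𝒳) (hE' : E.IsEquivariantBundle 𝒢 𝒳) :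
    IsIdempotentAdditive fun q : E.endAlgebra h𝒳 hE => (image q).cls 𝒢 𝒳 where
  add p q hp hq hpq hqp := by
    have happ : ∀ {a b c : E.endAlgebra h𝒳 hE}, a * b = c → ∀ x v, a.1 x (b.1 x v) = c.1 x v := by
      rintro a b _ rfl x v
      rfl
    have hs : (p + q) * (p + q) = p + q := by
      rw [mul_add, add_mul, add_mul, hp, hq, hpq, hqp, add_zero, zero_add]
    have h1 : ∀ x, ∀ a ∈ LinearMap.range (p.1 x),
        (1 : E.endAlgebra h𝒳 hE).1 x a ∈ LinearMap.range ((p + q).1 x) := by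
      rintro x _ ⟨a, rfl⟩
      refine ⟨p.1 x a, ?_⟩
      rw [happ (show (p + q) * p = p by rw [add_mul, hp, hqp, add_zero])]
      rfl
    have h2 : ∀ x, ∀ a ∈ LinearMap.range ((p + q).1 x), q.1 x a ∈ LinearMap.range (q.1 x) :=
      fun x a _ => ⟨a, rfl⟩
    refine ShortExact.cls_eq_add (shortExact_of_exact (isEqHom_image h1) (isEqHom_image h2)
      (fun x => ?_) (fun x => ?_) (fun x => ?_))
      (image_isEquivariantBundle h𝒢 hact hE' hp) (image_isEquivariantBundle h𝒢 hact hE' hs)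
      (image_isEquivariantBundle h𝒢 hact hE' hq)
    · rintro ⟨a, ha⟩ h
      have h' : a = 0 := congrArg Subtype.val h
      exact Subtype.ext h'
    · rintro ⟨_, a, rfl⟩
      refine ⟨⟨q.1 x a, q.1 x a, ?_⟩, Subtype.ext (happ hq x a)⟩
      exact happ (show (p + q) * q = q by rw [add_mul, hq, hpq, zero_add]) x a
    · rintro ⟨_, a, rfl⟩
      constructor
      · rintro ⟨⟨_, b, rfl⟩, hb⟩
        have hb' : p.1 x b = (p + q).1 x a := congrArg Subtype.val hb
        refine Subtype.ext ?_
        change q.1 x ((p + q).1 x a) = 0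
        rw [← hb', happ hqp]
        rfl
      · intro h
        have h' : q.1 x ((p + q).1 x a) = 0 := congrArg Subtype.val h
        rw [happ (show q * (p + q) = q by rw [mul_add, hq, hqp, zero_add])] at h'
        refine ⟨⟨p.1 x a, a, rfl⟩, Subtype.ext ?_⟩
        change p.1 x a = p.1 x a + q.1 x a
        rw [h', add_zero]
  conj x y p q hp hq hxy hyx := by
    have happ : ∀ {a b c : E.endAlgebra h𝒳 hE}, a * b = c → ∀ x v, a.1 x (b.1 x v) = c.1 x v := by
      rintro a b _ rfl x v
      rfl
    have h00 : (0 : E.endAlgebra h𝒳 hE) * 0 = 0 := zero_mul 0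
    have hz := image_isEquivariantBundle h𝒢 hact hE' h00
    have hz' : ∀ z, Subsingleton ((image (0 : E.endAlgebra h𝒳 hE)).fib z) := fun z =>
      ⟨by rintro ⟨_, a, rfl⟩ ⟨_, b, rfl⟩; rfl⟩
    have h1 : ∀ z, ∀ a ∈ LinearMap.range ((0 : E.endAlgebra h𝒳 hE).1 z),
        (0 : E.endAlgebra h𝒳 hE).1 z a ∈ LinearMap.range (p.1 z) := fun z a _ => zero_mem _
    have h2 : ∀ z, ∀ a ∈ LinearMap.range (p.1 z), y.1 z a ∈ LinearMap.range (q.1 z) := by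
      rintro z _ ⟨a, rfl⟩
      refine ⟨y.1 z a, ?_⟩
      rw [happ (rfl : q * y = q * y), happ (rfl : y * p = y * p), ← hxy, ← hyx, mul_assoc]
    -- an isomorphism is a short exact sequence that starts with a zero bundle
    have h3 := ShortExact.cls_eq_add (shortExact_of_exact (isEqHom_image h1) (isEqHom_image h2)
      (fun z a _ => (hz' z).elim a 0) (fun z => ?_) (fun z => ?_))
      hz (image_isEquivariantBundle h𝒢 hact hE' hp) (image_isEquivariantBundle h𝒢 hact hE' hq)
    · rw [cls_eq_zero_of_subsingleton hz hz', zero_add] at h3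
      exact h3
    · rintro ⟨_, a, rfl⟩
      refine ⟨⟨p.1 z (x.1 z a), x.1 z a, rfl⟩, Subtype.ext ?_⟩
      change y.1 z (p.1 z (x.1 z a)) = q.1 z a
      rw [happ (rfl : p * x = p * x), happ (rfl : y * (p * x) = _), ← hxy, mul_assoc, ← mul_assoc y,
        hyx, hq]
    · rintro ⟨_, a, rfl⟩
      constructor
      · rintro ⟨b, hb⟩
        have hb' : (0 : E.fib z) = p.1 z a := congrArg Subtype.val hb
        refine Subtype.ext ?_
        change y.1 z (p.1 z a) = 0
        rw [← hb', map_zero]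
      · intro ha
        have ha' : y.1 z (p.1 z a) = 0 := congrArg Subtype.val ha
        refine ⟨⟨0, 0, rfl⟩, Subtype.ext ?_⟩
        change 0 = p.1 z a
        rw [← happ hp, ← happ hxy z (p.1 z a), ha', map_zero]

end EqBundleData

/-! ### Compact groups act by bounded groups of automorphisms -/

namespace FunSpace

variable {X : Type u} {𝒳 : FunSpace X}

theorem eventually_analytic_of_eventually (h𝒳 : 𝒳.IsRinged) {x : X} {p : X → Prop}
    (h : ∀ᶠ y in 𝒳.nbhd x, p y) : ∀ᶠ y in @nhds X 𝒳.analyticTop x, p y := by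
  obtain ⟨U, hU, hx, hp⟩ := (eventually_iff 𝒳).1 h
  let _ := 𝒳.analyticTop
  have hU' : IsOpen {y | y ∈ U ∧ (fun _ : X => (0 : ℂ)) y ∈ (Set.univ : Set ℂ)} :=
    TopologicalSpace.isOpen_generateFrom_of_mem ⟨U, fun _ => 0, Set.univ, hU,
      fun y _ => h𝒳.const 0 y, isOpen_univ, rfl⟩
  filter_upwards [hU'.mem_nhds ⟨hx, trivial⟩] with y hy
  exact hp y hy.1

theorem RegAt.bounded_analytic {x : X} {f : X → ℂ} (hf : 𝒳.RegAt f x) :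
    ∃ C : ℝ, ∀ᶠ y in @nhds X 𝒳.analyticTop x, ‖f y‖ ≤ C := by
  obtain ⟨U, hU, hx, hp⟩ := (eventually_iff 𝒳).1 (𝒳.nearby hf)
  let _ := 𝒳.analyticTop
  have hU' : IsOpen {y | y ∈ U ∧ f y ∈ Metric.ball (0 : ℂ) (‖f x‖ + 1)} :=
    TopologicalSpace.isOpen_generateFrom_of_mem ⟨U, f, _, hU, hp, Metric.isOpen_ball, rfl⟩
  refine ⟨‖f x‖ + 1, ?_⟩
  filter_upwards [hU'.mem_nhds ⟨hx, by simp⟩] with y hy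
  simpa using (mem_ball_zero_iff.1 hy.2).le

end FunSpace

namespace EqBundleData

variable {G : Type v} [Group G] {X : Type u} [MulAction G X] {𝒢 : FunSpace G} {𝒳 : FunSpace X}
  {V : EqBundleData.{u, v, w} G X}

/-- Near any element of the group, the matrix coefficients of the elements that fix a given point
are bounded, because the action on the bundle is given by regular functions. -/
theorem IsEquivariantBundle.eventually_bounded_act (h𝒢 : 𝒢.IsRinged) (h𝒳 : 𝒳.IsRinged)
    (hV : V.IsEquivariantBundle 𝒢 𝒳) (y : X) (φ : Module.End ℂ (V.fib y) →ₗ[ℂ] ℂ) (g₀ : G) :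
    ∃ C : ℝ, ∀ᶠ g in @nhds G 𝒢.analyticTop g₀, ∀ h : g • y = y, ‖φ (V.act g h)‖ ≤ C := by
  obtain ⟨U, n, e, hy, he⟩ := BundleData.isVectorBundle_iff.1 hV.isVectorBundle y
  obtain ⟨b, hb⟩ : ∃ b : Module.Basis (Fin n) ℂ (V.fib y), ∀ i, b i = e i y :=
    ⟨Module.Basis.mk (he.linearIndependent y hy) (he.span_eq_top y hy).ge, fun i => by simp⟩
  have hj : FunSpace.IsMorphism 𝒢 (FunSpace.prod 𝒢 𝒳) (fun g => (g, y)) :=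
    FunSpace.isMorphism_prodMk h𝒢 FunSpace.isMorphism_id (FunSpace.isMorphism_const h𝒢 _)
  -- the operator that agrees with `g` on the basis vector `i` and vanishes on the others
  have hcol : ∀ i, ∃ C : ℝ, ∀ᶠ g in @nhds G 𝒢.analyticTop g₀, ∀ h : g • y = y,
      ‖φ ((b.coord i).smulRight (V.act g h (e i y)))‖ ≤ C := by
    intro i
    obtain ⟨m, k, ω, hk, -, h⟩ := hV.act_regular (fun q : G × X => e i q.2) (g₀, y)
      (BundleData.pullback_regAt_comp (FunSpace.prod_isRinged h𝒢 h𝒳) (he.regAt h𝒳 i hy))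
    choose C hC using fun l => (hj.regAt (hk l)).bounded_analytic
    refine ⟨∑ l, C l * ‖φ ((b.coord i).smulRight (ω l y))‖, ?_⟩
    filter_upwards [FunSpace.eventually_analytic_of_eventually h𝒢 (hj.eventually h),
      Filter.eventually_all.2 hC] with g hg hgC hgy
    rw [V.act_eq_sum_of_act_eq_sum hgy _ (fun l => k l (g, y)) ω hg]
    have : (b.coord i).smulRight (∑ l, k l (g, y) • ω l y)
        = ∑ l, k l (g, y) • (b.coord i).smulRight (ω l y) := by
      ext a
      simp only [LinearMap.smulRight_apply, LinearMap.sum_apply, LinearMap.smul_apply,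
        Finset.smul_sum]
      exact Finset.sum_congr rfl fun l _ => smul_comm _ _ _
    rw [this, map_sum]
    refine (norm_sum_le _ _).trans (Finset.sum_le_sum fun l _ => ?_)
    rw [map_smul, norm_smul]
    exact mul_le_mul_of_nonneg_right (hgC l) (norm_nonneg _)
  choose C hC using hcol
  refine ⟨∑ i, C i, ?_⟩
  filter_upwards [Filter.eventually_all.2 hC] with g hg hgy
  have : V.act g hgy = ∑ i, (b.coord i).smulRight (V.act g hgy (e i y)) := by
    refine b.ext fun j => ?_
    rw [LinearMap.sum_apply, Finset.sum_eq_single_of_mem j (Finset.mem_univ j)]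
    · simp [← hb]
    · intro i _ hij
      simp [hij.symm]
  rw [this, map_sum]
  exact (norm_sum_le _ _).trans (Finset.sum_le_sum fun i _ => hg i hgy)

theorem IsEquivariantBundle.bounded_act_of_isCompact (h𝒢 : 𝒢.IsRinged) (h𝒳 : 𝒳.IsRinged)
    (hV : V.IsEquivariantBundle 𝒢 𝒳) {K : Set G} (hK : @IsCompact G 𝒢.analyticTop K) (y : X)
    (φ : Module.End ℂ (V.fib y) →ₗ[ℂ] ℂ) :
    ∃ C : ℝ, ∀ g ∈ K, ∀ h : g • y = y, ‖φ (V.act g h)‖ ≤ C := by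
  let _ := 𝒢.analyticTop
  refine hK.induction_on (p := fun S => ∃ C : ℝ, ∀ g ∈ S, ∀ h : g • y = y, ‖φ (V.act g h)‖ ≤ C)
    ⟨0, fun g hg => hg.elim⟩ (fun s t hst => fun ⟨C, hC⟩ => ⟨C, fun g hg => hC g (hst hg)⟩) ?_ ?_
  · rintro s t ⟨C, hC⟩ ⟨D, hD⟩
    refine ⟨max C D, fun g hg h => ?_⟩
    rcases hg with hg | hg
    · exact (hC g hg h).trans (le_max_left _ _)
    · exact (hD g hg h).trans (le_max_right _ _)
  · intro g₀ _
    obtain ⟨C, hC⟩ := hV.eventually_bounded_act h𝒢 h𝒳 y φ g₀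
    exact ⟨_, mem_nhdsWithin_of_mem_nhds hC, C, fun g hg => hg⟩

end EqBundleData

/-! ### The algebra generated by a bounded group in a product of endomorphism algebras -/

section BoundedGroup

open Matrix

open scoped ComplexOrder

variable {Γ : Type*} [Group Γ] {Y : Type*} {W : Y → Type*} [∀ y, AddCommGroup (W y)]
  [∀ y, Module ℂ (W y)]

/-- A bounded group of automorphisms of a vector space acts by unitary matrices in a suitable
basis. -/
theorem exists_algEquiv_mem_unitaryGroup {W : Type*} [AddCommGroup W] [Module ℂ W]
    [FiniteDimensional ℂ W] (ρ : Γ →* Module.End ℂ W)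
    (hb : ∀ φ : Module.End ℂ W →ₗ[ℂ] ℂ, ∃ C : ℝ, ∀ γ, ‖φ (ρ γ)‖ ≤ C) :
    ∃ (m : ℕ) (M : Module.End ℂ W ≃ₐ[ℂ] Matrix (Fin m) (Fin m) ℂ),
      (∀ γ, M (ρ γ) ∈ unitaryGroup (Fin m) ℂ) ∧ ∀ a, (M a).trace = LinearMap.trace ℂ W a := by
  let b := Module.finBasis ℂ W
  let e := LinearMap.toMatrixAlgEquiv b
  obtain ⟨S, hS⟩ := exists_conj_mem_unitaryGroup ((e : _ →* _).comp ρ) fun i j =>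
    hb ((LinearMap.proj j ∘ₗ LinearMap.proj i) ∘ₗ e.toLinearMap)
  refine ⟨_, e.trans (MulSemiringAction.toAlgEquiv ℂ (Matrix _ _ ℂ) (ConjAct.toConjAct S)),
    fun γ => hS γ, fun a => ?_⟩
  rw [LinearMap.trace_eq_matrix_trace ℂ b]
  exact trace_units_conj S (e a)

/-- The algebra generated by a group of families of automorphisms. -/
def groupAlgebraImage (T : Γ →* ∀ y, Module.End ℂ (W y)) :
    Subalgebra ℂ (∀ y, Module.End ℂ (W y)) := Algebra.adjoin ℂ (Set.range T)

variable {T : Γ →* ∀ y, Module.End ℂ (W y)}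

theorem apply_mem_groupAlgebraImage (γ : Γ) : T γ ∈ groupAlgebraImage T :=
  Algebra.subset_adjoin ⟨γ, rfl⟩

theorem groupAlgebraImage_induction {p : (∀ y, Module.End ℂ (W y)) → Prop} (hT : ∀ γ, p (T γ))
    (h0 : p 0) (hadd : ∀ a b, p a → p b → p (a + b)) (hsmul : ∀ (c : ℂ) a, p a → p (c • a))
    {a : ∀ y, Module.End ℂ (W y)} (ha : a ∈ groupAlgebraImage T) : p a := by
  have h : a ∈ Submodule.span ℂ (Set.range T) := by
    have h1 := Algebra.adjoin_eq_span ℂ ((MonoidHom.mrange T) : Set (∀ y, Module.End ℂ (W y)))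
    rw [Submonoid.closure_eq, MonoidHom.coe_mrange] at h1
    rw [← h1]
    exact ha
  clear ha
  induction h using Submodule.span_induction with
  | mem x hx => obtain ⟨γ, rfl⟩ := hx; exact hT γ
  | zero => exact h0
  | add x y _ _ hx hy => exact hadd x y hx hy
  | smul c x _ hx => exact hsmul c x hx

section Unitary

variable {m : Y → ℕ} {M : ∀ y, Module.End ℂ (W y) ≃ₐ[ℂ] Matrix (Fin (m y)) (Fin (m y)) ℂ}
  (hM : ∀ y γ, M y (T γ y) ∈ unitaryGroup (Fin (m y)) ℂ)
  (htr : ∀ y a, (M y a).trace = LinearMap.trace ℂ (W y) a)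

include hM in
/-- The algebra generated by a group of unitary matrices is closed under conjugate transposition. -/
theorem exists_conjTranspose_groupAlgebraImage {a : ∀ y, Module.End ℂ (W y)}
    (ha : a ∈ groupAlgebraImage T) :
    ∃ a' ∈ groupAlgebraImage T, ∀ y, M y (a' y) = (M y (a y))ᴴ := by
  refine groupAlgebraImage_induction (p := fun a => ∃ a' ∈ groupAlgebraImage T, ∀ y,
    M y (a' y) = (M y (a y))ᴴ) ?_ ?_ ?_ ?_ ha
  · intro γ
    refine ⟨T γ⁻¹, apply_mem_groupAlgebraImage _, fun y => ?_⟩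
    refine left_inv_eq_right_inv (a := M y (T γ y)) ?_ (mem_unitaryGroup_iff.1 (hM y γ))
    rw [← map_mul, ← Pi.mul_apply, ← map_mul, inv_mul_cancel, map_one, Pi.one_apply, map_one]
  · exact ⟨0, zero_mem _, fun y => by simp⟩
  · rintro a b ⟨a', ha', h⟩ ⟨b', hb', h'⟩
    exact ⟨a' + b', add_mem ha' hb', fun y => by simp [h, h']⟩
  · rintro c a ⟨a', ha', h⟩
    exact ⟨star c • a', Subalgebra.smul_mem _ ha' _, fun y => by simp [h]⟩

include hM htr in
/-- If every character of the family occurs at a point of `s`, an element of the algebra that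
vanishes at the points of `s` is zero: the trace of `aᴴ a` only depends on the character. -/
theorem eq_zero_of_forall_mem_eq_zero {s : Finset Y}
    (hs : ∀ y, ∃ y' ∈ s, ∀ γ, LinearMap.trace ℂ (W y') (T γ y') = LinearMap.trace ℂ (W y) (T γ y))
    {a : ∀ y, Module.End ℂ (W y)} (ha : a ∈ groupAlgebraImage T) (h : ∀ y ∈ s, a y = 0) :
    a = 0 := by
  obtain ⟨a', ha', haa'⟩ := exists_conjTranspose_groupAlgebraImage hM ha
  funext y
  obtain ⟨y', hy', hyy'⟩ := hs y
  have key : LinearMap.trace ℂ (W y') ((a' * a) y') = LinearMap.trace ℂ (W y) ((a' * a) y) :=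
    groupAlgebraImage_induction (p := fun a => LinearMap.trace ℂ (W y') (a y') =
      LinearMap.trace ℂ (W y) (a y)) hyy' (by simp) (fun a b h h' => by simp [h, h'])
      (fun c a h => by simp [h]) (mul_mem ha' ha)
  rw [Pi.mul_apply, h y' hy', mul_zero, map_zero, ← htr, Pi.mul_apply, map_mul, haa'] at key
  have h0 := trace_conjTranspose_mul_self_eq_zero_iff.1 key.symm
  simpa using h0

include hM htr in
/-- The algebra is embedded into a product over finitely many points. -/
theorem exists_restriction_groupAlgebraImage {s : Finset Y}
    (hs : ∀ y, ∃ y' ∈ s, ∀ γ, LinearMap.trace ℂ (W y') (T γ y') = LinearMap.trace ℂ (W y) (T γ y)) :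
    ∃ r : groupAlgebraImage T →ₗ[ℂ] (∀ y : s, Module.End ℂ (W y)), LinearMap.ker r = ⊥ ∧
      ∀ γ y, r ⟨T γ, apply_mem_groupAlgebraImage γ⟩ y = T γ y := by
  refine ⟨(LinearMap.pi fun y : s => LinearMap.proj (y : Y)) ∘ₗ
      (groupAlgebraImage T).val.toLinearMap,
    LinearMap.ker_eq_bot'.2 fun a ha => ?_, fun γ y => rfl⟩
  exact Subtype.ext (eq_zero_of_forall_mem_eq_zero hM htr hs a.2 fun y hy => congrFun ha ⟨y, hy⟩)

include hM in
/-- If `a` lies in the Jacobson radical, `aᴴ a` is nilpotent, hence has trace zero, and `a = 0`. -/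
theorem isSemisimpleRing_groupAlgebraImage [FiniteDimensional ℂ (groupAlgebraImage T)] :
    IsSemisimpleRing (groupAlgebraImage T) := by
  have : IsArtinianRing (groupAlgebraImage T) := IsArtinianRing.of_finite ℂ _
  rw [IsArtinianRing.isSemisimpleRing_iff_jacobson, eq_bot_iff]
  intro a ha
  obtain ⟨a', ha', haa'⟩ := exists_conjTranspose_groupAlgebraImage hM a.2
  obtain ⟨k, hk⟩ := IsSemiprimaryRing.isNilpotent (R := groupAlgebraImage T)
  have h1 : (⟨a', ha'⟩ * a) ^ k = 0 := by
    have := Ideal.pow_mem_pow (Ideal.mul_mem_left _ ⟨a', ha'⟩ ha) k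
    rwa [hk] at this
  rw [Submodule.mem_bot]
  refine Subtype.ext (funext fun y => ?_)
  have h2 : IsNilpotent ((M y (a.1 y))ᴴ * M y (a.1 y)) := by
    refine ⟨k, ?_⟩
    rw [← haa', ← map_mul, ← map_pow]
    have h3 : (a' y * a.1 y) ^ k = 0 := congrFun (congrArg Subtype.val h1) y
    rw [h3, map_zero]
  have h4 := trace_conjTranspose_mul_self_eq_zero_iff.1
    (isNilpotent_iff_eq_zero.1 (isNilpotent_trace_of_isNilpotent h2))
  simpa using h4

end Unitary

/-- A family of representations of a group, each bounded, with only finitely many different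
characters: the algebra it generates is a product of matrix algebras, and the group acts by unitary
matrices in suitable bases. -/
theorem exists_algEquiv_pi_matrix_groupAlgebraImage [∀ y, FiniteDimensional ℂ (W y)]
    (hb : ∀ y (φ : Module.End ℂ (W y) →ₗ[ℂ] ℂ), ∃ C : ℝ, ∀ γ, ‖φ (T γ y)‖ ≤ C) {s : Finset Y}
    (hs : ∀ y, ∃ y' ∈ s, ∀ γ, LinearMap.trace ℂ (W y') (T γ y') = LinearMap.trace ℂ (W y) (T γ y)) :
    ∃ (n : ℕ) (d : Fin n → ℕ) (_ : ∀ i, NeZero (d i))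
      (Φ : groupAlgebraImage T ≃ₐ[ℂ] ∀ i, Matrix (Fin (d i)) (Fin (d i)) ℂ)
      (S : ∀ i, (Matrix (Fin (d i)) (Fin (d i)) ℂ)ˣ), ∀ γ i,
        (S i : Matrix _ _ ℂ) * Φ ⟨T γ, apply_mem_groupAlgebraImage γ⟩ i *
          (((S i)⁻¹ : (Matrix (Fin (d i)) (Fin (d i)) ℂ)ˣ) : Matrix _ _ ℂ) ∈
            unitaryGroup (Fin (d i)) ℂ := by
  classical
  choose m M hM htr using fun y => exists_algEquiv_mem_unitaryGroup
    ((Pi.evalMonoidHom (fun y => Module.End ℂ (W y)) y).comp T) (hb y)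
  obtain ⟨r, hr, hrT⟩ := exists_restriction_groupAlgebraImage hM htr hs
  have : FiniteDimensional ℂ (groupAlgebraImage T) :=
    FiniteDimensional.of_injective r (LinearMap.ker_eq_bot.1 hr)
  have := isSemisimpleRing_groupAlgebraImage hM
  obtain ⟨n, d, hd, ⟨Φ⟩⟩ :=
    IsSemisimpleRing.exists_algEquiv_pi_matrix_of_isAlgClosed ℂ (groupAlgebraImage T)
  obtain ⟨l, hl⟩ := r.exists_leftInverse_of_injective hr
  let T' : Γ →* groupAlgebraImage T := T.codRestrict _ apply_mem_groupAlgebraImage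
  -- a functional on the algebra extends to the product over `s`, where it is a sum of functionals
  -- of the factors
  have hbd : ∀ ψ : groupAlgebraImage T →ₗ[ℂ] ℂ, ∃ C : ℝ, ∀ γ, ‖ψ (T' γ)‖ ≤ C := by
    intro ψ
    choose C hC using fun y : s =>
      hb y (ψ ∘ₗ l ∘ₗ LinearMap.single ℂ (fun y : s => Module.End ℂ (W y)) y)
    refine ⟨∑ y, C y, fun γ => ?_⟩
    have h1 : ψ (T' γ) = ∑ y : s, (ψ ∘ₗ l ∘ₗ
        LinearMap.single ℂ (fun y : s => Module.End ℂ (W y)) y) (T γ y) := by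
      have h2 : T' γ = l (r (T' γ)) := (LinearMap.congr_fun hl _).symm
      have h3 : r (T' γ) =
          ∑ y : s, LinearMap.single ℂ (fun y : s => Module.End ℂ (W y)) y (T γ y) := by
        funext y
        rw [Finset.sum_apply]
        refine (hrT γ y).trans ?_
        rw [Finset.sum_eq_single_of_mem y (Finset.mem_univ y) fun z _ hz => ?_]
        · exact (Pi.single_eq_same (M := fun y : s => Module.End ℂ (W y)) y (T γ y)).symm
        · exact Pi.single_eq_of_ne (M := fun y : s => Module.End ℂ (W y)) hz.symm (T γ z)
      rw [h2, h3, map_sum, map_sum]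
      rfl
    rw [h1]
    exact (norm_sum_le _ _).trans (Finset.sum_le_sum fun y _ => hC y γ)
  choose S hS using fun i => exists_conj_mem_unitaryGroup
    ((Pi.evalMonoidHom (fun i => Matrix (Fin (d i)) (Fin (d i)) ℂ) i).comp
      ((Φ : _ →* _).comp T')) fun j k =>
    hbd ((LinearMap.proj k ∘ₗ LinearMap.proj j ∘ₗ LinearMap.proj i) ∘ₗ Φ.toLinearMap)
  exact ⟨n, d, hd, Φ, S, fun γ i => hS i γ⟩

end BoundedGroup

/-! ### Finiteness of the characters on the fixed locus -/

theorem Matrix.norm_trace_le_of_mem_unitaryGroup {n : ℕ} {A : Matrix (Fin n) (Fin n) ℂ}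
    (hA : A ∈ Matrix.unitaryGroup (Fin n) ℂ) : ‖A.trace‖ ≤ n := by
  refine (norm_sum_le _ _).trans ((Finset.sum_le_sum fun i _ =>
    entry_norm_bound_of_unitary hA i i).trans ?_)
  simp

theorem norm_trace_le_finrank {Γ : Type*} [Group Γ] {W : Type*} [AddCommGroup W] [Module ℂ W]
    [FiniteDimensional ℂ W] (ρ : Γ →* Module.End ℂ W)
    (hb : ∀ φ : Module.End ℂ W →ₗ[ℂ] ℂ, ∃ C : ℝ, ∀ γ, ‖φ (ρ γ)‖ ≤ C) (γ : Γ) :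
    ‖LinearMap.trace ℂ W (ρ γ)‖ ≤ Module.finrank ℂ W := by
  obtain ⟨m, M, hM, htr⟩ := exists_algEquiv_mem_unitaryGroup ρ hb
  have h1 : (m : ℂ) = Module.finrank ℂ W := by
    have := htr 1
    rw [map_one, Matrix.trace_one, Fintype.card_fin, LinearMap.trace_one] at this
    exact this
  rw [← htr, ← Nat.cast_inj.1 h1]
  exact Matrix.norm_trace_le_of_mem_unitaryGroup (hM γ)

namespace BundleData

variable {X : Type u} {𝒳 : FunSpace X} {E : BundleData.{u, w} X}

theorem IsFrame.exists_basis {ι : Type*} [Fintype ι] {U : Set X} {e : ι → ∀ x, E.fib x}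
    (he : IsFrame 𝒳 E U e) {x : X} (hx : x ∈ U) :
    ∃ b : Module.Basis ι ℂ (E.fib x), ∀ i, b i = e i x :=
  ⟨Module.Basis.mk (he.linearIndependent x hx) (he.span_eq_top x hx).ge, fun i => by simp⟩

theorem IsVectorBundle.finiteDimensional (hE : E.IsVectorBundle 𝒳) (x : X) :
    FiniteDimensional ℂ (E.fib x) := by
  obtain ⟨U, n, e, hx, he⟩ := isVectorBundle_iff.1 hE x
  obtain ⟨b, -⟩ := he.exists_basis hx
  exact b.finiteDimensional_of_finite

theorem IsVectorBundle.eventually_finrank_eq (hE : E.IsVectorBundle 𝒳) (x : X) :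
    ∀ᶠ y in 𝒳.nbhd x, Module.finrank ℂ (E.fib y) = Module.finrank ℂ (E.fib x) := by
  obtain ⟨U, n, e, hx, he⟩ := isVectorBundle_iff.1 hE x
  filter_upwards [he.isOpen.eventually_mem hx] with y hy
  obtain ⟨b, -⟩ := he.exists_basis hx
  obtain ⟨b', -⟩ := he.exists_basis hy
  rw [Module.finrank_eq_card_basis b, Module.finrank_eq_card_basis b']

/-- The trace of an endomorphism of a vector bundle is a regular function. -/
theorem IsVectorBundle.regAt_trace (h𝒳 : 𝒳.IsRinged) (hE : E.IsVectorBundle 𝒳)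
    {T : ∀ x, E.fib x →ₗ[ℂ] E.fib x} (hT : IsHom E E T) (x : X) :
    𝒳.RegAt (fun y => LinearMap.trace ℂ (E.fib y) (T y)) x := by
  obtain ⟨U, n, e, hx, he⟩ := isVectorBundle_iff.1 hE x
  choose c hc h using fun j => (he.regAt_iff _ x hx).1 (hT _ x (he.regAt h𝒳 j hx))
  refine 𝒳.congr' (h𝒳.sum Finset.univ fun j _ => hc j j) ?_
  filter_upwards [he.isOpen.eventually_mem hx, Filter.eventually_all.2 h] with y hy hTy
  obtain ⟨b, hb⟩ := he.exists_basis hy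
  rw [LinearMap.trace_eq_matrix_trace ℂ b, Matrix.trace]
  refine Finset.sum_congr rfl fun j _ => ?_
  rw [Matrix.diag_apply, LinearMap.toMatrix_apply, hb, hTy]
  simp [← hb, Finsupp.single_apply]

end BundleData

namespace EqBundleData

variable {G : Type v} [Group G] {X : Type u} [MulAction G X] {𝒢 : FunSpace G} {𝒳 : FunSpace X}
  {V : EqBundleData.{u, v, w} G X}

/-- The representation of the group generated by `g₁` and `g₂` on the fibres over the fixed
locus. -/
def fibreRep (𝒳 : FunSpace X) (V : EqBundleData.{u, v, w} G X) (g₁ g₂ : G) :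
    pairSubgroup g₁ g₂ →* ∀ y, Module.End ℂ ((V.restrictFixed 𝒳 g₁ g₂).fib y) where
  toFun γ := (V.fibreAut 𝒳 g₁ g₂ γ).toFun
  map_one' := funext fun _ => LinearMap.ext fun a => V.act_one _ a
  map_mul' γ γ' := funext fun y => LinearMap.ext fun a =>
    V.act_mul (γ : G) (γ' : G) (pairSubgroup_smul γ' y) (pairSubgroup_smul γ y) _ a

theorem fixedLocus_isClosed (hX : 𝒳.IsVariety)
    (hact : FunSpace.IsAlgebraicAction 𝒢 𝒳) (g₁ g₂ : G) : 𝒳.Open (fixedLocus X g₁ g₂)ᶜ := by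
  have h𝒳 := hX.isRinged
  have hg : ∀ g : G, 𝒳.Open {x | g • x ≠ x} := fun g =>
    hX.open_ne h𝒳 (hact.comp (FunSpace.isMorphism_prodMk h𝒳 (FunSpace.isMorphism_const h𝒳 g)
      FunSpace.isMorphism_id)) FunSpace.isMorphism_id
  have h : (fixedLocus X g₁ g₂)ᶜ = {x | g₁ • x ≠ x} ∪ {x | g₂ • x ≠ x} := by
    ext x
    simp only [fixedLocus, Set.mem_compl_iff, Set.mem_ofPred_eq, Set.mem_union]
    tauto
  rw [h]
  let _ := 𝒳.top
  exact IsOpen.union (hg g₁) (hg g₂)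

theorem fibreRep_bounded (h𝒢 : 𝒢.IsRinged) (h𝒳 : 𝒳.IsRinged) (hV : V.IsEquivariantBundle 𝒢 𝒳)
    {K : Subgroup G} (hK : @IsCompact G 𝒢.analyticTop (K : Set G)) {g₁ g₂ : G} (hg₁ : g₁ ∈ K)
    (hg₂ : g₂ ∈ K) (y : fixedLocus X g₁ g₂)
    (φ : Module.End ℂ ((V.restrictFixed 𝒳 g₁ g₂).fib y) →ₗ[ℂ] ℂ) :
    ∃ C : ℝ, ∀ γ, ‖φ (V.fibreRep 𝒳 g₁ g₂ γ y)‖ ≤ C := by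
  obtain ⟨C, hC⟩ := hV.bounded_act_of_isCompact h𝒢 h𝒳 hK (y : X) φ
  have hle : pairSubgroup g₁ g₂ ≤ K := by
    rw [Subgroup.closure_le]
    rintro a (rfl | rfl)
    · exact hg₁
    · exact hg₂
  exact ⟨C, fun γ => hC γ (hle γ.2) _⟩

/-- The characters of the group generated by `g₁` and `g₂` on the fibres over the fixed locus are
regular functions bounded by the rank, hence locally constant; so only finitely many occur. -/
theorem exists_finset_characters (hX : 𝒳.IsVariety) (h𝒢 : 𝒢.IsRinged)
    (hact : FunSpace.IsAlgebraicAction 𝒢 𝒳) (hV : V.IsEquivariantBundle 𝒢 𝒳)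
    {K : Subgroup G} (hK : @IsCompact G 𝒢.analyticTop (K : Set G)) {g₁ g₂ : G} (hg₁ : g₁ ∈ K)
    (hg₂ : g₂ ∈ K) : ∃ s : Finset (fixedLocus X g₁ g₂), ∀ y, ∃ y' ∈ s, ∀ γ,
      LinearMap.trace ℂ _ (V.fibreRep 𝒳 g₁ g₂ γ y') =
        LinearMap.trace ℂ _ (V.fibreRep 𝒳 g₁ g₂ γ y) := by
  have h𝒳 := hX.isRinged
  have hVB := restrictFixed_isVectorBundle h𝒳 hV g₁ g₂
  refine hX.exists_finset_joint_values _ (fun (γ : pairSubgroup g₁ g₂) y =>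
    LinearMap.trace ℂ ((V.restrictFixed 𝒳 g₁ g₂).fib y) (V.fibreRep 𝒳 g₁ g₂ γ y)) fun γ y => ?_
  refine hX.eventually_eq_of_bounded (fixedLocus_isClosed hX hact g₁ g₂)
    (hVB.regAt_trace (h𝒳.sub_isRinged _) (fibreAut_isHom h𝒢 h𝒳 hV g₁ g₂ γ) y)
    ⟨Module.finrank ℂ ((V.restrictFixed 𝒳 g₁ g₂).fib y), ?_⟩
  filter_upwards [hVB.eventually_finrank_eq y] with z hz
  rw [← hz]
  have := hVB.finiteDimensional z
  exact norm_trace_le_finrank ((Pi.evalMonoidHom _ z).comp (V.fibreRep 𝒳 g₁ g₂))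
    (fibreRep_bounded h𝒢 h𝒳 hV hK hg₁ hg₂ z) γ

end EqBundleData

/-! ### Spectral projections and logarithmic traces -/

section Eigenspaces

open Polynomial

variable {W : Type*} [AddCommGroup W] [Module ℂ W] {R : Finset ℂ} {B : Module.End ℂ W}

theorem aeval_apply_of_mem_eigenspace {μ : ℂ} {v : W} (hv : v ∈ B.eigenspace μ) (p : ℂ[X]) :
    aeval B p v = p.eval μ • v := by
  rw [Module.End.mem_eigenspace_iff] at hv
  induction p using Polynomial.induction_on' with
  | add p q hp hq => rw [map_add, LinearMap.add_apply, hp, hq, eval_add, add_smul]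
  | monomial n c =>
    have h : ∀ n : ℕ, (B ^ n) v = μ ^ n • v := fun n => by
      induction n with
      | zero => simp
      | succ n ih => rw [pow_succ', Module.End.mul_apply, ih, map_smul, hv, smul_smul, pow_succ]
    rw [aeval_monomial, Module.End.mul_apply, h, eval_monomial, ← smul_smul]
    rfl

theorem range_spectralProjection (hB : aeval B (∏ ν ∈ R, (X - C ν)) = 0) {μ : ℂ} (hμ : μ ∈ R) :
    LinearMap.range (spectralProjection R B μ) = B.eigenspace μ := by
  refine le_antisymm ?_ fun v hv => ⟨v, ?_⟩
  · rintro _ ⟨v, rfl⟩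
    rw [Module.End.mem_eigenspace_iff]
    exact LinearMap.congr_fun (mul_spectralProjection hB hμ) v
  · rw [spectralProjection, aeval_apply_of_mem_eigenspace hv,
      show (Lagrange.basis R id μ).eval μ = 1 from
        Lagrange.eval_basis_self Function.injective_id.injOn hμ, one_smul]

theorem eigenspace_eq_bot_of_notMem (hB : aeval B (∏ ν ∈ R, (X - C ν)) = 0) {μ : ℂ} (hμ : μ ∉ R) :
    B.eigenspace μ = ⊥ := by
  rw [eq_bot_iff]
  intro v hv
  have h := aeval_apply_of_mem_eigenspace hv (∏ ν ∈ R, (X - C ν))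
  rw [hB, LinearMap.zero_apply, eval_prod] at h
  refine (smul_eq_zero.1 h.symm).resolve_left (Finset.prod_ne_zero_iff.2 fun ν hν => ?_)
  rw [eval_sub, eval_X, eval_C, sub_ne_zero]
  rintro rfl
  exact hμ hν

theorem iSup_eigenspace_eq_top (hB : aeval B (∏ ν ∈ R, (X - C ν)) = 0) :
    ⨆ μ ∈ R, B.eigenspace μ = ⊤ := by
  rw [eq_top_iff]
  intro v _
  rcases R.eq_empty_or_nonempty with rfl | hR
  · have h : v = 0 := by simpa using LinearMap.congr_fun hB v
    rw [h]
    exact zero_mem _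
  · have h := LinearMap.congr_fun (sum_spectralProjection (T := B) hR) v
    rw [LinearMap.sum_apply, Module.End.one_apply] at h
    rw [← h]
    refine Submodule.sum_mem _ fun μ hμ => ?_
    refine Submodule.mem_iSup_of_mem μ (Submodule.mem_iSup_of_mem hμ ?_)
    rw [← range_spectralProjection hB hμ]
    exact ⟨v, rfl⟩

end Eigenspaces

namespace EqBundleData

open Polynomial

variable {G : Type v} [Group G] {X : Type u} [MulAction G X] {𝒢 : FunSpace G} {𝒳 : FunSpace X}
  {E : EqBundleData.{u, v, w} G X} {h𝒳 : 𝒳.IsRinged} {hE : E.toBundleData.IsVectorBundle 𝒳}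

theorem sub_congr {S S' : ∀ x, Submodule ℂ (E.fib x)}
    (hS : ∀ (g : G) {x y : X} (h : g • x = y), ∀ a ∈ S x, E.act g h a ∈ S y)
    (hS' : ∀ (g : G) {x y : X} (h : g • x = y), ∀ a ∈ S' x, E.act g h a ∈ S' y)
    (h : ∀ x, S x = S' x) : E.sub S hS = E.sub S' hS' := by
  obtain rfl : S = S' := funext h
  rfl

theorem eigenbundle_eq_image {t : E.FibreEnd} {α : ℝ} {q : E.endAlgebra h𝒳 hE}
    (h : ∀ x, LinearMap.range (q.1 x) =
      (t.toFun x).eigenspace (Complex.exp (2 * Real.pi * Complex.I * α))) :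
    E.eigenbundle t α = image q :=
  (sub_congr _ _ h).symm

variable (h𝒢 : 𝒢.IsRinged) (hact : FunSpace.IsAlgebraicAction 𝒢 𝒳)
  (hE' : E.IsEquivariantBundle 𝒢 𝒳) {t : E.FibreEnd} {a : E.endAlgebra h𝒳 hE}
  (ha : a.1 = t.toFun) {R : Finset ℂ} (hR : ∀ ν ∈ R, ‖ν‖ = 1)
  (haR : aeval a (∏ ν ∈ R, (Polynomial.X - C ν)) = 0)

/-- The evaluation of endomorphisms of a bundle at a point. -/
def evalEnd (h𝒳 : 𝒳.IsRinged) (hE : E.toBundleData.IsVectorBundle 𝒳) (x : X) :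
    E.endAlgebra h𝒳 hE →ₐ[ℂ] Module.End ℂ (E.fib x) :=
  (Pi.evalAlgHom ℂ (fun x => Module.End ℂ (E.fib x)) x).comp (E.endAlgebra h𝒳 hE).val

include ha haR in
theorem aeval_toFun_eq_zero (x : X) : aeval (t.toFun x) (∏ ν ∈ R, (Polynomial.X - C ν)) = 0 := by
  have h : evalEnd h𝒳 hE x a = t.toFun x := congrFun ha x
  rw [← h, aeval_algHom_apply, haR, map_zero]

include ha haR in
theorem eigenbundle_eq_image_spectralProjection {ν : ℂ} (hν : ν ∈ R) {α : ℝ}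
    (hα : Complex.exp (2 * Real.pi * Complex.I * α) = ν) :
    E.eigenbundle t α = image (spectralProjection R a ν) := by
  refine eigenbundle_eq_image fun x => ?_
  rw [hα, ← range_spectralProjection (aeval_toFun_eq_zero ha haR x) hν, ← congrFun ha x]
  exact congrArg LinearMap.range (map_spectralProjection (evalEnd h𝒳 hE x) ν)

include ha haR in
theorem eigenbundle_eq_image_zero {α : ℝ}
    (hα : Complex.exp (2 * Real.pi * Complex.I * α) ∉ R) :
    E.eigenbundle t α = image (0 : E.endAlgebra h𝒳 hE) := by
  refine eigenbundle_eq_image fun x => ?_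
  rw [eigenspace_eq_bot_of_notMem (aeval_toFun_eq_zero ha haR x) hα]
  exact LinearMap.range_zero

include h𝒢 hact hE' ha hR haR in
/-- An endomorphism that is annihilated by a polynomial with simple roots of absolute value one has
a logarithmic trace: its eigenbundles are the images of the spectral projections. -/
theorem hasLogTrace_of_aeval_eq_zero : E.HasLogTrace 𝒢 𝒳 t where
  bundle := hE'
  eigen α _ := by
    by_cases hα : Complex.exp (2 * Real.pi * Complex.I * α) ∈ R
    · rw [eigenbundle_eq_image_spectralProjection ha haR hα rfl]
      refine image_isEquivariantBundle h𝒢 hact hE' ?_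
      rw [spectralProjection_mul_spectralProjection haR hα hα, if_pos rfl]
    · rw [eigenbundle_eq_image_zero ha haR hα]
      exact image_isEquivariantBundle h𝒢 hact hE' (mul_zero 0)
  finite := by
    refine (R.finite_toSet.image eigenAngle).subset ?_
    rintro α ⟨hα, x, hx⟩
    refine ⟨_, ?_, eigenAngle_exp hα⟩
    by_contra h
    change Nontrivial ((t.toFun x).eigenspace (Complex.exp (2 * Real.pi * Complex.I * α))) at hx
    rw [eigenspace_eq_bot_of_notMem (aeval_toFun_eq_zero ha haR x) h] at hx
    exact not_subsingleton (⊥ : Submodule ℂ (E.fib x)) inferInstance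
  span x := by
    rw [eq_top_iff, ← iSup_eigenspace_eq_top (aeval_toFun_eq_zero ha haR x)]
    refine iSup₂_le fun ν hν => ?_
    refine le_trans ?_ (le_iSup₂_of_le (eigenAngle ν) ⟨eigenAngle_nonneg _, eigenAngle_lt_one _⟩
      le_rfl)
    rw [exp_eigenAngle (hR ν hν)]

include h𝒢 hact hE' ha hR haR in
theorem logTrace_eq_sum : E.logTrace 𝒢 𝒳 t =
    ∑ ν ∈ R, eigenAngle ν ⊗ₜ[ℤ] (image (spectralProjection R a ν)).cls 𝒢 𝒳 := by
  classical
  have hinj : Set.InjOn eigenAngle R := by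
    intro ν hν ν' hν' h
    rw [← exp_eigenAngle (hR ν hν), ← exp_eigenAngle (hR ν' hν'), h]
  have h0 : ∀ α : ℝ, Complex.exp (2 * Real.pi * Complex.I * α) ∉ R →
      (E.eigenbundle t α).cls 𝒢 𝒳 = 0 := by
    intro α hα
    rw [eigenbundle_eq_image_zero ha haR hα]
    exact (isIdempotentAdditive_cls_image h𝒢 hact hE').map_zero
  rw [logTrace, finsum_mem_eq_sum_of_inter_support_eq (t := R.image eigenAngle),
    Finset.sum_image hinj]
  · refine Finset.sum_congr rfl fun ν hν => ?_
    rw [eigenbundle_eq_image_spectralProjection ha haR hν (exp_eigenAngle (hR ν hν))]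
  · ext α
    simp only [Set.mem_inter_iff, Finset.coe_image, Set.mem_image, Finset.mem_coe]
    refine and_congr_left fun hα => ⟨fun h => ⟨_, ?_, eigenAngle_exp h⟩, ?_⟩
    · by_contra h'
      exact hα ((congrArg (α ⊗ₜ[ℤ] ·) (h0 α h')).trans (TensorProduct.tmul_zero _ _))
    · rintro ⟨ν, -, rfl⟩
      exact ⟨eigenAngle_nonneg _, eigenAngle_lt_one _⟩

end EqBundleData

/-! ### Logarithmic traces in a semisimple algebra of endomorphisms -/

theorem IsIdempotentAdditive.comp {R S M : Type*} [Ring R] [Ring S] [AddCommGroup M] {f : R → M}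
    (hf : IsIdempotentAdditive f) (φ : S →+* R) : IsIdempotentAdditive fun s => f (φ s) where
  add p q hp hq hpq hqp := by
    rw [map_add]
    exact hf.add (φ p) (φ q) (by rw [← map_mul, hp]) (by rw [← map_mul, hq])
      (by rw [← map_mul, hpq, _root_.map_zero]) (by rw [← map_mul, hqp, _root_.map_zero])
  conj x y p q hp hq hxy hyx := hf.conj (φ x) (φ y) _ _ (by rw [← map_mul, hp])
    (by rw [← map_mul, hq]) (by rw [← map_mul, hxy]) (by rw [← map_mul, hyx])

section Matrices

open Matrix Polynomial

theorem Matrix.aeval_conj_diagonal {d : ℕ} {U U' : Matrix (Fin d) (Fin d) ℂ} (h : U' * U = 1)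
    (μ : Fin d → ℂ) (p : ℂ[X]) :
    aeval (U * diagonal μ * U') p = U * diagonal (fun j => p.eval (μ j)) * U' := by
  have h' : U * U' = 1 := mul_eq_one_comm.1 h
  induction p using Polynomial.induction_on' with
  | add p q hp hq =>
    simp only [map_add, hp, hq, eval_add, ← diagonal_add, mul_add, add_mul]
  | monomial n c =>
    have hn : (U * diagonal μ * U') ^ n = U * diagonal (μ ^ n) * U' := by
      induction n with
      | zero => simp [h']
      | succ n ih =>
        have h1 : diagonal (μ ^ (n + 1)) = diagonal (μ ^ n) * diagonal μ := by
          rw [diagonal_mul_diagonal, pow_succ]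
          rfl
        rw [pow_succ, ih, h1]
        calc U * diagonal (μ ^ n) * U' * (U * diagonal μ * U')
            = U * diagonal (μ ^ n) * (U' * U) * diagonal μ * U' := by simp only [mul_assoc]
          _ = _ := by rw [h, mul_one]; simp only [mul_assoc]
    rw [aeval_monomial, hn, ← Algebra.smul_def]
    have : (fun j => (monomial n c).eval (μ j)) = c • μ ^ n := by
      funext j
      simp
    rw [this, diagonal_smul, mul_smul_comm, smul_mul_assoc]

/-- A matrix that is conjugate to a unitary one is diagonalizable with eigenvalues of absolute value
one. -/
theorem Matrix.exists_eq_conj_diagonal {d : ℕ} {A S S' : Matrix (Fin d) (Fin d) ℂ} (hS : S' * S = 1)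
    (hA : S * A * S' ∈ unitaryGroup (Fin d) ℂ) :
    ∃ (U U' : Matrix (Fin d) (Fin d) ℂ) (μ : Fin d → ℂ), U' * U = 1 ∧ (∀ j, ‖μ j‖ = 1) ∧
      A = U * diagonal μ * U' := by
  obtain ⟨Q, hQ, μ, hμ, h⟩ := exists_unitary_diagonalization hA
  have hS' : S * S' = 1 := mul_eq_one_comm.1 hS
  refine ⟨S' * Q, star Q * S, μ, ?_, hμ, ?_⟩
  · calc star Q * S * (S' * Q) = star Q * (S * S') * Q := by simp only [mul_assoc]
      _ = 1 := by rw [hS', mul_one, mem_unitaryGroup_iff'.1 hQ]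
  · calc A = (S' * S) * A * (S' * S) := by rw [hS, one_mul, mul_one]
      _ = S' * (S * A * S') * S := by simp only [mul_assoc]
      _ = _ := by rw [h]; simp only [mul_assoc]

variable {n : ℕ} {d : Fin n → ℕ} {A S S' : ∀ i, Matrix (Fin (d i)) (Fin (d i)) ℂ}

/-- In a product of matrix algebras, an element `A` with unitarizable components is annihilated by a
polynomial with simple roots of absolute value one, and a function of the spectral projections of
`A`, weighted by the angles of the eigenvalues, is the combination of the values at the elementary
idempotents with coefficients `logDegree (A i)`. -/
theorem exists_finset_spectralProjection [∀ i, NeZero (d i)] (hS : ∀ i, S' i * S i = 1)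
    (hA : ∀ i, S i * A i * S' i ∈ unitaryGroup (Fin (d i)) ℂ) :
    ∃ R : Finset ℂ, (∀ ν ∈ R, ‖ν‖ = 1) ∧ aeval A (∏ ν ∈ R, (X - C ν)) = 0 ∧
      ∀ {M : Type*} [AddCommGroup M] {f : (∀ i, Matrix (Fin (d i)) (Fin (d i)) ℂ) → M},
        IsIdempotentAdditive f → ∑ ν ∈ R, eigenAngle ν ⊗ₜ[ℤ] f (spectralProjection R A ν) =
          ∑ i, logDegree (A i) ⊗ₜ[ℤ] f (Pi.single i (Matrix.single 0 0 1)) := by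
  classical
  choose U U' μ hU hμ hAU using fun i => Matrix.exists_eq_conj_diagonal (hS i) (hA i)
  have heval : ∀ (p : ℂ[X]), aeval A p = fun i =>
      U i * diagonal (fun j => p.eval (μ i j)) * U' i := by
    intro p
    funext i
    have h := aeval_algHom_apply (Pi.evalAlgHom ℂ (fun i => Matrix (Fin (d i)) (Fin (d i)) ℂ) i) A p
    refine h.symm.trans ?_
    rw [Pi.evalAlgHom_apply, hAU i, Matrix.aeval_conj_diagonal (hU i)]
  let R : Finset ℂ := Finset.univ.image fun x : Σ i, Fin (d i) => μ x.1 x.2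
  have hR : ∀ i j, μ i j ∈ R := fun i j =>
    Finset.mem_image_of_mem _ (Finset.mem_univ (⟨i, j⟩ : Σ i, Fin (d i)))
  refine ⟨R, ?_, ?_, ?_⟩
  · intro ν hν
    obtain ⟨x, -, rfl⟩ := Finset.mem_image.1 hν
    exact hμ _ _
  · rw [heval]
    funext i
    have : (fun j => (∏ ν ∈ R, (X - C ν)).eval (μ i j)) = fun _ => 0 := by
      funext j
      rw [eval_prod]
      exact Finset.prod_eq_zero (hR i j) (by simp)
    rw [this, diagonal_zero, mul_zero, zero_mul]
    rfl
  · intro M _ f hf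
    -- the spectral projection for `ν` has rank the multiplicity of `ν` in each factor
    have h1 : ∀ ν ∈ R, f (spectralProjection R A ν) =
        ∑ i, (Finset.univ.filter fun j => μ i j = ν).card •
          f (Pi.single i (Matrix.single 0 0 1)) := by
      intro ν hν
      rw [← hf.apply_conj_diagonal U U' hU, spectralProjection, heval]
      congr 1
      funext i
      congr 3
      funext j
      simp only [Finset.mem_filter, Finset.mem_univ, true_and]
      split_ifs with h
      · rw [h]
        exact Lagrange.eval_basis_self Function.injective_id.injOn hν
      · exact Lagrange.eval_basis_of_ne (v := id) (Ne.symm h) (hR i j)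
    rw [Finset.sum_congr rfl fun ν hν => by rw [h1 ν hν, TensorProduct.tmul_sum], Finset.sum_comm]
    refine Finset.sum_congr rfl fun i _ => ?_
    have h2 : logDegree (A i) =
        ∑ ν ∈ R, (Finset.univ.filter fun j => μ i j = ν).card • eigenAngle ν := by
      rw [hAU i, logDegree_conj (hU i), logDegree_diagonal,
        ← Finset.sum_fiberwise_of_maps_to (t := R) (g := μ i) fun j _ => hR i j]
      refine Finset.sum_congr rfl fun ν _ => ?_
      rw [Finset.sum_congr rfl fun j hj => by rw [(Finset.mem_filter.1 hj).2], Finset.sum_const]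
    rw [h2, TensorProduct.sum_tmul]
    refine Finset.sum_congr rfl fun ν _ => ?_
    rw [← natCast_zsmul, ← natCast_zsmul, TensorProduct.tmul_smul, TensorProduct.smul_tmul']

end Matrices

namespace EqBundleData

open Polynomial

variable {G : Type v} [Group G] {X : Type u} [MulAction G X] {𝒢 : FunSpace G} {𝒳 : FunSpace X}
  {E : EqBundleData.{u, v, w} G X}

/-- Let a group act on an equivariant bundle by automorphisms that generate a product of matrix
algebras, and be unitarizable in each factor. Then logarithmic traces exist, and their failure to be
additive is the class of a bundle: in the factor `i` it is given by the non-negative integer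
`logDegree A + logDegree B - logDegree (A * B)`, which is at most the size of the factor and
therefore the rank of an idempotent. -/
theorem hasLogTrace_and_exists_cls_eq (h𝒢 : 𝒢.IsRinged) (h𝒳 : 𝒳.IsRinged)
    (hact : FunSpace.IsAlgebraicAction 𝒢 𝒳) (hE : E.IsEquivariantBundle 𝒢 𝒳)
    {Γ : Type*} [Group Γ] {T : Γ →* ∀ x, Module.End ℂ (E.fib x)} {t : Γ → E.FibreEnd}
    (htT : ∀ γ, (t γ).toFun = T γ) (hT : ∀ γ, IsEqHom E E (T γ)) {n : ℕ} {d : Fin n → ℕ}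
    [∀ i, NeZero (d i)] (Φ : groupAlgebraImage T ≃ₐ[ℂ] ∀ i, Matrix (Fin (d i)) (Fin (d i)) ℂ)
    (S : ∀ i, (Matrix (Fin (d i)) (Fin (d i)) ℂ)ˣ)
    (hS : ∀ γ i, (S i : Matrix _ _ ℂ) * Φ ⟨T γ, apply_mem_groupAlgebraImage γ⟩ i *
      (((S i)⁻¹ : (Matrix (Fin (d i)) (Fin (d i)) ℂ)ˣ) : Matrix _ _ ℂ) ∈
        Matrix.unitaryGroup (Fin (d i)) ℂ) :
    (∀ γ, E.HasLogTrace 𝒢 𝒳 (t γ)) ∧ ∀ a b, ∃ F : EqVB.{u, v, w} 𝒢 𝒳,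
      E.logTrace 𝒢 𝒳 (t a) + E.logTrace 𝒢 𝒳 (t b) - E.logTrace 𝒢 𝒳 (t (a * b))
        = (1 : ℝ) ⊗ₜ[ℤ] F.cls := by
  have hVB := hE.isVectorBundle
  have hle : groupAlgebraImage T ≤ E.endAlgebra h𝒳 hVB := Algebra.adjoin_le (by
    rintro _ ⟨γ, rfl⟩
    exact hT γ)
  let ψ := (Subalgebra.inclusion hle).comp Φ.symm.toAlgHom
  let A : Γ → ∀ i, Matrix (Fin (d i)) (Fin (d i)) ℂ := fun γ =>
    Φ ⟨T γ, apply_mem_groupAlgebraImage γ⟩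
  let f : (∀ i, Matrix (Fin (d i)) (Fin (d i)) ℂ) → KGroup.{u, v, w} 𝒢 𝒳 := fun q =>
    (image (ψ q)).cls 𝒢 𝒳
  have hf : IsIdempotentAdditive f := (isIdempotentAdditive_cls_image h𝒢 hact hE).comp ψ.toRingHom
  have hψ : ∀ γ, (ψ (A γ)).1 = (t γ).toFun := by
    intro γ
    have : Φ.symm (A γ) = ⟨T γ, apply_mem_groupAlgebraImage γ⟩ := Φ.symm_apply_apply _
    rw [htT]
    exact congrArg Subtype.val this
  have hinv : ∀ i, (((S i)⁻¹ : (Matrix (Fin (d i)) (Fin (d i)) ℂ)ˣ) :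
      Matrix (Fin (d i)) (Fin (d i)) ℂ) * (S i : Matrix (Fin (d i)) (Fin (d i)) ℂ) = 1 :=
    fun i => Units.inv_mul _
  have key : ∀ γ, E.HasLogTrace 𝒢 𝒳 (t γ) ∧ E.logTrace 𝒢 𝒳 (t γ) =
      ∑ i, logDegree (A γ i) ⊗ₜ[ℤ] f (Pi.single i (Matrix.single 0 0 1)) := by
    intro γ
    obtain ⟨R, hR, hAR, h⟩ := exists_finset_spectralProjection hinv (hS γ)
    have haR : aeval (ψ (A γ)) (∏ ν ∈ R, (Polynomial.X - C ν)) = 0 := by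
      rw [aeval_algHom_apply, hAR, map_zero]
    refine ⟨hasLogTrace_of_aeval_eq_zero h𝒢 hact hE (hψ γ) hR haR, ?_⟩
    rw [logTrace_eq_sum h𝒢 hact hE (hψ γ) hR haR, ← h hf]
    refine Finset.sum_congr rfl fun ν _ => ?_
    rw [← map_spectralProjection]
  refine ⟨fun γ => (key γ).1, fun a b => ?_⟩
  have hmul : ∀ i, A (a * b) i = A a i * A b i := by
    intro i
    have h : (⟨T (a * b), apply_mem_groupAlgebraImage _⟩ : groupAlgebraImage T) =
        ⟨T a, apply_mem_groupAlgebraImage a⟩ * ⟨T b, apply_mem_groupAlgebraImage b⟩ :=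
      Subtype.ext (map_mul T a b)
    exact (congrFun (congrArg Φ h) i).trans (congrFun (map_mul Φ _ _) i)
  choose k hk hkl using fun i => exists_nat_logDegree_mul (hinv i) (hS a i) (hS b i)
  -- the diagonal idempotent with rank `k i` in the factor `i`
  let s : ∀ i, Finset (Fin (d i)) := fun i => Finset.univ.filter fun j => (j : ℕ) < k i
  have hs : ∀ i, (s i).card = k i := fun i => by
    rw [Fin.card_filter_val_lt, min_eq_right (hk i)]
  let q : ∀ i, Matrix (Fin (d i)) (Fin (d i)) ℂ := fun i =>
    1 * Matrix.diagonal (fun j => if j ∈ s i then 1 else 0) * 1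
  have hq : q * q = q := by
    funext i
    simp only [q, Pi.mul_apply, one_mul, mul_one, Matrix.diagonal_mul_diagonal, mul_ite, mul_zero]
    congr 1
    funext j
    split_ifs <;> rfl
  have hqE : (image (ψ q)).IsEquivariantBundle 𝒢 𝒳 :=
    image_isEquivariantBundle h𝒢 hact hE (by rw [← map_mul, hq])
  refine ⟨⟨image (ψ q), hqE⟩, ?_⟩
  have hfq : EqVB.cls ⟨image (ψ q), hqE⟩ = ∑ i, k i • f (Pi.single i (Matrix.single 0 0 1)) := by
    rw [← hqE.cls_eq]
    refine (hf.apply_conj_diagonal 1 1 (fun i => one_mul _) s).trans ?_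
    simp only [hs]
  rw [hfq, (key a).2, (key b).2, (key (a * b)).2, ← Finset.sum_add_distrib,
    ← Finset.sum_sub_distrib, TensorProduct.tmul_sum]
  refine Finset.sum_congr rfl fun i _ => ?_
  rw [← TensorProduct.add_tmul, ← TensorProduct.sub_tmul, hmul, hkl, ← natCast_zsmul,
    ← TensorProduct.smul_tmul]
  simp

end EqBundleData

/-- For `g₁, g₂` in a compact subgroup of an algebraic group `G` acting on a variety `X`, and a
`G`-equivariant vector bundle `V` on `X`, the logarithmic traces on `X^{g₁,g₂}` are well defined,
and `V⁺(g₁,g₂)` and `V⁻(g₁,g₂)` are classes of `Z_G(g₁,g₂)`-equivariant vector bundles. -/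
theorem mainTheorem7 {G : Type v} [Group G] (𝒢 : FunSpace G) (hG : 𝒢.IsAlgebraicGroup)
    {X : Type u} [MulAction G X] (𝒳 : FunSpace X) (hX : 𝒳.IsVariety)
    (hact : FunSpace.IsAlgebraicAction 𝒢 𝒳)
    (V : EqBundleData.{u, v, w} G X) (hV : V.IsEquivariantBundle 𝒢 𝒳)
    (K : Subgroup G) (hK : @IsCompact G 𝒢.analyticTop (K : Set G))
    (g₁ g₂ : G) (hg₁ : g₁ ∈ K) (hg₂ : g₂ ∈ K) :
    (∀ g : pairSubgroup g₁ g₂, (V.restrictFixed 𝒳 g₁ g₂).HasLogTrace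
      (centralizerSpace 𝒢 g₁ g₂) (fixedSpace 𝒳 g₁ g₂) (V.fibreAut 𝒳 g₁ g₂ g)) ∧
    (∃ F : EqVB.{u, v, w} (centralizerSpace 𝒢 g₁ g₂) (fixedSpace 𝒳 g₁ g₂),
      V.plusClass 𝒢 𝒳 g₁ g₂ = (1 : ℝ) ⊗ₜ[ℤ] F.cls) ∧
    (∃ F : EqVB.{u, v, w} (centralizerSpace 𝒢 g₁ g₂) (fixedSpace 𝒳 g₁ g₂),
      V.minusClass 𝒢 𝒳 g₁ g₂ = (1 : ℝ) ⊗ₜ[ℤ] F.cls) := by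
  have h𝒢 := hG.variety.isRinged
  have h𝒳 := hX.isRinged
  have := fun y => (EqBundleData.restrictFixed_isVectorBundle h𝒳 hV g₁ g₂).finiteDimensional y
  obtain ⟨s, hs⟩ := EqBundleData.exists_finset_characters hX h𝒢 hact hV hK hg₁ hg₂
  obtain ⟨n, d, hd, Φ, S, hS⟩ := exists_algEquiv_pi_matrix_groupAlgebraImage
    (T := V.fibreRep 𝒳 g₁ g₂) (EqBundleData.fibreRep_bounded h𝒢 h𝒳 hV hK hg₁ hg₂) hs
  obtain ⟨hlog, h⟩ := EqBundleData.hasLogTrace_and_exists_cls_eq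
    (G := pairCentralizer g₁ g₂) (X := fixedLocus X g₁ g₂)
    (h𝒢.sub_isRinged (pairCentralizer g₁ g₂ : Set G)) (h𝒳.sub_isRinged (fixedLocus X g₁ g₂))
    (EqBundleData.isAlgebraicAction_fixed h𝒢 h𝒳 hact g₁ g₂)
    (EqBundleData.restrictFixed_isEquivariantBundle h𝒢 h𝒳 hact hV g₁ g₂)
    (t := V.fibreAut 𝒳 g₁ g₂) (fun _ => rfl)
    (fun γ => ⟨EqBundleData.fibreAut_isHom h𝒢 h𝒳 hV g₁ g₂ γ, fun g _ _ e a =>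
      (V.fibreAut 𝒳 g₁ g₂ γ).comm g e a⟩) Φ S hS
  refine ⟨hlog, h _ _, ?_⟩
  -- `L(g₂⁻¹) + L(g₁⁻¹) - L(g₂⁻¹ g₁⁻¹)`: the summands of `V⁻` occur in the other order
  obtain ⟨F, hF⟩ := h (pairSnd g₁ g₂)⁻¹ (pairFst g₁ g₂)⁻¹
  refine ⟨F, ?_⟩
  rw [← hF, EqBundleData.minusClass, add_comm (V.fixedLogTrace 𝒢 𝒳 g₁ g₂ (pairFst g₁ g₂)⁻¹)]
  rfl
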